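/- Let $m\ge 2$, let $(M,g)$ be a smooth Riemannian Einstein manifold of dimension $m+1$ (i.e. $\mathrm{ric}=c\,g$ for a constant $c$) with scalar curvature $S$, and let $\Sigma$ be a smooth oriented immersed hypersurface of $M$ without boundary, with oriented unit normal $n$. Write $D$ for the Levi-Civita connection of $M$, $I$ for the induced metric on $\Sigma$, $dA$ for its area measure, $BX=-D_Xn$ for the shape operator, $I\!I(X,Y)=I(X,BY)$ for the second fundamental form and $H=\mathrm{tr}\,B$ for the mean curvature; $\langle\cdot,\cdot\rangle$ is the scalar product of 2-tensors on $\Sigma$ defined by $I$. Let $v$ be a section of $TM|_\Sigma$, and let $(\phi_t)_{|t|<\varepsilon}$ be any smooth deformation of $\Sigma$ through immersions with $\partial_t\phi_t|_{t=0}=v$, which is constant in $t$ outside of a compact subset of $\Sigma$ (no condition if $\Sigma$ is compact). Let $I_t$ and $H_t$ be the induced metric and the mean curvature of $\phi_t$, with respect to the oriented unit normal $n_t$ depending smoothly on $t$, with $n_0=n$, and let $V_t$ be the oriented volume swept out between $\phi_0$ and $\phi_t$ (counted positively when the hypersurface moves to the side of its normal). Then $I_t$, $H_t$ and $V_t$ are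 differentiable at $t=0$; denote their derivatives by $I'$, $H'$ and $V'$. The function $H'+\frac12\langle I',I\!I\rangle$ is integrable on $\Sigma$, and $$\frac{S}{m+1}\,V'=\int_\Sigma\Big(H'+\frac12\langle I',I\!I\rangle\Big)\,dA .$$ If moreover the $\phi_t$ are embeddings whose images bound domains $\Omega_t\subset M$ of finite volume with exterior normal $n_t$, deforming along with their boundaries (no point outside of $\phi_t(\Sigma)$ enters or leaves the domain at time $t$), then $V'$ is also the derivative at $t=0$ of the volume of $\Omega_t$. -/

import Mathlib

open scoped Manifold ContDiff Topology
open Set Filter MeasureTheory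

-- This instance would hide the standard charted space structure of `EuclideanSpace ℝ (Fin n)`.
attribute [-instance] TopCat.of.chartedSpace

noncomputable section

namespace Schlaefli

section Tensors

variable {n : ℕ} {M : Type*} [TopologicalSpace M] [ChartedSpace (EuclideanSpace ℝ (Fin n)) M]

/-- Covariant 2-tensor fields on `M`: a real function of two tangent vectors at each point (all the
ones used below are bilinear). -/
abbrev TensorField (n : ℕ) (M : Type*) [TopologicalSpace M]
    [ChartedSpace (EuclideanSpace ℝ (Fin n)) M] : Type _ :=
  ∀ x : M, TangentSpace (𝓡 n) x → TangentSpace (𝓡 n) x → ℝ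

/-- The `i`-th vector of the coordinate basis of the tangent space at `x` (given by the preferred
chart at `x`). -/
def stdVec (x : M) (i : Fin n) : TangentSpace (𝓡 n) x :=
  (EuclideanSpace.single i (1 : ℝ) : EuclideanSpace ℝ (Fin n))

/-- Matrix of the tensor `b` at `x` in the coordinate basis of the tangent space. -/
def gram (b : TensorField n M) (x : M) : Matrix (Fin n) (Fin n) ℝ :=
  Matrix.of fun i j => b x (stdVec x i) (stdVec x j)

/-- Trace of the 2-tensor `c` with respect to the metric `b`: `b^{ij} c_{ij}`. -/
def traceWith (b c : TensorField n M) (x : M) : ℝ :=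
  ((gram b x)⁻¹ * gram c x).trace

/-- Scalar product of the 2-tensors `c` and `d` with respect to the metric `b`:
`b^{ik} b^{jl} c_{ij} d_{kl}`. -/
def innerWith (b c d : TensorField n M) (x : M) : ℝ :=
  ((gram b x)⁻¹ * gram c x * (gram b x)⁻¹ * (gram d x).transpose).trace

/-- Components of the tensor `b` in the preferred chart at `p`, as a function of the
coordinate `y`. -/
def chartGram (b : TensorField n M) (p : M) (y : EuclideanSpace ℝ (Fin n)) :
    Matrix (Fin n) (Fin n) ℝ :=
  Matrix.of fun i j =>
    b ((extChartAt (𝓡 n) p).symm y)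
      (mfderiv 𝓘(ℝ, EuclideanSpace ℝ (Fin n)) (𝓡 n) (extChartAt (𝓡 n) p).symm y
        (EuclideanSpace.single i (1 : ℝ) : EuclideanSpace ℝ (Fin n)))
      (mfderiv 𝓘(ℝ, EuclideanSpace ℝ (Fin n)) (𝓡 n) (extChartAt (𝓡 n) p).symm y
        (EuclideanSpace.single j (1 : ℝ) : EuclideanSpace ℝ (Fin n)))

/-- The Riemannian measure of the metric `b`: the smallest Borel measure that dominates, for every
chart, the measure with density `√(det b_{ij})` in this chart. These local measures agree on
overlaps, so on the domain of each chart it is given by `√(det b_{ij}) dy`. -/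
def riemannianMeasure [MeasurableSpace M] (b : TensorField n M) : Measure M :=
  ⨆ p : M, Measure.map (extChartAt (𝓡 n) p).symm
    ((volume.restrict (extChartAt (𝓡 n) p).target).withDensity
      fun y => ENNReal.ofReal √(chartGram b p y).det)

/-- Partial derivative in the `i`-th coordinate direction. -/
def partialDeriv (i : Fin n) (f : EuclideanSpace ℝ (Fin n) → ℝ)
    (y : EuclideanSpace ℝ (Fin n)) : ℝ :=
  fderiv ℝ f y (EuclideanSpace.single i (1 : ℝ))

/-- Christoffel symbol `Γ^k_{ij}` of the Levi-Civita connection of the metric `b`, in the preferred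
chart at `p`. -/
def christoffel (b : TensorField n M) (p : M) (k i j : Fin n)
    (y : EuclideanSpace ℝ (Fin n)) : ℝ :=
  (1 / 2) * ∑ l, (chartGram b p y)⁻¹ k l *
    (partialDeriv i (fun z => chartGram b p z j l) y
      + partialDeriv j (fun z => chartGram b p z i l) y
      - partialDeriv l (fun z => chartGram b p z i j) y)

/-- Component `R^l_{kij}` of the curvature tensor, `R(∂_i, ∂_j) ∂_k = R^l_{kij} ∂_l`, where
`R(X, Y) Z = D_X D_Y Z - D_Y D_X Z - D_{[X, Y]} Z`, in the preferred chart at `p`. -/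
def riemann (b : TensorField n M) (p : M) (l k i j : Fin n)
    (y : EuclideanSpace ℝ (Fin n)) : ℝ :=
  partialDeriv i (christoffel b p l j k) y - partialDeriv j (christoffel b p l i k) y
    + ∑ a, (christoffel b p l i a y * christoffel b p a j k y
        - christoffel b p l j a y * christoffel b p a i k y)

/-- The Ricci tensor, `ric(Y, Z) = tr (X ↦ R(X, Y) Z)`, computed at `p` in the preferred chart
at `p`. -/
def ricci (b : TensorField n M) : TensorField n M := fun p Y Z =>
  let Yc : EuclideanSpace ℝ (Fin n) := Y
  let Zc : EuclideanSpace ℝ (Fin n) := Z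
  ∑ j, ∑ k, (∑ i, riemann b p i k i j (extChartAt (𝓡 n) p p)) * Yc j * Zc k

/-- Scalar curvature: the metric trace of the Ricci tensor. -/
def scalarCurvature (b : TensorField n M) (p : M) : ℝ := traceWith b (ricci b) p

/-- The metric `b` is Einstein: the Ricci tensor is a constant multiple of the metric. -/
def IsEinstein (b : TensorField n M) : Prop :=
  ∃ c : ℝ, ∀ (p : M) (Y Z : TangentSpace (𝓡 n) p), ricci b p Y Z = c * b p Y Z

variable {k : ℕ} {N : Type*} [TopologicalSpace N] [ChartedSpace (EuclideanSpace ℝ (Fin k)) N]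

/-- Covariant derivative `D_X Y` at `x`, for the Levi-Civita connection of `b`, of a vector field
`Y` along a map `f : N → M`, in the direction `X` tangent to `N` at `x`. In the preferred chart at
`f x` it is `dY^l(X) + Γ^l_{ij} df(X)^i Y^j`. -/
def covDerivAlong (b : TensorField n M) (f : N → M) (Y : ∀ x : N, TangentSpace (𝓡 n) (f x))
    (x : N) (X : TangentSpace (𝓡 k) x) : TangentSpace (𝓡 n) (f x) :=
  let coords : N → EuclideanSpace ℝ (Fin n) := fun y =>
    mfderiv (𝓡 n) 𝓘(ℝ, EuclideanSpace ℝ (Fin n)) (extChartAt (𝓡 n) (f x)) (f y) (Y y)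
  let dY : EuclideanSpace ℝ (Fin n) :=
    mfderiv (𝓡 k) 𝓘(ℝ, EuclideanSpace ℝ (Fin n)) coords x X
  let dfX : EuclideanSpace ℝ (Fin n) := mfderiv (𝓡 k) (𝓡 n) f x X
  (WithLp.toLp 2 fun l => dY l + ∑ i, ∑ j,
    christoffel b (f x) l i j (extChartAt (𝓡 n) (f x) (f x)) * dfX i * coords x j :
      EuclideanSpace ℝ (Fin n))

end Tensors

variable {m : ℕ}
  {M : Type*} [TopologicalSpace M] [ChartedSpace (EuclideanSpace ℝ (Fin (m + 1))) M]
  [IsManifold (𝓡 (m + 1)) ∞ M]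
  {N : Type*} [TopologicalSpace N] [ChartedSpace (EuclideanSpace ℝ (Fin m)) N]

/-- Smooth Riemannian metrics on the `n`-manifold `M`. -/
abbrev Metric (n : ℕ) (M : Type*) [TopologicalSpace M]
    [ChartedSpace (EuclideanSpace ℝ (Fin n)) M] [IsManifold (𝓡 n) ∞ M] : Type _ :=
  Bundle.ContMDiffRiemannianMetric (𝓡 n) ∞ (EuclideanSpace ℝ (Fin n))
    (TangentSpace (𝓡 n) : M → Type _)

/-- The metric as a 2-tensor field. -/
def Metric.tensor {n : ℕ} {M : Type*} [TopologicalSpace M]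
    [ChartedSpace (EuclideanSpace ℝ (Fin n)) M] [IsManifold (𝓡 n) ∞ M] (g : Metric n M) :
    TensorField n M :=
  fun x X Y => g.inner x X Y

/-- A smooth deformation `φ_t`, `|t| < ε`, of an oriented immersed hypersurface `φ_0 : N → M`,
through immersions, constant in `t` outside of a compact subset of `N` (no condition
if `N` is compact). The orientation is recorded by the oriented unit normal `n_t` of `φ_t`, which
depends smoothly on `t` and on the point. -/
structure Deformation (g : Metric (m + 1) M) (N : Type*) [TopologicalSpace N]
    [ChartedSpace (EuclideanSpace ℝ (Fin m)) N] where
  ε : ℝ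
  ε_pos : 0 < ε
  map : ℝ → N → M
  normal : ∀ (t : ℝ) (x : N), TangentSpace (𝓡 (m + 1)) (map t x)
  contMDiffOn_map : ContMDiffOn (𝓘(ℝ, ℝ).prod (𝓡 m)) (𝓡 (m + 1)) ∞
    (fun p : ℝ × N => map p.1 p.2) (Ioo (-ε) ε ×ˢ univ)
  contMDiffOn_normal : ContMDiffOn (𝓘(ℝ, ℝ).prod (𝓡 m)) (𝓡 (m + 1)).tangent ∞
    (fun p : ℝ × N => (⟨map p.1 p.2, normal p.1 p.2⟩ : TangentBundle (𝓡 (m + 1)) M))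
    (Ioo (-ε) ε ×ˢ univ)
  immersion : ∀ t ∈ Ioo (-ε) ε, ∀ x,
    Function.Injective (mfderiv (𝓡 m) (𝓡 (m + 1)) (map t) x)
  normal_unit : ∀ t ∈ Ioo (-ε) ε, ∀ x, g.inner (map t x) (normal t x) (normal t x) = 1
  normal_orthogonal : ∀ t ∈ Ioo (-ε) ε, ∀ x, ∀ X : TangentSpace (𝓡 m) x,
    g.inner (map t x) (normal t x) (mfderiv (𝓡 m) (𝓡 (m + 1)) (map t) x X) = 0
  compact_support : ∃ K : Set N, IsCompact K ∧ ∀ t ∈ Ioo (-ε) ε, ∀ x ∉ K, map t x = map 0 x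

namespace Deformation

variable {g : Metric (m + 1) M} (D : Deformation g N)

/-- The velocity `∂φ_t/∂t` of the deformation. -/
def velocity (t : ℝ) (x : N) : TangentSpace (𝓡 (m + 1)) (D.map t x) :=
  mfderiv 𝓘(ℝ, ℝ) (𝓡 (m + 1)) (fun s => D.map s x) t (1 : ℝ)

/-- The first fundamental form (induced metric) of `φ_t`. -/
def firstForm (t : ℝ) : TensorField m N := fun x X Y =>
  g.inner (D.map t x) (mfderiv (𝓡 m) (𝓡 (m + 1)) (D.map t) x X)
    (mfderiv (𝓡 m) (𝓡 (m + 1)) (D.map t) x Y)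

/-- The second fundamental form of `φ_t`: `II(X, Y) = I(X, B Y)`, where `B Y = - D_Y n`. -/
def secondForm (t : ℝ) : TensorField m N := fun x X Y =>
  g.inner (D.map t x) (mfderiv (𝓡 m) (𝓡 (m + 1)) (D.map t) x X)
    (-covDerivAlong g.tensor (D.map t) (D.normal t) x Y)

/-- The mean curvature of `φ_t`: the trace of `B`, that is, the metric trace of `II`. -/
def meanCurvature (t : ℝ) (x : N) : ℝ := traceWith (D.firstForm t) (D.secondForm t) x

/-- The variation `I'` of the induced metric. -/
def firstFormVar : TensorField m N := fun x X Y => deriv (fun t => D.firstForm t x X Y) 0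

/-- The variation `H'` of the mean curvature. -/
def meanCurvatureVar (x : N) : ℝ := deriv (fun t => D.meanCurvature t x) 0

/-- The area measure `dA` of `φ_0`. -/
def area [MeasurableSpace N] : Measure N := riemannianMeasure (D.firstForm 0)

/-- Signed Jacobian of `(t, x) ↦ φ_t x` with respect to `dt dA`: the pulled-back Riemannian
volume density, with the sign `+` where the hypersurface moves to the side of its oriented
normal. -/
def signedJacobian (t : ℝ) (x : N) : ℝ :=
  let e : Fin (m + 1) → TangentSpace (𝓡 (m + 1)) (D.map t x) :=
    Fin.cons (D.velocity t x)
      (fun i => mfderiv (𝓡 m) (𝓡 (m + 1)) (D.map t) x (stdVec x i))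
  (SignType.sign (g.inner (D.map t x) (D.velocity t x) (D.normal t x)) : ℝ) *
    √(Matrix.of fun i j => g.inner (D.map t x) (e i) (e j)).det /
      √(gram (D.firstForm 0) x).det

/-- The oriented volume swept out between `φ_0` and `φ_t`, i.e. the volume bounded
by the hypersurface up to an additive constant. -/
def sweptVolume [MeasurableSpace N] (t : ℝ) : ℝ :=
  ∫ s in (0 : ℝ)..t, ∫ x, D.signedJacobian s x ∂D.area

/-- The hypersurfaces `φ_t N` are embedded and bound the domains `Ω t`, of finite volume, with
exterior normal `n_t`, and the domains deform along with their boundaries: no point outside of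
`φ_t N` enters or leaves the domain at time `t`. -/
structure Bounds [MeasurableSpace M] (Ω : ℝ → Set M) : Prop where
  isEmbedding : ∀ t ∈ Ioo (-D.ε) D.ε, Topology.IsEmbedding (D.map t)
  frontier_eq : ∀ t ∈ Ioo (-D.ε) D.ε, frontier (Ω t) = range (D.map t)
  exterior_normal : ∀ t ∈ Ioo (-D.ε) D.ε, ∀ x : N, ∀ᶠ s in 𝓝[>] (0 : ℝ),
    let c := extChartAt (𝓡 (m + 1)) (D.map t x)
    let n : EuclideanSpace ℝ (Fin (m + 1)) := D.normal t x
    c.symm (c (D.map t x) + s • n) ∉ Ω t ∧ c.symm (c (D.map t x) - s • n) ∈ Ω t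
  locally_constant : ∀ t ∈ Ioo (-D.ε) D.ε, ∀ p ∉ range (D.map t),
    ∀ᶠ s in 𝓝 t, (p ∈ Ω s ↔ p ∈ Ω t)
  finite_volume : ∀ t ∈ Ioo (-D.ε) D.ε, riemannianMeasure g.tensor (Ω t) ≠ ⊤

end Deformation

end Schlaefli

end

/-!
The proof has a pointwise part, valid for every deformation of an immersed hypersurface, and an
integral part.

Pointwise, write `v` for the velocity and `n'` for the covariant time derivative of the unit normal.
Since `⟨n, n⟩ = 1`, the vector `n'` is tangent to the hypersurface. The mean curvature is minus the
trace of `⟨∂_i φ, D_j n⟩` with respect to the induced metric. Differentiating in time, the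
derivative of the inverse of the metric contributes `-⟨I', II⟩`, that of `∂_i φ` contributes
`½ ⟨I', II⟩`, and the commutation of `D_t` with `D_j` produces a curvature term whose trace is
`ric (v, n)` (`HypFamily.fderiv_mean`, for families of hypersurfaces in a coordinate domain). Therefore
`H' + ½ ⟨I', II⟩ = ric (v, n) - div n'`, and `ric (v, n) = c ⟨v, n⟩` with `c = S / (m + 1)` on an
Einstein manifold (`Deformation.divNormalVar_eq_trace`).

The field `n'` vanishes outside of the compact support of the deformation, so that its divergence
has integral zero (`Deformation.isDivergence`, `IsDivergence.integral_eq_zero`); the divergence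
theorem is proved with a partition of unity from the formula `√g div ζ = ∑ ∂_k (√g ζ_k)` in charts
(`HypFamily.area_mul_div`). The integral of `H' + ½ ⟨I', II⟩` is thus `c ∫ ⟨v, n⟩`
(`Deformation.integral_integrand`), while `∫ ⟨v, n⟩` is the derivative of the swept volume: the
signed Jacobian is the normal speed times the ratio of the area densities
(`Deformation.hasDerivAt_sweptVolume`).

For domains `Ω t` bounded by the hypersurfaces, the derivative of the volume is `∫ ⟨v, n⟩` as well.
By the inverse function theorem, near a point of the hypersurface the images of the `φ_t` are graphs
`z = h t y` over the hypersurface (`exists_isGraph`). As points outside of the hypersurfaces do not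
change sides and the normal is exterior, `Ω t` is the region below the graph (`side_of_graph`,
`Deformation.Bounds.exists_isBox`). The integral of a continuous density over this region is
differentiated by Fubini's theorem and the fundamental theorem of calculus
(`IsGraph.hasDerivAt_integral`), and `h'` times the volume density of `M` is the normal speed times
the area density, because tangential motion is orthogonal to the normal
(`Deformation.IsBox.tubeDensity_mul`). A partition of unity near the support of the deformation
reduces the volume to such regions; the rest of the volume is constant in time
(`Deformation.Bounds.hasDerivAt_volume`).

Tangent vectors at `x` are identified with vectors of the model space, as in Mathlib, through the
preferred chart at `x`. The Levi-Civita connection and the curvature of the statement are defined at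
a point `p` in the preferred chart at `p`. Differentiating along a deformation requires the
connection at all points of one chart, which is why the transformation rules under changes of charts are proved
for covariant derivatives along maps.
-/

noncomputable section

namespace Schlaefli

/-! ### The Levi-Civita connection in a coordinate domain -/

/-- The coordinate space of an `n`-manifold. -/
abbrev Euc (n : ℕ) : Type := EuclideanSpace ℝ (Fin n)

/-- The `i`-th coordinate vector. -/
abbrev bv {n : ℕ} (i : Fin n) : Euc n := EuclideanSpace.single i (1 : ℝ)

section LeviCivita

variable {n : ℕ}

theorem euc_eq_sum (u : Euc n) : u = ∑ i, u i • bv i := by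
  ext j
  simp [Pi.single_apply]

theorem clm_eq_sum {F : Type*} [NormedAddCommGroup F] [NormedSpace ℝ F] (L : Euc n →L[ℝ] F)
    (u : Euc n) : L u = ∑ i, u i • L (bv i) := by
  conv_lhs => rw [euc_eq_sum u]
  simp only [map_sum, map_smul]

/-- Component matrix of a bilinear form. -/
def compMat (β : Euc n →L[ℝ] Euc n →L[ℝ] ℝ) : Matrix (Fin n) (Fin n) ℝ :=
  Matrix.of fun i j => β (bv i) (bv j)

/-- Christoffel symbols of a matrix-valued function, by the formula used in `christoffel`. -/
def chr (A : Euc n → Matrix (Fin n) (Fin n) ℝ) (k i j : Fin n) (y : Euc n) : ℝ :=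
  (1 / 2) * ∑ l, (A y)⁻¹ k l *
    (partialDeriv i (fun z => A z j l) y
      + partialDeriv j (fun z => A z i l) y
      - partialDeriv l (fun z => A z i j) y)

/-- The Christoffel symbols as a vector-valued bilinear map. -/
def chrMap (A : Euc n → Matrix (Fin n) (Fin n) ℝ) (q : Euc n) : Euc n →L[ℝ] Euc n →L[ℝ] Euc n :=
  ∑ i, ∑ j, (EuclideanSpace.proj i : Euc n →L[ℝ] ℝ).smulRight
    ((EuclideanSpace.proj j : Euc n →L[ℝ] ℝ).smulRight
      (WithLp.toLp 2 (fun l => chr A l i j q) : Euc n))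

theorem chrMap_apply (A : Euc n → Matrix (Fin n) (Fin n) ℝ) (q u v : Euc n) (l : Fin n) :
    chrMap A q u v l = ∑ i, ∑ j, chr A l i j q * u i * v j := by
  simp only [chrMap, sum_apply, ContinuousLinearMap.smulRight_apply,
    smul_apply, PiLp.proj_apply, WithLp.ofLp_sum, Finset.sum_apply,
    PiLp.smul_apply, smul_eq_mul]
  refine Finset.sum_congr rfl fun i _ => Finset.sum_congr rfl fun j _ => by ring

/-- `B` is a smooth Riemannian metric on the open subset `U` of the coordinate space. -/
structure LocalMetric (B : Euc n → Euc n →L[ℝ] Euc n →L[ℝ] ℝ) (U : Set (Euc n)) : Prop where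
  isOpen : IsOpen U
  contDiffOn : ContDiffOn ℝ ∞ B U
  symm : ∀ q ∈ U, ∀ u v, B q u v = B q v u
  pos : ∀ q ∈ U, ∀ u, u ≠ 0 → 0 < B q u u

variable {B : Euc n → Euc n →L[ℝ] Euc n →L[ℝ] ℝ} {U : Set (Euc n)}

theorem compMat_mulVec (β : Euc n →L[ℝ] Euc n →L[ℝ] ℝ) (u v : Euc n) :
    β u v = ∑ i, ∑ j, u i * v j * compMat β i j := by
  rw [clm_eq_sum β u]
  simp only [sum_apply, smul_apply, smul_eq_mul]
  refine Finset.sum_congr rfl fun i _ => ?_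
  rw [clm_eq_sum (β (bv i)) v, Finset.mul_sum]
  refine Finset.sum_congr rfl fun j _ => ?_
  simp only [compMat, Matrix.of_apply, smul_eq_mul]
  ring

/-- The component matrix of a positive definite form is invertible. -/
theorem isUnit_det_of_pos {k : ℕ} {A : Matrix (Fin k) (Fin k) ℝ}
    (h : ∀ u : Fin k → ℝ, u ≠ 0 → 0 < ∑ i, ∑ j, u i * u j * A i j) : IsUnit A.det := by
  rw [isUnit_iff_ne_zero]
  intro h0
  obtain ⟨v, hv, hv0⟩ := Matrix.exists_mulVec_eq_zero_iff.2 h0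
  have h1 := h v hv
  have h2 : ∑ i, ∑ j, v i * v j * A i j = ∑ i, v i * (A.mulVec v) i := by
    refine Finset.sum_congr rfl fun i _ => ?_
    simp only [Matrix.mulVec, dotProduct, Finset.mul_sum]
    exact Finset.sum_congr rfl fun j _ => by ring
  rw [h2, hv0] at h1
  simp at h1

theorem LocalMetric.isUnit_det (h : LocalMetric B U) {q : Euc n} (hq : q ∈ U) :
    IsUnit (compMat (B q)).det := by
  refine isUnit_det_of_pos fun u hu => ?_
  have := h.pos q hq (WithLp.toLp 2 u) (by simpa using hu)
  rwa [compMat_mulVec] at this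

theorem LocalMetric.differentiableAt (h : LocalMetric B U) {q : Euc n} (hq : q ∈ U) :
    DifferentiableAt ℝ B q :=
  (h.contDiffOn.contDiffAt (h.isOpen.mem_nhds hq)).differentiableAt (by simp)

theorem LocalMetric.partialDeriv_compMat (h : LocalMetric B U) {q : Euc n} (hq : q ∈ U)
    (i j l : Fin n) :
    partialDeriv i (fun z => compMat (B z) j l) q = fderiv ℝ B q (bv i) (bv j) (bv l) := by
  have h1 : HasFDerivAt (fun z => B z (bv j) (bv l)) _ q :=
    (((h.differentiableAt hq).hasFDerivAt.clm_apply (hasFDerivAt_const (bv j) q)).clm_apply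
      (hasFDerivAt_const (bv l) q))
  simp only [partialDeriv, compMat, Matrix.of_apply]
  rw [h1.fderiv]
  simp

theorem trilinear_eq (T : Euc n →L[ℝ] Euc n →L[ℝ] Euc n →L[ℝ] ℝ) (u v w : Euc n) :
    T u v w = ∑ i, ∑ j, ∑ k, u i * v j * w k * T (bv i) (bv j) (bv k) := by
  rw [clm_eq_sum (F := Euc n →L[ℝ] Euc n →L[ℝ] ℝ) T u]
  simp only [sum_apply, smul_apply, smul_eq_mul]
  refine Finset.sum_congr rfl fun i _ => ?_
  rw [compMat_mulVec (T (bv i)), Finset.mul_sum]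
  refine Finset.sum_congr rfl fun j _ => ?_
  rw [Finset.mul_sum]
  refine Finset.sum_congr rfl fun k _ => ?_
  simp only [compMat, Matrix.of_apply]; ring

/-- Product rule for a bilinear form applied to two vectors, all three variable. -/
theorem hasFDerivAt_bilin {W F : Type*} [NormedAddCommGroup W] [NormedSpace ℝ W]
    [NormedAddCommGroup F] [NormedSpace ℝ F] {β : W → Euc n →L[ℝ] Euc n →L[ℝ] F}
    {Y Z : W → Euc n} {p : W} (hβ : DifferentiableAt ℝ β p) (hY : DifferentiableAt ℝ Y p)
    (hZ : DifferentiableAt ℝ Z p) :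
    DifferentiableAt ℝ (fun p => β p (Y p) (Z p)) p ∧
    ∀ w, fderiv ℝ (fun p => β p (Y p) (Z p)) p w = fderiv ℝ β p w (Y p) (Z p)
      + β p (fderiv ℝ Y p w) (Z p) + β p (Y p) (fderiv ℝ Z p w) := by
  have h1 := (hβ.hasFDerivAt.clm_apply hY.hasFDerivAt).clm_apply hZ.hasFDerivAt
  refine ⟨h1.differentiableAt, fun w => ?_⟩
  rw [h1.fderiv]
  simp only [add_apply, ContinuousLinearMap.comp_apply, ContinuousLinearMap.flip_apply]
  abel

theorem differentiableAt_comp_euc {W F : Type*} [NormedAddCommGroup W] [NormedSpace ℝ W]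
    [NormedAddCommGroup F] [NormedSpace ℝ F] {β : Euc n → F} {f : W → Euc n} {p : W}
    (hβ : DifferentiableAt ℝ β (f p)) (hf : DifferentiableAt ℝ f p) :
    DifferentiableAt ℝ (fun p => β (f p)) p := DifferentiableAt.comp p hβ hf

theorem fderiv_comp_apply {W F : Type*} [NormedAddCommGroup W] [NormedSpace ℝ W]
    [NormedAddCommGroup F] [NormedSpace ℝ F] {β : Euc n → F} {f : W → Euc n} {p : W}
    (hβ : DifferentiableAt ℝ β (f p)) (hf : DifferentiableAt ℝ f p) (w : W) :
    fderiv ℝ (fun p => β (f p)) p w = fderiv ℝ β (f p) (fderiv ℝ f p w) := by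
  have := (hβ.hasFDerivAt.comp p hf.hasFDerivAt).fderiv
  exact congrArg (fun L => L w) this

theorem fderiv_fderiv_symm {W E : Type*} [NormedAddCommGroup W] [NormedSpace ℝ W]
    [NormedAddCommGroup E] [NormedSpace ℝ E] {F : W → E} {p : W}
    (hF : ContDiffAt ℝ ∞ F p) (v w : W) :
    fderiv ℝ (fun p => fderiv ℝ F p v) p w = fderiv ℝ (fun p => fderiv ℝ F p w) p v := by
  have h1 := ((hF.fderiv_right (m := ∞) (by simp)).differentiableAt (by simp)).hasFDerivAt
  rw [(h1.clm_apply (hasFDerivAt_const v p)).fderiv, (h1.clm_apply (hasFDerivAt_const w p)).fderiv]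
  have := hF.isSymmSndFDerivAt (by simpa using ENat.LEInfty.out)
  simp [this.eq v w]

theorem contDiffAt_fderiv_apply {W E : Type*} [NormedAddCommGroup W] [NormedSpace ℝ W]
    [NormedAddCommGroup E] [NormedSpace ℝ E] {F : W → E}
    {p : W} (hF : ContDiffAt ℝ ∞ F p) (v : W) : ContDiffAt ℝ ∞ (fun p => fderiv ℝ F p v) p :=
  (hF.fderiv_right (m := ∞) (by simp)).clm_apply contDiffAt_const

/-- The Koszul formula. -/
theorem LocalMetric.koszul (h : LocalMetric B U) {q : Euc n} (hq : q ∈ U) (u v w : Euc n) :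
    2 * B q (chrMap (fun z => compMat (B z)) q u v) w =
      fderiv ℝ B q u v w + fderiv ℝ B q v u w - fderiv ℝ B q w u v := by
  set A := fun z => compMat (B z) with hA
  have hsymm : (A q).transpose = A q := by
    ext i j; exact h.symm q hq _ _
  have hinv : A q * (A q)⁻¹ = 1 := Matrix.mul_nonsing_inv _ (h.isUnit_det hq)
  have key : ∀ i j m, 2 * ∑ k, chr A k i j q * A q k m =
      fderiv ℝ B q (bv i) (bv j) (bv m) + fderiv ℝ B q (bv j) (bv i) (bv m)
        - fderiv ℝ B q (bv m) (bv i) (bv j) := by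
    intro i j m
    set T : Fin n → ℝ := fun l => fderiv ℝ B q (bv i) (bv j) (bv l)
      + fderiv ℝ B q (bv j) (bv i) (bv l) - fderiv ℝ B q (bv l) (bv i) (bv j) with hT
    have e1 : ∀ k, chr A k i j q = (1 / 2) * ∑ l, (A q)⁻¹ k l * T l := by
      intro k
      simp only [chr, hT, hA, h.partialDeriv_compMat hq]
    have e2 : 2 * ∑ k, chr A k i j q * A q k m = (((A q) * (A q)⁻¹).mulVec T) m := by
      rw [← Matrix.mulVec_mulVec, Finset.mul_sum]
      simp only [Matrix.mulVec, dotProduct, e1]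
      refine Finset.sum_congr rfl fun k _ => ?_
      have : A q k m = A q m k := congrFun (congrFun hsymm m) k
      rw [this]; ring
    rw [e2, hinv, Matrix.one_mulVec]
  have key' : ∀ i j m, 2 * B q (chrMap A q (bv i) (bv j)) (bv m) =
      fderiv ℝ B q (bv i) (bv j) (bv m) + fderiv ℝ B q (bv j) (bv i) (bv m)
        - fderiv ℝ B q (bv m) (bv i) (bv j) := by
    intro i j m
    rw [← key, compMat_mulVec]
    simp [chrMap_apply, hA]
  have e3 := trilinear_eq
    ((ContinuousLinearMap.compL ℝ (Euc n) (Euc n) (Euc n →L[ℝ] ℝ) (B q)).comp (chrMap A q)) u v w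
  simp only [ContinuousLinearMap.comp_apply, ContinuousLinearMap.compL_apply] at e3
  rw [e3, trilinear_eq (fderiv ℝ B q) u v w, trilinear_eq (fderiv ℝ B q) v u w,
    trilinear_eq (fderiv ℝ B q) w u v, Finset.mul_sum, Finset.sum_comm
      (f := fun i j => ∑ k, v i * u j * w k * fderiv ℝ B q (bv i) (bv j) (bv k)),
    Finset.sum_comm (f := fun i j => ∑ k, w i * u j * v k * fderiv ℝ B q (bv i) (bv j) (bv k)),
    ← Finset.sum_add_distrib, ← Finset.sum_sub_distrib]
  refine Finset.sum_congr rfl fun i _ => ?_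
  rw [Finset.sum_comm (f := fun k j => w k * u i * v j * fderiv ℝ B q (bv k) (bv i) (bv j)),
    Finset.mul_sum, ← Finset.sum_add_distrib, ← Finset.sum_sub_distrib]
  refine Finset.sum_congr rfl fun j _ => ?_
  rw [Finset.mul_sum, ← Finset.sum_add_distrib, ← Finset.sum_sub_distrib]
  refine Finset.sum_congr rfl fun m _ => ?_
  linear_combination (u i * v j * w m) * key' i j m

/-- A vector is determined by its scalar products. -/
theorem LocalMetric.ext (h : LocalMetric B U) {q : Euc n} (hq : q ∈ U) {u v : Euc n}
    (H : ∀ w, B q u w = B q v w) : u = v := by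
  by_contra hne
  have := h.pos q hq (u - v) (sub_ne_zero.2 hne)
  rw [map_sub (B q)] at this
  rw [sub_apply, H, sub_self] at this
  exact lt_irrefl _ this

theorem LocalMetric.fderiv_symm (h : LocalMetric B U) {q : Euc n} (hq : q ∈ U) (w u v : Euc n) :
    fderiv ℝ B q w u v = fderiv ℝ B q w v u := by
  have h1 := (h.differentiableAt hq).hasFDerivAt
  have h2 := ((h1.clm_apply (hasFDerivAt_const u q)).clm_apply (hasFDerivAt_const v q))
  have h3 := ((h1.clm_apply (hasFDerivAt_const v q)).clm_apply (hasFDerivAt_const u q))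
  have h4 : (fun z => B z u v) =ᶠ[𝓝 q] fun z => B z v u := by
    filter_upwards [h.isOpen.mem_nhds hq] with z hz using h.symm z hz u v
  have h5 := congrArg (fun L => L w) (h2.unique (h3.congr_of_eventuallyEq h4))
  simpa using h5

/-- The Levi-Civita connection, in coordinates, of the metric `B`. -/
abbrev lc (B : Euc n → Euc n →L[ℝ] Euc n →L[ℝ] ℝ) : Euc n → Euc n →L[ℝ] Euc n →L[ℝ] Euc n :=
  chrMap fun z => compMat (B z)

/-- The Levi-Civita connection is torsion-free. -/
theorem LocalMetric.lc_symm (h : LocalMetric B U) {q : Euc n} (hq : q ∈ U) (u v : Euc n) :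
    lc B q u v = lc B q v u := by
  refine h.ext hq fun w => ?_
  have h1 := h.koszul hq u v w
  have h2 := h.koszul hq v u w
  have hs := h.fderiv_symm hq w u v
  linarith

/-- The Levi-Civita connection preserves the metric. -/
theorem LocalMetric.fderiv_eq (h : LocalMetric B U) {q : Euc n} (hq : q ∈ U) (w u v : Euc n) :
    fderiv ℝ B q w u v = B q (lc B q w u) v + B q u (lc B q w v) := by
  have h1 := h.koszul hq w u v
  have h2 := h.koszul hq w v u
  rw [h.symm q hq u]
  have hs := h.fderiv_symm hq w u v
  have hs1 := h.fderiv_symm hq u w v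
  have hs2 := h.fderiv_symm hq v w u
  linarith

section Smooth

variable {W : Type*} [NormedAddCommGroup W] [NormedSpace ℝ W] {k : ℕ} {r : WithTop ℕ∞}

theorem contDiffAt_det {A : W → Matrix (Fin k) (Fin k) ℝ} {x : W}
    (h : ∀ i j, ContDiffAt ℝ r (fun y => A y i j) x) : ContDiffAt ℝ r (fun y => (A y).det) x := by
  simp only [Matrix.det_apply']
  exact ContDiffAt.sum fun σ _ => contDiffAt_const.mul (contDiffAt_prod fun i _ => h _ _)

theorem contDiffAt_inv_matrix {A : W → Matrix (Fin k) (Fin k) ℝ} {x : W}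
    (h : ∀ i j, ContDiffAt ℝ r (fun y => A y i j) x) (hx : IsUnit (A x).det) (i j : Fin k) :
    ContDiffAt ℝ r (fun y => (A y)⁻¹ i j) x := by
  simp only [Matrix.inv_def, Matrix.smul_apply, Matrix.adjugate_apply, smul_eq_mul,
    Ring.inverse_eq_inv']
  refine ((contDiffAt_det h).inv hx.ne_zero).mul (contDiffAt_det fun a b => ?_)
  simp only [Matrix.updateRow_apply]
  split_ifs
  · exact contDiffAt_const
  · exact h _ _

end Smooth

theorem LocalMetric.contDiffAt (h : LocalMetric B U) {q : Euc n} (hq : q ∈ U) :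
    ContDiffAt ℝ ∞ B q :=
  h.contDiffOn.contDiffAt (h.isOpen.mem_nhds hq)

theorem LocalMetric.contDiffAt_compMat (h : LocalMetric B U) {q : Euc n} (hq : q ∈ U)
    (i j : Fin n) : ContDiffAt ℝ ∞ (fun z => compMat (B z) i j) q :=
  ((h.contDiffAt hq).clm_apply contDiffAt_const).clm_apply contDiffAt_const

theorem LocalMetric.contDiffAt_chr (h : LocalMetric B U) {q : Euc n} (hq : q ∈ U)
    (l i j : Fin n) : ContDiffAt ℝ ∞ (chr (fun z => compMat (B z)) l i j) q := by
  have hd : ∀ i j l, ContDiffAt ℝ ∞ (partialDeriv i fun z => compMat (B z) j l) q := fun i j l =>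
    ((h.contDiffAt_compMat hq j l).fderiv_right (m := ∞) (by simp)).clm_apply contDiffAt_const
  unfold chr
  exact contDiffAt_const.mul (ContDiffAt.sum fun a _ =>
    (contDiffAt_inv_matrix (h.contDiffAt_compMat hq) (h.isUnit_det hq) _ _).mul
      (((hd _ _ _).add (hd _ _ _)).sub (hd _ _ _)))

theorem LocalMetric.contDiffAt_lc (h : LocalMetric B U) {q : Euc n} (hq : q ∈ U) :
    ContDiffAt ℝ ∞ (lc B) q := by
  unfold lc chrMap
  refine ContDiffAt.sum fun i _ => ContDiffAt.sum fun j _ => ?_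
  refine contDiffAt_const.smulRight (contDiffAt_const.smulRight ?_)
  exact contDiffAt_euclidean.2 fun l => h.contDiffAt_chr hq l i j

/-! ### Curvature -/

/-- The curvature `R(u, v)` of the connection `Γ`, as a function of `v` and of the vector that it
is applied to. -/
def curv (Γ : Euc n → Euc n →L[ℝ] Euc n →L[ℝ] Euc n) (q u : Euc n) :
    Euc n →L[ℝ] Euc n →L[ℝ] Euc n :=
  fderiv ℝ Γ q u - (fderiv ℝ Γ q).flip u
    + (ContinuousLinearMap.compL ℝ (Euc n) (Euc n) (Euc n) (Γ q u)).comp (Γ q)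
    - ((ContinuousLinearMap.compL ℝ (Euc n) (Euc n) (Euc n)).flip (Γ q u)).comp (Γ q)

theorem curv_apply (Γ : Euc n → Euc n →L[ℝ] Euc n →L[ℝ] Euc n) (q u v w : Euc n) :
    curv Γ q u v w = fderiv ℝ Γ q u v w - fderiv ℝ Γ q v u w + Γ q u (Γ q v w)
      - Γ q v (Γ q u w) := rfl

/-- The curvature is skew-symmetric for the metric. -/
theorem LocalMetric.curv_self (h : LocalMetric B U) {q : Euc n} (hq : q ∈ U) (u v w : Euc n) :
    B q (curv (lc B) q u v w) w = 0 := by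
  -- The second derivatives of `z ↦ B z w w` in the directions `u` and `v` commute.
  have hw : ContDiffAt ℝ ∞ (fun z => B z w w) q :=
    ((h.contDiffAt hq).clm_apply contDiffAt_const).clm_apply contDiffAt_const
  have hΓ : DifferentiableAt ℝ (lc B) q := (h.contDiffAt_lc hq).differentiableAt (by simp)
  have hΓv : ∀ v : Euc n, DifferentiableAt ℝ (fun z => lc B z v w) q ∧
      ∀ u, fderiv ℝ (fun z => lc B z v w) q u = fderiv ℝ (lc B) q u v w := fun v => by
    have := hasFDerivAt_bilin hΓ (differentiableAt_const v) (differentiableAt_const w)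
    simpa using this
  have h3 : ∀ v u : Euc n, fderiv ℝ (fun z => fderiv ℝ (fun z => B z w w) z v) q u =
      2 * (fderiv ℝ B q u (lc B q v w) w + B q (fderiv ℝ (lc B) q u v w) w) := by
    intro v u
    have h4 : (fun z => fderiv ℝ (fun z => B z w w) z v) =ᶠ[𝓝 q]
        fun z => 2 * B z (lc B z v w) w := by
      filter_upwards [h.isOpen.mem_nhds hq] with z hz
      rw [(hasFDerivAt_bilin (h.differentiableAt hz) (differentiableAt_const w)
        (differentiableAt_const w)).2 v, h.fderiv_eq hz, h.symm z hz w, two_mul]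
      simp
    rw [h4.fderiv_eq]
    have h5 := hasFDerivAt_bilin (h.differentiableAt hq) (hΓv v).1 (differentiableAt_const w)
    rw [fderiv_const_mul h5.1]
    simp only [smul_apply, h5.2, (hΓv v).2, smul_eq_mul]
    simp
  have h6 := fderiv_fderiv_symm hw v u
  rw [h3, h3, h.fderiv_eq hq, h.fderiv_eq hq] at h6
  rw [curv_apply]
  simp only [map_add, map_sub, add_apply, sub_apply]
  have := h.symm q hq (lc B q v w) (lc B q u w)
  linarith

theorem bilin_eq {F : Type*} [NormedAddCommGroup F] [NormedSpace ℝ F]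
    (β : Euc n →L[ℝ] Euc n →L[ℝ] F) (u v : Euc n) :
    β u v = ∑ i, ∑ j, (u i * v j) • β (bv i) (bv j) := by
  rw [clm_eq_sum β u]
  simp only [sum_apply, smul_apply]
  refine Finset.sum_congr rfl fun i _ => ?_
  rw [clm_eq_sum (β (bv i)) v, Finset.smul_sum]
  exact Finset.sum_congr rfl fun j _ => by rw [smul_smul]

/-- The components of the curvature are given by the classical formula. -/
theorem LocalMetric.curv_component (h : LocalMetric B U) {q : Euc n} (hq : q ∈ U)
    (l k i j : Fin n) : curv (lc B) q (bv i) (bv j) (bv k) l =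
      partialDeriv i (chr (fun z => compMat (B z)) l j k) q
      - partialDeriv j (chr (fun z => compMat (B z)) l i k) q
      + ∑ a, (chr (fun z => compMat (B z)) l i a q * chr (fun z => compMat (B z)) a j k q
        - chr (fun z => compMat (B z)) l j a q * chr (fun z => compMat (B z)) a i k q) := by
  have h1 : ∀ i j k, fderiv ℝ (lc B) q (bv i) (bv j) (bv k) l =
      partialDeriv i (chr (fun z => compMat (B z)) l j k) q := by
    intro i j k
    have e : chr (fun z => compMat (B z)) l j k =
        fun z => (EuclideanSpace.proj l : Euc n →L[ℝ] ℝ) (lc B z (bv j) (bv k)) := by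
      ext z; simp [lc, chrMap_apply]
    have h2 := (EuclideanSpace.proj l : Euc n →L[ℝ] ℝ).hasFDerivAt.comp q
      ((((h.contDiffAt_lc hq).differentiableAt (by simp)).hasFDerivAt.clm_apply
        (hasFDerivAt_const (bv j) q)).clm_apply (hasFDerivAt_const (bv k) q))
    rw [partialDeriv, e]
    erw [h2.fderiv]
    simp
  rw [curv_apply]
  simp only [PiLp.sub_apply, PiLp.add_apply, h1, Finset.sum_sub_distrib]
  simp [lc, chrMap_apply]
  ring

/-! ### Covariant derivatives along a map -/

section Cov

variable {W : Type*} [NormedAddCommGroup W] [NormedSpace ℝ W]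

/-- Covariant derivative, in the direction `w`, of the vector field `Y` along the map `F`. -/
def cov (Γ : Euc n → Euc n →L[ℝ] Euc n →L[ℝ] Euc n) (F Y : W → Euc n) (w p : W) : Euc n :=
  fderiv ℝ Y p w + Γ (F p) (fderiv ℝ F p w) (Y p)

theorem LocalMetric.hasFDerivAt_inner (h : LocalMetric B U) {F Y Z : W → Euc n} {p : W}
    (hF : DifferentiableAt ℝ F p) (hp : F p ∈ U) (hY : DifferentiableAt ℝ Y p)
    (hZ : DifferentiableAt ℝ Z p) (w : W) :
    DifferentiableAt ℝ (fun p => B (F p) (Y p) (Z p)) p ∧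
    fderiv ℝ (fun p => B (F p) (Y p) (Z p)) p w =
      B (F p) (cov (lc B) F Y w p) (Z p) + B (F p) (Y p) (cov (lc B) F Z w p) := by
  have hB : DifferentiableAt ℝ (fun p => B (F p)) p :=
    differentiableAt_comp_euc (F := Euc n →L[ℝ] Euc n →L[ℝ] ℝ) (h.differentiableAt hp) hF
  have h1 := hasFDerivAt_bilin hB hY hZ
  refine ⟨h1.1, ?_⟩
  rw [h1.2, fderiv_comp_apply (F := Euc n →L[ℝ] Euc n →L[ℝ] ℝ) (h.differentiableAt hp) hF,
    h.fderiv_eq hp, cov, cov]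
  simp only [map_add, add_apply]
  ring

theorem LocalMetric.cov_fderiv_symm (h : LocalMetric B U) {F : W → Euc n} {p : W}
    (hF : ContDiffAt ℝ ∞ F p) (hp : F p ∈ U) (v w : W) :
    cov (lc B) F (fun p => fderiv ℝ F p v) w p = cov (lc B) F (fun p => fderiv ℝ F p w) v p := by
  rw [cov, cov, fderiv_fderiv_symm hF, h.lc_symm hp]

theorem LocalMetric.contDiffAt_cov (h : LocalMetric B U) {F Y : W → Euc n} {p : W}
    (hF : ContDiffAt ℝ ∞ F p) (hp : F p ∈ U) (hY : ContDiffAt ℝ ∞ Y p) (v : W) :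
    ContDiffAt ℝ ∞ (cov (lc B) F Y v) p :=
  (contDiffAt_fderiv_apply hY v).add (((ContDiffAt.comp p (h.contDiffAt_lc hp) hF).clm_apply
    (contDiffAt_fderiv_apply hF v)).clm_apply hY)

/-- The commutator of two covariant derivatives is the curvature. -/
theorem LocalMetric.cov_comm (h : LocalMetric B U) {F Y : W → Euc n} {p : W}
    (hF : ContDiffAt ℝ ∞ F p) (hp : F p ∈ U) (hY : ContDiffAt ℝ ∞ Y p) (v w : W) :
    cov (lc B) F (cov (lc B) F Y w) v p =
      cov (lc B) F (cov (lc B) F Y v) w p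
        + curv (lc B) (F p) (fderiv ℝ F p v) (fderiv ℝ F p w) (Y p) := by
  have key : ∀ v w, fderiv ℝ (cov (lc B) F Y w) p v =
      fderiv ℝ (fun p => fderiv ℝ Y p w) p v
      + (fderiv ℝ (lc B) (F p) (fderiv ℝ F p v) (fderiv ℝ F p w) (Y p)
        + lc B (F p) (fderiv ℝ (fun p => fderiv ℝ F p w) p v) (Y p)
        + lc B (F p) (fderiv ℝ F p w) (fderiv ℝ Y p v)) := by
    intro v w
    have h1 := (contDiffAt_fderiv_apply hY w).differentiableAt (by simp)
    have h2 := (contDiffAt_fderiv_apply hF w).differentiableAt (by simp)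
    have hΓ := (h.contDiffAt_lc hp).differentiableAt (by simp)
    have hF1 := hF.differentiableAt (by simp)
    have h3 : DifferentiableAt ℝ (fun p => lc B (F p)) p := DifferentiableAt.comp p hΓ hF1
    have h4 := hasFDerivAt_bilin h3 h2 (hY.differentiableAt (by simp))
    have e : cov (lc B) F Y w =
      (fun p => fderiv ℝ Y p w) + fun p => lc B (F p) (fderiv ℝ F p w) (Y p) := rfl
    rw [e, fderiv_add h1 h4.1, add_apply, h4.2, fderiv_comp_apply hΓ hF1]
  have e : ∀ v w, cov (lc B) F (cov (lc B) F Y w) v p = fderiv ℝ (cov (lc B) F Y w) p v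
    + lc B (F p) (fderiv ℝ F p v) (fderiv ℝ Y p w + lc B (F p) (fderiv ℝ F p w) (Y p)) :=
    fun v w => rfl
  rw [e, e, key, key, fderiv_fderiv_symm hY v w, fderiv_fderiv_symm hF v w, curv_apply]
  simp only [map_add]
  abel

end Cov

/-! ### Change of coordinates -/

section Change

variable {W : Type*} [NormedAddCommGroup W] [NormedSpace ℝ W]
  {B' : Euc n → Euc n →L[ℝ] Euc n →L[ℝ] ℝ} {U' : Set (Euc n)} {τ : Euc n → Euc n} {q : Euc n}

/-- The transformation law of the Christoffel symbols. -/
theorem LocalMetric.lc_change (h : LocalMetric B U) (h' : LocalMetric B' U') (hq : q ∈ U)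
    (hq' : τ q ∈ U') (hτ : ContDiffAt ℝ ∞ τ q) (hs : Function.Surjective (fderiv ℝ τ q))
    (hB : ∀ᶠ z in 𝓝 q, ∀ u v, B z u v = B' (τ z) (fderiv ℝ τ z u) (fderiv ℝ τ z v))
    (u v : Euc n) :
    fderiv ℝ τ q (lc B q u v) = lc B' (τ q) (fderiv ℝ τ q u) (fderiv ℝ τ q v)
      + fderiv ℝ (fun z => fderiv ℝ τ z v) q u := by
  have hτ1 := hτ.differentiableAt (by simp)
  have hτ2 : ∀ u, DifferentiableAt ℝ (fun z => fderiv ℝ τ z u) q := fun u =>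
    (contDiffAt_fderiv_apply hτ u).differentiableAt (by simp)
  have key : ∀ w u v, fderiv ℝ B q w u v =
      fderiv ℝ B' (τ q) (fderiv ℝ τ q w) (fderiv ℝ τ q u) (fderiv ℝ τ q v)
      + B' (τ q) (fderiv ℝ (fun z => fderiv ℝ τ z u) q w) (fderiv ℝ τ q v)
      + B' (τ q) (fderiv ℝ τ q u) (fderiv ℝ (fun z => fderiv ℝ τ z v) q w) := by
    intro w u v
    have hc : DifferentiableAt ℝ (fun z => B' (τ z)) q :=
      differentiableAt_comp_euc (F := Euc n →L[ℝ] Euc n →L[ℝ] ℝ) (h'.differentiableAt hq') hτ1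
    have h2 := hasFDerivAt_bilin hc (hτ2 u) (hτ2 v)
    have h3 := hasFDerivAt_bilin (h.differentiableAt hq) (differentiableAt_const u)
      (differentiableAt_const v)
    have h4 : (fun z => B z u v) =ᶠ[𝓝 q] fun z => B' (τ z) (fderiv ℝ τ z u) (fderiv ℝ τ z v) := by
      filter_upwards [hB] with z hz using hz u v
    have h5 := h3.2 w
    rw [h4.fderiv_eq, h2.2, fderiv_comp_apply (F := Euc n →L[ℝ] Euc n →L[ℝ] ℝ)
      (h'.differentiableAt hq') hτ1] at h5
    simpa using h5.symm
  have hsym : ∀ a b, fderiv ℝ (fun z => fderiv ℝ τ z b) q a =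
    fderiv ℝ (fun z => fderiv ℝ τ z a) q b := fun a b => fderiv_fderiv_symm hτ b a
  refine h'.ext hq' fun w' => ?_
  obtain ⟨w, rfl⟩ := hs w'
  rw [← hB.self_of_nhds, map_add, add_apply]
  have h1 := h.koszul hq u v w
  have h2 := h'.koszul hq' (fderiv ℝ τ q u) (fderiv ℝ τ q v) (fderiv ℝ τ q w)
  rw [key, key, key, hsym w u, hsym w v, hsym v u] at h1
  have h3 := h'.symm _ hq' (fderiv ℝ (fun z => fderiv ℝ τ z w) q u) (fderiv ℝ τ q v)
  have h4 := h'.symm _ hq' (fderiv ℝ (fun z => fderiv ℝ τ z w) q v) (fderiv ℝ τ q u)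
  linarith

/-- Covariant derivatives along a map do not depend on the coordinates of the target. -/
theorem LocalMetric.cov_change (h : LocalMetric B U) (h' : LocalMetric B' U') {F Y : W → Euc n}
    {p : W} (hq : F p ∈ U) (hq' : τ (F p) ∈ U') (hτ : ContDiffAt ℝ ∞ τ (F p))
    (hs : Function.Surjective (fderiv ℝ τ (F p)))
    (hB : ∀ᶠ z in 𝓝 (F p), ∀ u v, B z u v = B' (τ z) (fderiv ℝ τ z u) (fderiv ℝ τ z v))
    (hF : DifferentiableAt ℝ F p) (hY : DifferentiableAt ℝ Y p) (w : W) :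
    cov (lc B') (fun p => τ (F p)) (fun p => fderiv ℝ τ (F p) (Y p)) w p =
      fderiv ℝ τ (F p) (cov (lc B) F Y w p) := by
  have hτ1 := hτ.differentiableAt (by simp)
  have hτ2 := (hτ.fderiv_right (m := ∞) (by simp)).differentiableAt (by simp)
  have h1 := ((hτ2.hasFDerivAt.comp p hF.hasFDerivAt).clm_apply hY.hasFDerivAt).fderiv
  have h2 : fderiv ℝ (fun p => fderiv ℝ τ (F p) (Y p)) p w =
      fderiv ℝ τ (F p) (fderiv ℝ Y p w)
        + fderiv ℝ (fun z => fderiv ℝ τ z (Y p)) (F p) (fderiv ℝ F p w) := by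
    have h3 := (hτ2.hasFDerivAt.clm_apply (hasFDerivAt_const (Y p) (F p))).fderiv
    refine (congrArg (fun L => L w) h1).trans ?_
    rw [h3]
    simp
  rw [cov, h2, fderiv_comp_apply hτ1 hF, cov, map_add, h.lc_change h' hq hq' hτ hs hB]
  abel

end Change

end LeviCivita

end Schlaefli

end

noncomputable section

namespace Schlaefli

/-! ### Hyperplanes of a Euclidean vector space -/

section Frame

variable {n m k : ℕ}

/-- Gram matrix of the vectors `e i`. -/
def gramOf (β : Euc n →L[ℝ] Euc n →L[ℝ] ℝ) (e : Fin k → Euc n) : Matrix (Fin k) (Fin k) ℝ :=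
  Matrix.of fun i j => β (e i) (e j)

theorem gramOf_posDef {β : Euc n →L[ℝ] Euc n →L[ℝ] ℝ} (hs : ∀ u v, β u v = β v u)
    (hp : ∀ u, u ≠ 0 → 0 < β u u) {e : Fin k → Euc n} (he : LinearIndependent ℝ e) :
    (gramOf β e).PosDef := by
  refine Matrix.PosDef.of_dotProduct_mulVec_pos ?_ fun x hx => ?_
  · ext i j
    simp [gramOf, hs (e j)]
  · have h1 : ∑ i, x i • e i ≠ 0 := fun h0 =>
      hx (funext fun i => (Fintype.linearIndependent_iff.1 he) x h0 i)
    have h2 := hp _ h1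
    have h3 : β (∑ i, x i • e i) (∑ i, x i • e i) =
        dotProduct (star x) ((gramOf β e).mulVec x) := by
      simp only [map_sum, map_smul, sum_apply, smul_apply, smul_eq_mul, dotProduct,
        Matrix.mulVec, gramOf, Matrix.of_apply, Finset.mul_sum, Pi.star_apply, star_trivial]
      rw [Finset.sum_comm]
      refine Finset.sum_congr rfl fun i _ => Finset.sum_congr rfl fun j _ => by ring
    rwa [h3] at h2

/-- `β` is a scalar product, `e` is a linearly independent family of `m` vectors of the
`(m + 1)`-dimensional space, and `ν` is a unit normal of the hyperplane that it spans. -/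
structure AdaptedFrame (β : Euc (m + 1) →L[ℝ] Euc (m + 1) →L[ℝ] ℝ) (e : Fin m → Euc (m + 1))
    (ν : Euc (m + 1)) : Prop where
  symm : ∀ u v, β u v = β v u
  pos : ∀ u, u ≠ 0 → 0 < β u u
  indep : LinearIndependent ℝ e
  unit : β ν ν = 1
  orth : ∀ i, β ν (e i) = 0

variable {β : Euc (m + 1) →L[ℝ] Euc (m + 1) →L[ℝ] ℝ} {e : Fin m → Euc (m + 1)}
  {ν : Euc (m + 1)}

theorem AdaptedFrame.gram_posDef (h : AdaptedFrame β e ν) : (gramOf β e).PosDef :=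
  gramOf_posDef h.symm h.pos h.indep

theorem AdaptedFrame.isUnit_det (h : AdaptedFrame β e ν) : IsUnit (gramOf β e).det :=
  h.gram_posDef.det_pos.ne'.isUnit

/-- The tangent vectors `e i` and the normal `ν` span, so that a vector is determined by its scalar
products with them. -/
theorem AdaptedFrame.ext (h : AdaptedFrame β e ν) {u v : Euc (m + 1)}
    (h1 : ∀ i, β (e i) u = β (e i) v) (h2 : β ν u = β ν v) : u = v := by
  have hli : LinearIndependent ℝ (Fin.cons ν e : Fin (m + 1) → Euc (m + 1)) := by
    refine linearIndependent_finCons.2 ⟨h.indep, fun hν => ?_⟩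
    have h3 : ∀ w ∈ Submodule.span ℝ (range e), β ν w = 0 := by
      intro w hw
      induction hw using Submodule.span_induction with
      | mem x hx => obtain ⟨i, rfl⟩ := hx; exact h.orth i
      | zero => simp
      | add x y _ _ hx hy => simp [hx, hy]
      | smul a x _ hx => simp [hx]
    have := h3 ν hν
    rw [h.unit] at this
    exact one_ne_zero this
  have hspan := hli.span_eq_top_of_card_eq_finrank (by simp)
  have h4 : ∀ w, β w u = β w v := by
    intro w
    have hw : w ∈ Submodule.span ℝ (range (Fin.cons ν e : Fin (m + 1) → Euc (m + 1))) := by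
      rw [hspan]; trivial
    induction hw using Submodule.span_induction with
    | mem x hx =>
      obtain ⟨i, rfl⟩ := hx
      refine Fin.cases ?_ (fun i => ?_) i
      · simpa using h2
      · simpa using h1 i
    | zero => simp
    | add x y _ _ hx hy => simp [hx, hy]
    | smul a x _ hx => simp [hx]
  by_contra hne
  have h5 := h.pos (u - v) (sub_ne_zero.2 hne)
  rw [map_sub (β (u - v)), h4, sub_self] at h5
  exact lt_irrefl _ h5

/-- Decomposition of a vector into its tangential and its normal part. -/
theorem AdaptedFrame.decomp (h : AdaptedFrame β e ν) (u : Euc (m + 1)) :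
    u = ∑ i, (∑ j, (gramOf β e)⁻¹ i j * β (e j) u) • e i + β ν u • ν := by
  refine h.ext (fun k => ?_) ?_
  · have h1 : ∑ i, (∑ j, (gramOf β e)⁻¹ i j * β (e j) u) * β (e k) (e i) =
        ((gramOf β e * (gramOf β e)⁻¹).mulVec fun j => β (e j) u) k := by
      rw [← Matrix.mulVec_mulVec]
      simp only [Matrix.mulVec, dotProduct, gramOf, Matrix.of_apply]
      exact Finset.sum_congr rfl fun i _ => mul_comm _ _
    rw [Matrix.mul_nonsing_inv _ h.isUnit_det, Matrix.one_mulVec] at h1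
    simp only [map_add, map_sum, map_smul, smul_eq_mul, h.symm (e k) ν, h.orth]
    rw [h1]; simp
  · simp only [map_add, map_sum, map_smul, smul_eq_mul, h.orth, h.unit]
    simp

theorem AdaptedFrame.inner_eq (h : AdaptedFrame β e ν) (u v : Euc (m + 1)) :
    β u v = ∑ i, ∑ j, β u (e i) * (gramOf β e)⁻¹ i j * β (e j) v + β u ν * β ν v := by
  conv_lhs => rw [h.decomp v]
  simp only [map_add, map_sum, map_smul, smul_eq_mul, Finset.sum_mul]
  congr 1
  · exact Finset.sum_congr rfl fun i _ => Finset.sum_congr rfl fun j _ => by ring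
  · ring

/-- Trace of an endomorphism in an adapted frame. -/
theorem AdaptedFrame.trace_eq (h : AdaptedFrame β e ν) (L : Euc (m + 1) →L[ℝ] Euc (m + 1)) :
    ∑ k, L (bv k) k = ((gramOf β e)⁻¹ * Matrix.of fun i j => β (e i) (L (e j))).trace
      + β ν (L ν) := by
  have h1 : ∀ k, L (bv k) k = ∑ i, ∑ j, (gramOf β e)⁻¹ i j * (β (e j) (bv k) * L (e i) k)
      + β ν (bv k) * L ν k := by
    intro k
    conv_lhs => rw [h.decomp (bv k)]
    simp only [map_add, map_sum, map_smul, PiLp.add_apply, PiLp.smul_apply, WithLp.ofLp_sum,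
      Finset.sum_apply, smul_eq_mul, Finset.sum_mul, mul_assoc]
  have h2 : ∀ w z : Euc (m + 1), ∑ k, β w (bv k) * z k = β w z := by
    intro w z
    rw [clm_eq_sum (β w) z]
    exact Finset.sum_congr rfl fun k _ => by rw [smul_eq_mul, mul_comm]
  simp only [h1, Finset.sum_add_distrib, h2]
  congr 1
  rw [Finset.sum_comm]
  simp only [Matrix.trace, Matrix.diag_apply, Matrix.mul_apply, Matrix.of_apply]
  refine Finset.sum_congr rfl fun i _ => ?_
  rw [Finset.sum_comm]
  refine Finset.sum_congr rfl fun j _ => ?_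
  rw [← Finset.mul_sum, h2]

/-- The volume of the parallelepiped spanned by `u` and by the vectors `e i` is the product of its
height and of the area of its base. -/
theorem AdaptedFrame.det_cons (h : AdaptedFrame β e ν) (u : Euc (m + 1)) :
    (gramOf β (Fin.cons u e : Fin (m + 1) → Euc (m + 1))).det = β u ν ^ 2 * (gramOf β e).det := by
  set φ := (finSuccEquiv m).trans (Equiv.optionEquivSumPUnit.{0} (Fin m))
  have hφ1 : ∀ i, φ.symm (Sum.inl i) = Fin.succ i := fun i => by simp [φ]
  have hφ2 : ∀ i, φ.symm (Sum.inr i) = 0 := fun i => by simp [φ]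
  rw [← Matrix.det_reindex_self φ]
  have h1 : Matrix.reindex φ φ (gramOf β (Fin.cons u e : Fin (m + 1) → Euc (m + 1))) =
      Matrix.fromBlocks (gramOf β e) (Matrix.of fun i _ => β (e i) u)
        (Matrix.of fun _ i => β u (e i)) (Matrix.of fun _ _ => β u u) := by
    ext i j
    rcases i with i | i <;> rcases j with j | j <;>
      simp only [Matrix.reindex_apply, Matrix.submatrix_apply, hφ1, hφ2, gramOf, Matrix.of_apply,
        Matrix.fromBlocks_apply₁₁, Matrix.fromBlocks_apply₁₂, Matrix.fromBlocks_apply₂₁,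
        Matrix.fromBlocks_apply₂₂, Fin.cons_succ, Fin.cons_zero]
  let _ := Matrix.invertibleOfIsUnitDet _ h.isUnit_det
  rw [h1, Matrix.det_fromBlocks₁₁, Matrix.det_unique (n := PUnit), mul_comm]
  congr 1
  have h2 := h.inner_eq u u
  simp only [Matrix.sub_apply, Matrix.mul_apply, Matrix.of_apply, Matrix.invOf_eq_nonsing_inv]
  rw [h2, h.symm ν u, Finset.sum_comm]
  simp only [Finset.sum_mul]
  ring

end Frame

end Schlaefli

end

noncomputable section

namespace Schlaefli

/-! ### Directional derivatives of matrix functions -/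

section MatrixDeriv

variable {k : ℕ} {W : Type*} [NormedAddCommGroup W] [NormedSpace ℝ W]

/-- Entrywise directional derivative of a matrix function. -/
def dmat (A : W → Matrix (Fin k) (Fin k) ℝ) (p w : W) : Matrix (Fin k) (Fin k) ℝ :=
  Matrix.of fun i j => fderiv ℝ (fun p => A p i j) p w

variable {A C : W → Matrix (Fin k) (Fin k) ℝ} {p : W}

theorem dmat_mul (hA : ∀ i j, DifferentiableAt ℝ (fun p => A p i j) p)
    (hC : ∀ i j, DifferentiableAt ℝ (fun p => C p i j) p) (w : W) :
    dmat (fun p => A p * C p) p w = dmat A p w * C p + A p * dmat C p w := by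
  ext i j
  simp only [dmat, Matrix.of_apply, Matrix.mul_apply, Matrix.add_apply]
  rw [fderiv_fun_sum fun l _ => (hA i l).fun_mul (hC l j), sum_apply, ← Finset.sum_add_distrib]
  refine Finset.sum_congr rfl fun l _ => ?_
  rw [fderiv_fun_mul (hA i l) (hC l j)]
  simp only [add_apply, smul_apply, smul_eq_mul]
  ring

/-- The derivative of the inverse of a matrix, obtained by differentiating `A * A⁻¹ = 1`. -/
theorem dmat_inv (hA : ∀ i j, ContDiffAt ℝ ∞ (fun p => A p i j) p) (hp : IsUnit (A p).det)
    (w : W) : dmat (fun p => (A p)⁻¹) p w = -((A p)⁻¹ * dmat A p w * (A p)⁻¹) := by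
  have h1 := dmat_mul (C := fun p => (A p)⁻¹)
    (fun i j => (hA i j).differentiableAt (by simp))
    (fun i j => (contDiffAt_inv_matrix hA hp i j).differentiableAt (by simp)) w
  have h2 : dmat (fun p => A p * (A p)⁻¹) p w = 0 := by
    have hev : ∀ᶠ z in 𝓝 p, IsUnit (A z).det := by
      have := (contDiffAt_det hA).continuousAt.eventually_ne hp.ne_zero
      filter_upwards [this] with z hz using hz.isUnit
    ext i j
    have h3 : (fun z => (A z * (A z)⁻¹) i j) =ᶠ[𝓝 p]
        fun _ => (1 : Matrix (Fin k) (Fin k) ℝ) i j := by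
      filter_upwards [hev] with z hz
      rw [Matrix.mul_nonsing_inv _ hz]
    simp only [dmat, Matrix.of_apply]
    rw [h3.fderiv_eq]
    simp
  rw [h2] at h1
  have h4 : A p * dmat (fun p => (A p)⁻¹) p w = -(dmat A p w * (A p)⁻¹) :=
    (neg_eq_of_add_eq_zero_right h1.symm).symm
  calc dmat (fun p => (A p)⁻¹) p w
      = (A p)⁻¹ * (A p * dmat (fun p => (A p)⁻¹) p w) := by
        rw [← Matrix.mul_assoc, Matrix.nonsing_inv_mul _ hp, Matrix.one_mul]
    _ = _ := by rw [h4, Matrix.mul_neg, Matrix.mul_assoc]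

theorem fderiv_trace (hA : ∀ i j, DifferentiableAt ℝ (fun p => A p i j) p) (w : W) :
    fderiv ℝ (fun p => (A p).trace) p w = (dmat A p w).trace := by
  simp only [Matrix.trace, Matrix.diag_apply, dmat, Matrix.of_apply]
  rw [fderiv_fun_sum fun i _ => hA i i, sum_apply]

theorem differentiable_det : Differentiable ℝ fun M : Fin k → Fin k → ℝ => (Matrix.of M).det :=
  fun M => (contDiffAt_det (r := 1) (x := M) (A := fun M : Fin k → Fin k → ℝ => Matrix.of M)
    fun i j => by simp only [Matrix.of_apply]; fun_prop).differentiableAt one_ne_zero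

/-- The derivative of the determinant at the identity is the trace: `det (1 + r N)` is a polynomial
in `r` with linear coefficient `tr N`. -/
theorem fderiv_det_one (N : Fin k → Fin k → ℝ) :
    fderiv ℝ (fun M : Fin k → Fin k → ℝ => (Matrix.of M).det)
      (fun i j => (1 : Matrix (Fin k) (Fin k) ℝ) i j) N = (Matrix.of N).trace := by
  set J : Fin k → Fin k → ℝ := fun i j => (1 : Matrix (Fin k) (Fin k) ℝ) i j with hJ
  have h1 : HasDerivAt (fun r : ℝ => J + r • N) N 0 := by
    simpa using ((hasDerivAt_id (0 : ℝ)).smul_const N).const_add J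
  have h3 := HasFDerivAt.comp_hasDerivAt_of_eq (0 : ℝ) (differentiable_det J).hasFDerivAt h1
    (by simp)
  have h4 : HasDerivAt (fun r : ℝ => (1 + r • Matrix.of N).det) (Matrix.of N).trace 0 := by
    have e : (fun r : ℝ => (1 + r • Matrix.of N).det) = fun r => 1 + (Matrix.of N).trace * r +
      (Matrix.det (1 + (Polynomial.X : Polynomial ℝ) •
        (Matrix.of N).map Polynomial.C)).divX.divX.eval r * r ^ 2 := by
      funext r; exact Matrix.det_one_add_smul r _
    rw [e]
    have h5 := (((hasDerivAt_id (0 : ℝ)).const_mul (Matrix.of N).trace).const_add 1).add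
      (((Matrix.det (1 + (Polynomial.X : Polynomial ℝ) •
        (Matrix.of N).map Polynomial.C)).divX.divX.hasDerivAt 0).mul (hasDerivAt_pow 2 (0 : ℝ)))
    exact h5.congr_deriv (by simp)
  exact h3.unique h4

/-- Jacobi's formula. -/
theorem fderiv_det (hA : ∀ i j, DifferentiableAt ℝ (fun p => A p i j) p) (hp : IsUnit (A p).det)
    (w : W) : DifferentiableAt ℝ (fun p => (A p).det) p ∧
    fderiv ℝ (fun p => (A p).det) p w = (A p).det * ((A p)⁻¹ * dmat A p w).trace := by
  set C : W → Fin k → Fin k → ℝ := fun z i j => ((A p)⁻¹ * A z) i j with hC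
  have hCd : ∀ i j, DifferentiableAt ℝ (fun z => C z i j) p := by
    intro i j
    simp only [hC, Matrix.mul_apply]
    exact DifferentiableAt.fun_sum fun l _ => (hA l j).const_mul _
  have hCd' : DifferentiableAt ℝ C p := by
    rw [differentiableAt_pi]; intro i; rw [differentiableAt_pi]; exact hCd i
  have h1 : (fun z => (A z).det) = fun z => (A p).det * (Matrix.of (C z)).det := by
    funext z
    have : (Matrix.of (C z) : Matrix (Fin k) (Fin k) ℝ) = (A p)⁻¹ * A z := rfl
    rw [this, ← Matrix.det_mul, ← Matrix.mul_assoc, Matrix.mul_nonsing_inv _ hp, Matrix.one_mul]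
  have hC1 : C p = fun i j => (1 : Matrix (Fin k) (Fin k) ℝ) i j := by
    funext i j
    simp only [hC, Matrix.nonsing_inv_mul _ hp]
  have h3 := ((differentiable_det (C p)).hasFDerivAt.comp p hCd'.hasFDerivAt).const_mul (A p).det
  have h3' := h3.congr_of_eventuallyEq
    (show (fun z => (A z).det) =ᶠ[𝓝 p] _ from Eventually.of_forall fun z => congrFun h1 z)
  refine ⟨h3'.differentiableAt, ?_⟩
  rw [h3'.fderiv, smul_apply, ContinuousLinearMap.comp_apply, hC1, fderiv_det_one, smul_eq_mul]
  congr 2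
  ext i j
  have h4 : fderiv ℝ C p w i j = fderiv ℝ (fun z => C z i j) p w := by
    have h6 := hasFDerivAt_pi'.1 (hasFDerivAt_pi'.1 hCd'.hasFDerivAt i) j
    rw [h6.fderiv]; rfl
  rw [Matrix.of_apply, h4]
  simp only [hC, Matrix.mul_apply, dmat, Matrix.of_apply]
  rw [fderiv_fun_sum fun l _ => (hA l j).const_mul _, sum_apply]
  refine Finset.sum_congr rfl fun l _ => ?_
  rw [fderiv_const_mul (hA l j)]; rfl

end MatrixDeriv

end Schlaefli

end

noncomputable section

namespace Schlaefli

/-! ### Families of hypersurfaces in a coordinate domain -/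

section HypFamily

variable {m : ℕ} {W : Type*} [NormedAddCommGroup W] [NormedSpace ℝ W]

/-- Derivatives of `F` in the directions `X i`. -/
def tang (F : W → Euc (m + 1)) (X : Fin m → W) (p : W) : Fin m → Euc (m + 1) :=
  fun i => fderiv ℝ F p (X i)

/-- First fundamental form, in the directions `X i`. -/
def ff (B : Euc (m + 1) → Euc (m + 1) →L[ℝ] Euc (m + 1) →L[ℝ] ℝ) (F : W → Euc (m + 1))
    (X : Fin m → W) (p : W) : Matrix (Fin m) (Fin m) ℝ :=
  gramOf (B (F p)) (tang F X p)

/-- Matrix of the scalar products of the `X i`-derivative of `F` and of the covariant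
`X j`-derivative of `Z`. -/
def covMat (B : Euc (m + 1) → Euc (m + 1) →L[ℝ] Euc (m + 1) →L[ℝ] ℝ) (F Z : W → Euc (m + 1))
    (X : Fin m → W) (p : W) : Matrix (Fin m) (Fin m) ℝ :=
  Matrix.of fun i j => B (F p) (tang F X p i) (cov (lc B) F Z (X j) p)

/-- A map `F` defined on an open set `O` that parametrizes hypersurfaces (tangent to the `X i`) with
unit normal `Y`. The other directions of `W` are parameters. -/
structure HypFamily (B : Euc (m + 1) → Euc (m + 1) →L[ℝ] Euc (m + 1) →L[ℝ] ℝ)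
    (U : Set (Euc (m + 1))) (F Y : W → Euc (m + 1)) (X : Fin m → W) (O : Set W) : Prop where
  metric : LocalMetric B U
  isOpen : IsOpen O
  maps : ∀ p ∈ O, F p ∈ U
  smooth_map : ∀ p ∈ O, ContDiffAt ℝ ∞ F p
  smooth_normal : ∀ p ∈ O, ContDiffAt ℝ ∞ Y p
  frame : ∀ p ∈ O, AdaptedFrame (B (F p)) (tang F X p) (Y p)

variable {B : Euc (m + 1) → Euc (m + 1) →L[ℝ] Euc (m + 1) →L[ℝ] ℝ}
  {U : Set (Euc (m + 1))} {F Y Z : W → Euc (m + 1)} {X : Fin m → W} {O : Set W} {p : W}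

namespace HypFamily

theorem contDiffAt_inner (h : HypFamily B U F Y X O) (hp : p ∈ O) {Z Z' : W → Euc (m + 1)}
    (hZ : ContDiffAt ℝ ∞ Z p) (hZ' : ContDiffAt ℝ ∞ Z' p) :
    ContDiffAt ℝ ∞ (fun p => B (F p) (Z p) (Z' p)) p :=
  ((ContDiffAt.comp p (h.metric.contDiffAt (h.maps p hp)) (h.smooth_map p hp)).clm_apply
    hZ).clm_apply hZ'

theorem contDiffAt_tang (h : HypFamily B U F Y X O) (hp : p ∈ O) (i : Fin m) :
    ContDiffAt ℝ ∞ (fun p => tang F X p i) p :=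
  contDiffAt_fderiv_apply (h.smooth_map p hp) (X i)

theorem contDiffAt_ff (h : HypFamily B U F Y X O) (hp : p ∈ O) (i j : Fin m) :
    ContDiffAt ℝ ∞ (fun p => ff B F X p i j) p :=
  h.contDiffAt_inner hp (h.contDiffAt_tang hp i) (h.contDiffAt_tang hp j)

theorem contDiffAt_covMat (h : HypFamily B U F Y X O) (hp : p ∈ O) (hZ : ContDiffAt ℝ ∞ Z p)
    (i j : Fin m) : ContDiffAt ℝ ∞ (fun p => covMat B F Z X p i j) p :=
  h.contDiffAt_inner hp (h.contDiffAt_tang hp i)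
    (h.metric.contDiffAt_cov (h.smooth_map p hp) (h.maps p hp) hZ (X j))

theorem isUnit_det (h : HypFamily B U F Y X O) (hp : p ∈ O) : IsUnit (ff B F X p).det :=
  (h.frame p hp).isUnit_det

theorem det_pos (h : HypFamily B U F Y X O) (hp : p ∈ O) : 0 < (ff B F X p).det :=
  (h.frame p hp).gram_posDef.det_pos

theorem contDiffAt_trace (h : HypFamily B U F Y X O) (hp : p ∈ O) (hZ : ContDiffAt ℝ ∞ Z p) :
    ContDiffAt ℝ ∞ (fun p => ((ff B F X p)⁻¹ * covMat B F Z X p).trace) p := by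
  simp only [Matrix.trace, Matrix.diag_apply, Matrix.mul_apply]
  exact ContDiffAt.sum fun i _ => ContDiffAt.sum fun j _ =>
    (contDiffAt_inv_matrix (h.contDiffAt_ff hp) (h.isUnit_det hp) i j).mul
      (h.contDiffAt_covMat hp hZ j i)

theorem contDiffAt_area (h : HypFamily B U F Y X O) (hp : p ∈ O) :
    ContDiffAt ℝ ∞ (fun p => √(ff B F X p).det) p :=
  (contDiffAt_det (h.contDiffAt_ff hp)).sqrt (h.det_pos hp).ne'

theorem fderiv_inner (h : HypFamily B U F Y X O) (hp : p ∈ O) {Z Z' : W → Euc (m + 1)}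
    (hZ : DifferentiableAt ℝ Z p) (hZ' : DifferentiableAt ℝ Z' p) (w : W) :
    fderiv ℝ (fun p => B (F p) (Z p) (Z' p)) p w =
      B (F p) (cov (lc B) F Z w p) (Z' p) + B (F p) (Z p) (cov (lc B) F Z' w p) :=
  (h.metric.hasFDerivAt_inner ((h.smooth_map p hp).differentiableAt (by simp)) (h.maps p hp)
    hZ hZ' w).2

/-- A relation between scalar products that holds on `O` can be differentiated. -/
theorem inner_cov_eq_neg (h : HypFamily B U F Y X O) (hp : p ∈ O) {Z Z' : W → Euc (m + 1)} {c : ℝ}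
    (hZ : DifferentiableAt ℝ Z p) (hZ' : DifferentiableAt ℝ Z' p)
    (hc : ∀ᶠ z in 𝓝 p, B (F z) (Z z) (Z' z) = c) (w : W) :
    B (F p) (Z p) (cov (lc B) F Z' w p) = -B (F p) (cov (lc B) F Z w p) (Z' p) := by
  have h1 := h.fderiv_inner hp hZ hZ' w
  have h2 : (fun z => B (F z) (Z z) (Z' z)) =ᶠ[𝓝 p] fun _ => c := hc
  rw [h2.fderiv_eq] at h1
  simp at h1
  linarith

theorem inner_normal_cov (h : HypFamily B U F Y X O) (hp : p ∈ O) (w : W) :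
    B (F p) (Y p) (cov (lc B) F Y w p) = 0 := by
  have hY := (h.smooth_normal p hp).differentiableAt (by simp)
  have h1 := h.inner_cov_eq_neg hp hY hY (c := 1)
    (by filter_upwards [h.isOpen.mem_nhds hp] with z hz using (h.frame z hz).unit) w
  have h2 := (h.frame p hp).symm (Y p) (cov (lc B) F Y w p)
  linarith

theorem inner_tang_cov_normal (h : HypFamily B U F Y X O) (hp : p ∈ O) (i : Fin m) (w : W) :
    B (F p) (tang F X p i) (cov (lc B) F Y w p) =
      -B (F p) (cov (lc B) F (fun p => tang F X p i) w p) (Y p) := by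
  refine h.inner_cov_eq_neg hp ((h.contDiffAt_tang hp i).differentiableAt (by simp))
    ((h.smooth_normal p hp).differentiableAt (by simp)) (c := 0) ?_ w
  filter_upwards [h.isOpen.mem_nhds hp] with z hz
  rw [(h.frame z hz).symm]; exact (h.frame z hz).orth i

/-- The second fundamental form is symmetric. -/
theorem covMat_symm (h : HypFamily B U F Y X O) (hp : p ∈ O) :
    (covMat B F Y X p).transpose = covMat B F Y X p := by
  ext i j
  simp only [Matrix.transpose_apply, covMat, Matrix.of_apply, h.inner_tang_cov_normal hp]
  rw [show (fun p => tang F X p j) = fun p => fderiv ℝ F p (X j) from rfl,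
    h.metric.cov_fderiv_symm (h.smooth_map p hp) (h.maps p hp)]
  rfl

theorem ff_symm (h : HypFamily B U F Y X O) (hp : p ∈ O) :
    (ff B F X p).transpose = ff B F X p := by
  ext i j
  exact (h.frame p hp).symm _ _

/-- Weingarten's formula. -/
theorem cov_normal (h : HypFamily B U F Y X O) (hp : p ∈ O) (j : Fin m) :
    cov (lc B) F Y (X j) p = ∑ i, ((ff B F X p)⁻¹ * covMat B F Y X p) i j • tang F X p i := by
  conv_lhs => rw [(h.frame p hp).decomp (cov (lc B) F Y (X j) p), h.inner_normal_cov hp]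
  rw [zero_smul, add_zero]
  rfl

/-- The variation of the mean curvature, in terms of the derivative of the normal: the curvature
enters through the commutation of two covariant derivatives of the normal. -/
theorem fderiv_mean (h : HypFamily B U F Y X O) (hp : p ∈ O) (T : W) :
    fderiv ℝ (fun p => ((ff B F X p)⁻¹ * -covMat B F Y X p).trace) p T
      + (1 / 2) * ((ff B F X p)⁻¹ * dmat (ff B F X) p T * (ff B F X p)⁻¹
          * (-covMat B F Y X p).transpose).trace =
      ∑ k, curv (lc B) (F p) (bv k) (fderiv ℝ F p T) (Y p) k
        - ((ff B F X p)⁻¹ * covMat B F (cov (lc B) F Y T) X p).trace := by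
  set G := ff B F X p with hG
  set S := covMat B F Y X p with hS
  set P : Matrix (Fin m) (Fin m) ℝ := Matrix.of fun i j =>
    B (F p) (cov (lc B) F (fun p => tang F X p i) T p) (tang F X p j) with hP
  set N := covMat B F (cov (lc B) F Y T) X p with hN
  set R : Matrix (Fin m) (Fin m) ℝ := Matrix.of fun i j =>
    B (F p) (tang F X p i) (curv (lc B) (F p) (fderiv ℝ F p T) (tang F X p j) (Y p)) with hR
  have hd : ∀ i, DifferentiableAt ℝ (fun p => tang F X p i) p := fun i =>
    (h.contDiffAt_tang hp i).differentiableAt (by simp)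
  have hYs := h.smooth_normal p hp
  have hcY : ∀ w, DifferentiableAt ℝ (cov (lc B) F Y w) p := fun w =>
    (h.metric.contDiffAt_cov (h.smooth_map p hp) (h.maps p hp) hYs w).differentiableAt (by simp)
  -- The derivative of the metric along the family: `P i j = ⟨D_T ∂_i F, ∂_j F⟩`.
  have hD : dmat (ff B F X) p T = P + P.transpose := by
    ext i j
    refine (h.fderiv_inner hp (hd i) (hd j) T).trans ?_
    simp only [hP, Matrix.add_apply, Matrix.transpose_apply, Matrix.of_apply]
    rw [(h.frame p hp).symm (tang F X p i)]
  -- The derivative of `⟨∂_i F, D_j n⟩`. Exchanging `D_T` and `D_j` produces the curvature term `R`,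
  -- and Weingarten's formula expresses `D_j n` in the term with `D_T ∂_i F`.
  have hdS : dmat (covMat B F Y X) p T = P * (G⁻¹ * S) + N + R := by
    ext i j
    refine (h.fderiv_inner hp (hd i) (hcY (X j)) T).trans ?_
    rw [h.metric.cov_comm (h.smooth_map p hp) (h.maps p hp) hYs, map_add, ← add_assoc,
      h.cov_normal hp]
    simp only [Matrix.add_apply]
    congr 2
    rw [Matrix.mul_apply, map_sum]
    exact Finset.sum_congr rfl fun k _ => by rw [map_smul, smul_eq_mul, mul_comm]; rfl
  have hGinv : ∀ i j, DifferentiableAt ℝ (fun p => (ff B F X p)⁻¹ i j) p := fun i j =>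
    (contDiffAt_inv_matrix (h.contDiffAt_ff hp) (h.isUnit_det hp) i j).differentiableAt (by simp)
  have hSd : ∀ i j, DifferentiableAt ℝ (fun p => covMat B F Y X p i j) p := fun i j =>
    (h.contDiffAt_covMat hp hYs i j).differentiableAt (by simp)
  have hmul : ∀ i j, DifferentiableAt ℝ (fun p => ((ff B F X p)⁻¹ * covMat B F Y X p) i j) p := by
    intro i j
    simp only [Matrix.mul_apply]
    exact DifferentiableAt.fun_sum fun l _ => (hGinv i l).fun_mul (hSd l j)
  have h1 : fderiv ℝ (fun p => ((ff B F X p)⁻¹ * -covMat B F Y X p).trace) p T =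
      (G⁻¹ * (P + P.transpose) * G⁻¹ * S).trace - (G⁻¹ * (P * (G⁻¹ * S) + N + R)).trace := by
    have e : (fun p => ((ff B F X p)⁻¹ * -covMat B F Y X p).trace) =
        fun p => -((ff B F X p)⁻¹ * covMat B F Y X p).trace := by
      funext z; rw [Matrix.mul_neg, Matrix.trace_neg]
    rw [e, fderiv_fun_neg, neg_apply, fderiv_trace hmul, dmat_mul hGinv hSd,
      dmat_inv (h.contDiffAt_ff hp) (h.isUnit_det hp), hD, hdS, Matrix.trace_add, Matrix.neg_mul,
      Matrix.trace_neg]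
    ring
  have hGt : (G⁻¹).transpose = G⁻¹ := by rw [Matrix.transpose_nonsing_inv, hG, h.ff_symm hp]
  have h2 : (G⁻¹ * P.transpose * G⁻¹ * S).trace = (G⁻¹ * P * G⁻¹ * S).trace := by
    rw [← Matrix.trace_transpose]
    simp only [Matrix.transpose_mul, Matrix.transpose_transpose, hGt]
    rw [h.covMat_symm hp, Matrix.trace_mul_comm]
    simp only [Matrix.mul_assoc]
    rfl
  -- The trace of `R` over tangential directions is a full trace of the curvature, since the normal
  -- direction contributes `⟨n, R(·, n) n⟩ = 0`.
  have h3 : (G⁻¹ * R).trace = -∑ k, curv (lc B) (F p) (bv k) (fderiv ℝ F p T) (Y p) k := by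
    have h4 := (h.frame p hp).trace_eq ((curv (lc B) (F p) (fderiv ℝ F p T)).flip (Y p))
    simp only [ContinuousLinearMap.flip_apply] at h4
    rw [(h.frame p hp).symm (Y p), h.metric.curv_self (h.maps p hp), add_zero] at h4
    rw [hG, ff, hR, ← h4, ← Finset.sum_neg_distrib]
    refine Finset.sum_congr rfl fun k _ => ?_
    rw [curv_apply, curv_apply]
    simp only [PiLp.sub_apply, PiLp.add_apply]
    ring
  rw [h1, hD, Matrix.transpose_neg, h.covMat_symm hp, ← hS]
  simp only [Matrix.mul_add, Matrix.add_mul, Matrix.mul_neg, Matrix.trace_add, Matrix.trace_neg,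
    h2, h3]
  simp only [← Matrix.mul_assoc]
  ring

/-- The divergence of a tangential field, in divergence form. -/
theorem area_mul_div (h : HypFamily B U F Y X O) (hp : p ∈ O) {Z : W → Euc (m + 1)}
    (hZ : ∀ᶠ z in 𝓝 p, ContDiffAt ℝ ∞ Z z) (hZY : ∀ᶠ z in 𝓝 p, B (F z) (Y z) (Z z) = 0) :
    √(ff B F X p).det * ((ff B F X p)⁻¹ * covMat B F Z X p).trace =
      ∑ k, fderiv ℝ (fun p => √(ff B F X p).det *
        ∑ l, (ff B F X p)⁻¹ k l * B (F p) (tang F X p l) (Z p)) p (X k) := by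
  set ζ : Fin m → W → ℝ := fun k p => ∑ l, (ff B F X p)⁻¹ k l * B (F p) (tang F X p l) (Z p)
    with hζ
  set G := ff B F X p with hG
  have hζd : ∀ k, DifferentiableAt ℝ (ζ k) p := fun k =>
    DifferentiableAt.fun_sum fun l _ => ((contDiffAt_inv_matrix (h.contDiffAt_ff hp)
      (h.isUnit_det hp) k l).mul (h.contDiffAt_inner hp (h.contDiffAt_tang hp l)
        hZ.self_of_nhds)).differentiableAt (by simp)
  have hd : ∀ i, DifferentiableAt ℝ (fun p => tang F X p i) p := fun i =>
    (h.contDiffAt_tang hp i).differentiableAt (by simp)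
  have hffd : ∀ i j, DifferentiableAt ℝ (fun p => ff B F X p i j) p := fun i j =>
    (h.contDiffAt_ff hp i j).differentiableAt (by simp)
  -- `Z` is tangential, hence the combination of the `∂_k F` with coefficients `ζ k`.
  have hZe : Z =ᶠ[𝓝 p] fun z => ∑ k, ζ k z • tang F X z k := by
    filter_upwards [hZY, h.isOpen.mem_nhds hp] with z hz hzO
    conv_lhs => rw [(h.frame z hzO).decomp (Z z), hz, zero_smul, add_zero]
    rfl
  have hcov : ∀ w, cov (lc B) F Z w p = ∑ k, (fderiv ℝ (ζ k) p w • tang F X p k +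
      ζ k p • cov (lc B) F (fun p => tang F X p k) w p) := by
    intro w
    rw [cov, hZe.fderiv_eq, hZe.self_of_nhds,
      fderiv_fun_sum fun k _ => (hζd k).fun_smul (hd k), sum_apply, map_sum,
      ← Finset.sum_add_distrib]
    refine Finset.sum_congr rfl fun k _ => ?_
    rw [fderiv_fun_smul (hζd k) (hd k), cov]
    simp only [add_apply, smul_apply, map_smul, ContinuousLinearMap.smulRight_apply, smul_add]
    abel
  set Q : Fin m → Matrix (Fin m) (Fin m) ℝ := fun k => Matrix.of fun i j =>
    B (F p) (tang F X p i) (cov (lc B) F (fun p => tang F X p j) (X k) p) with hQ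
  have hsym : ∀ j k, cov (lc B) F (fun p => tang F X p k) (X j) p =
      cov (lc B) F (fun p => tang F X p j) (X k) p := fun j k =>
    h.metric.cov_fderiv_symm (h.smooth_map p hp) (h.maps p hp) _ _
  -- With `D_j ∂_k F = D_k ∂_j F`, the derivatives of the frame appear in the same form as in the
  -- derivative of the metric in the direction `X k`.
  have hmat : covMat B F Z X p = G * (Matrix.of fun k j => fderiv ℝ (ζ k) p (X j))
      + ∑ k, ζ k p • Q k := by
    ext i j
    simp only [covMat, Matrix.of_apply, hcov, map_sum, map_add, map_smul, Finset.sum_add_distrib,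
      Matrix.add_apply, Matrix.mul_apply, Matrix.sum_apply, Matrix.smul_apply, smul_eq_mul, hQ,
      hsym j]
    congr 1
    exact Finset.sum_congr rfl fun k _ => mul_comm _ _
  have hdff : ∀ k, dmat (ff B F X) p (X k) = Q k + (Q k).transpose := by
    intro k
    ext i j
    refine (h.fderiv_inner hp (hd i) (hd j) (X k)).trans ?_
    simp only [hQ, Matrix.add_apply, Matrix.transpose_apply, Matrix.of_apply]
    rw [(h.frame p hp).symm _ (tang F X p j), add_comm]
  have hGt : (G⁻¹).transpose = G⁻¹ := by rw [Matrix.transpose_nonsing_inv, hG, h.ff_symm hp]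
  have htr : ∀ k, (G⁻¹ * dmat (ff B F X) p (X k)).trace = 2 * (G⁻¹ * Q k).trace := by
    intro k
    have : (G⁻¹ * (Q k).transpose).trace = (G⁻¹ * Q k).trace := by
      rw [← Matrix.trace_transpose, Matrix.transpose_mul, Matrix.transpose_transpose, hGt,
        Matrix.trace_mul_comm]
    rw [hdff, Matrix.mul_add, Matrix.trace_add, this, two_mul]
  -- Jacobi's formula for the derivative of the square root of the determinant.
  have hsq : ∀ k, fderiv ℝ (fun p => √(ff B F X p).det) p (X k) =
      √G.det * (G⁻¹ * Q k).trace := by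
    intro k
    have h1 := fderiv_det hffd (h.isUnit_det hp) (X k)
    have h2 := h1.1.hasFDerivAt.sqrt (h.det_pos hp).ne'
    rw [h2.fderiv, smul_apply, h1.2, htr, ← hG, smul_eq_mul]
    have h3 : G.det = √G.det * √G.det := (Real.mul_self_sqrt (h.det_pos hp).le).symm
    have h4 : √G.det ≠ 0 := (Real.sqrt_pos.2 (h.det_pos hp)).ne'
    field_simp
    rw [sq, ← h3]
  have hsd : DifferentiableAt ℝ (fun p => √(ff B F X p).det) p :=
    (h.contDiffAt_area hp).differentiableAt (by simp)
  rw [hmat, Matrix.mul_add, ← Matrix.mul_assoc, Matrix.nonsing_inv_mul _ (h.isUnit_det hp),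
    Matrix.one_mul, Matrix.trace_add, Matrix.mul_sum, Matrix.trace_sum]
  simp only [Matrix.mul_smul, Matrix.trace_smul]
  rw [Matrix.trace]
  simp only [Matrix.diag_apply, Matrix.of_apply]
  rw [← Finset.sum_add_distrib, Finset.mul_sum]
  refine Finset.sum_congr rfl fun k _ => ?_
  change _ = fderiv ℝ (fun p => √(ff B F X p).det * ζ k p) p (X k)
  rw [fderiv_fun_mul hsd (hζd k), add_apply, smul_apply, smul_apply, hsq, smul_eq_mul, smul_eq_mul,
    smul_eq_mul]
  ring

end HypFamily

end HypFamily

end Schlaefli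

end

noncomputable section

namespace Schlaefli

/-! ### Tangent vectors and metrics in charts -/

section Charts

variable {n : ℕ} {M : Type*} [TopologicalSpace M] [ChartedSpace (Euc n) M]

/-- Components, in the preferred chart at `p`, of tangent vectors at `x`. -/
def dc (p x : M) : Euc n →L[ℝ] Euc n :=
  mfderiv (𝓡 n) 𝓘(ℝ, Euc n) (extChartAt (𝓡 n) p) x

/-- The tangent vectors, at the point of coordinate `y` in the preferred chart at `p`, with given
components in this chart. -/
def dcs (p : M) (y : Euc n) : Euc n →L[ℝ] Euc n :=
  mfderiv 𝓘(ℝ, Euc n) (𝓡 n) (extChartAt (𝓡 n) p).symm y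

variable [IsManifold (𝓡 n) ∞ M]

theorem isManifold_one : IsManifold (𝓡 n) 1 M := IsManifold.of_le (n := ∞) (by simp)

theorem dc_self (p : M) : dc p p = ContinuousLinearMap.id ℝ (Euc n) := by
  have := isManifold_one (n := n) (M := M)
  exact mfderiv_extChartAt_self (I := 𝓡 n) (x := p)

theorem dc_dcs {p : M} {y : Euc n} (hy : y ∈ (extChartAt (𝓡 n) p).target) (u : Euc n) :
    dc p ((extChartAt (𝓡 n) p).symm y) (dcs p y u) = u := by
  have := isManifold_one (n := n) (M := M)
  have h := mfderiv_extChartAt_comp_mfderivWithin_extChartAt_symm (I := 𝓡 n) hy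
  rw [ModelWithCorners.range_eq_univ, mfderivWithin_univ] at h
  exact congrArg (fun L : Euc n →L[ℝ] Euc n => L u) h

theorem dcs_dc {p x : M} (hx : x ∈ (extChartAt (𝓡 n) p).source) (u : Euc n) :
    dcs p (extChartAt (𝓡 n) p x) (dc p x u) = u := by
  have := isManifold_one (n := n) (M := M)
  have h := mfderivWithin_extChartAt_symm_comp_mfderiv_extChartAt' (I := 𝓡 n) hx
  rw [ModelWithCorners.range_eq_univ, mfderivWithin_univ] at h
  exact congrArg (fun L : Euc n →L[ℝ] Euc n => L u) h

theorem dcs_self (p : M) : dcs p (extChartAt (𝓡 n) p p) = ContinuousLinearMap.id ℝ (Euc n) := by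
  ext1 u
  have := dcs_dc (mem_extChartAt_source (I := 𝓡 n) p) u
  rwa [dc_self] at this

/-- Transition map between the preferred charts at `p` and at `p'`. -/
def trans (p p' : M) : Euc n → Euc n :=
  fun y => extChartAt (𝓡 n) p' ((extChartAt (𝓡 n) p).symm y)

theorem hasMFDerivAt_chart {p x : M} (hx : x ∈ (extChartAt (𝓡 n) p).source) :
    MDifferentiableAt (𝓡 n) 𝓘(ℝ, Euc n) (extChartAt (𝓡 n) p) x := by
  have := isManifold_one (n := n) (M := M)
  exact mdifferentiableAt_extChartAt (by rwa [extChartAt_source] at hx)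

theorem mdifferentiableAt_chart_symm {p : M} {y : Euc n} (hy : y ∈ (extChartAt (𝓡 n) p).target) :
    MDifferentiableAt 𝓘(ℝ, Euc n) (𝓡 n) (extChartAt (𝓡 n) p).symm y := by
  have := isManifold_one (n := n) (M := M)
  have h := mdifferentiableWithinAt_extChartAt_symm (I := 𝓡 n) hy
  rwa [ModelWithCorners.range_eq_univ, mdifferentiableWithinAt_univ] at h

theorem fderiv_trans {p p' : M} {y : Euc n} (hy : y ∈ (extChartAt (𝓡 n) p).target)
    (hy' : (extChartAt (𝓡 n) p).symm y ∈ (extChartAt (𝓡 n) p').source) (u : Euc n) :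
    fderiv ℝ (trans p p') y u = dc p' ((extChartAt (𝓡 n) p).symm y) (dcs p y u) := by
  have h := mfderiv_comp y (hasMFDerivAt_chart hy') (mdifferentiableAt_chart_symm hy)
  rw [mfderiv_eq_fderiv] at h
  exact congrArg (fun L : Euc n →L[ℝ] Euc n => L u) h

theorem contDiffAt_trans {p p' : M} {y : Euc n} (hy : y ∈ (extChartAt (𝓡 n) p).target)
    (hy' : (extChartAt (𝓡 n) p).symm y ∈ (extChartAt (𝓡 n) p').source) :
    ContDiffAt ℝ ∞ (trans p p') y := by
  have h1 : ContMDiffAt (𝓡 n) 𝓘(ℝ, Euc n) ∞ (extChartAt (𝓡 n) p')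
      ((extChartAt (𝓡 n) p).symm y) :=
    contMDiffAt_extChartAt' (by rwa [extChartAt_source] at hy')
  have h2 : ContMDiffAt 𝓘(ℝ, Euc n) (𝓡 n) ∞ (extChartAt (𝓡 n) p).symm y :=
    (contMDiffOn_extChartAt_symm p).contMDiffAt ((isOpen_extChartAt_target p).mem_nhds hy)
  exact (h1.comp y h2).contDiffAt

/-- The scalar product of `g` at `x`, on the vector space underlying the tangent space. -/
def gAt (g : Metric n M) (x : M) : Euc n →L[ℝ] Euc n →L[ℝ] ℝ := g.inner x

theorem gAt_symm (g : Metric n M) (x : M) (u v : Euc n) : gAt g x u v = gAt g x v u :=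
  g.symm x u v

theorem gAt_pos (g : Metric n M) (x : M) (u : Euc n) (hu : u ≠ 0) : 0 < gAt g x u u :=
  g.pos x u hu

/-- The metric `g` in the preferred chart at `p`. -/
def gB (g : Metric n M) (p : M) (y : Euc n) : Euc n →L[ℝ] Euc n →L[ℝ] ℝ :=
  (gAt g ((extChartAt (𝓡 n) p).symm y)).bilinearComp (dcs p y) (dcs p y)

theorem gB_apply (g : Metric n M) (p : M) (y u v : Euc n) :
    gB g p y u v = gAt g ((extChartAt (𝓡 n) p).symm y) (dcs p y u) (dcs p y v) := rfl

theorem gAt_eq_gB (g : Metric n M) {p x : M} (hx : x ∈ (extChartAt (𝓡 n) p).source)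
    (u v : Euc n) :
    gAt g x u v = gB g p (extChartAt (𝓡 n) p x) (dc p x u) (dc p x v) := by
  rw [gB_apply, dcs_dc hx, dcs_dc hx, (extChartAt (𝓡 n) p).left_inv hx]

theorem contMDiffOn_dcs (p : M) (u : Euc n) : ContMDiffOn 𝓘(ℝ, Euc n) (𝓡 n).tangent ∞
    (fun y => (⟨(extChartAt (𝓡 n) p).symm y, dcs p y u⟩ : TangentBundle (𝓡 n) M))
    (extChartAt (𝓡 n) p).target := by
  have := isManifold_one (n := n) (M := M)
  have hc : ContMDiffOn 𝓘(ℝ, Euc n) (𝓡 n) ∞ (extChartAt (𝓡 n) p).symm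
    (extChartAt (𝓡 n) p).target := contMDiffOn_extChartAt_symm p
  have ho := isOpen_extChartAt_target (I := 𝓡 n) p
  have h1 := hc.contMDiffOn_tangentMapWithin (m := ∞) (by simp) ho.uniqueMDiffOn
  have h2 : ContMDiff 𝓘(ℝ, Euc n) 𝓘(ℝ, Euc n).tangent ∞
      (fun y => (⟨y, u⟩ : TangentBundle 𝓘(ℝ, Euc n) (Euc n))) :=
    contMDiff_vectorSpace_iff_contDiff.2 contDiff_const
  refine (h1.comp h2.contMDiffOn (s := (extChartAt (𝓡 n) p).target) fun y hy => hy).congr ?_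
  intro y hy
  simp only [Function.comp_apply, tangentMapWithin]
  rw [mfderivWithin_of_isOpen ho hy]
  rfl

theorem contDiffOn_gB (g : Metric n M) (p : M) :
    ContDiffOn ℝ ∞ (gB g p) (extChartAt (𝓡 n) p).target := by
  have := isManifold_one (n := n) (M := M)
  rw [contDiffOn_clm_apply]
  intro u
  rw [contDiffOn_clm_apply]
  intro v
  rw [← contMDiffOn_iff_contDiffOn]
  have hc : ContMDiffOn 𝓘(ℝ, Euc n) (𝓡 n) ∞ (extChartAt (𝓡 n) p).symm
    (extChartAt (𝓡 n) p).target := contMDiffOn_extChartAt_symm p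
  have hg : ContMDiffOn 𝓘(ℝ, Euc n) ((𝓡 n).prod 𝓘(ℝ, Euc n →L[ℝ] Euc n →L[ℝ] ℝ)) ∞
      (fun y => Bundle.TotalSpace.mk' (Euc n →L[ℝ] Euc n →L[ℝ] ℝ)
        (E := fun x : M => TangentSpace (𝓡 n) x →L[ℝ] TangentSpace (𝓡 n) x →L[ℝ] ℝ)
        ((extChartAt (𝓡 n) p).symm y)
        (g.inner ((extChartAt (𝓡 n) p).symm y))) (extChartAt (𝓡 n) p).target :=
    g.contMDiff.comp_contMDiffOn hc
  have h3 := ContMDiffOn.clm_bundle_apply₂ (F₁ := Euc n) (F₂ := Euc n) (F₃ := ℝ)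
    (E₃ := Bundle.Trivial M ℝ) hg (contMDiffOn_dcs p u) (contMDiffOn_dcs p v)
  intro y hy
  exact ((Bundle.contMDiffWithinAt_totalSpace).1 (h3 y hy)).2

theorem localMetric_gB (g : Metric n M) (p : M) :
    LocalMetric (gB g p) (extChartAt (𝓡 n) p).target where
  isOpen := isOpen_extChartAt_target p
  contDiffOn := contDiffOn_gB g p
  symm q _ u v := gAt_symm _ _ _ _
  pos q hq u hu := by
    refine gAt_pos _ _ _ fun h0 => hu ?_
    have h1 : dcs p q u = 0 := h0
    rw [← dc_dcs hq u, h1, map_zero]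

theorem gB_trans (g : Metric n M) {p p' : M} {y : Euc n} (hy : y ∈ (extChartAt (𝓡 n) p).target)
    (hy' : (extChartAt (𝓡 n) p).symm y ∈ (extChartAt (𝓡 n) p').source) (u v : Euc n) :
    gB g p y u v = gB g p' (trans p p' y) (fderiv ℝ (trans p p') y u)
      (fderiv ℝ (trans p p') y v) := by
  rw [fderiv_trans hy hy', fderiv_trans hy hy', gB_apply, gAt_eq_gB g hy']
  rfl

/-- The Ricci tensor as the trace of the curvature. -/
theorem ricci_eq (g : Metric n M) (p : M) (Y Z : Euc n) : ricci g.tensor p Y Z =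
    ∑ k, curv (lc (gB g p)) (extChartAt (𝓡 n) p p) (bv k) Y Z k := by
  have hq := mem_extChartAt_target (I := 𝓡 n) p
  have h1 : ∀ k, curv (lc (gB g p)) (extChartAt (𝓡 n) p p) (bv k) Y Z k =
      ∑ i, ∑ j, Y i * Z j * riemann g.tensor p k j k i (extChartAt (𝓡 n) p p) := by
    intro k
    rw [bilin_eq]
    simp only [WithLp.ofLp_sum, Finset.sum_apply, PiLp.smul_apply, smul_eq_mul,
      (localMetric_gB g p).curv_component hq]
    rfl
  simp only [h1, ricci, Finset.sum_mul]
  refine Eq.trans ?_ Finset.sum_comm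
  refine Finset.sum_congr rfl fun j _ => ?_
  refine Eq.trans ?_ Finset.sum_comm
  refine Finset.sum_congr rfl fun k _ => Finset.sum_congr rfl fun i _ => ?_
  ring

theorem surjective_fderiv_trans {p p' : M} {y : Euc n} (hy : y ∈ (extChartAt (𝓡 n) p).target)
    (hy' : (extChartAt (𝓡 n) p).symm y ∈ (extChartAt (𝓡 n) p').source) :
    Function.Surjective (fderiv ℝ (trans p p') y) := by
  intro u
  refine ⟨dc p ((extChartAt (𝓡 n) p).symm y)
    (dcs p' (extChartAt (𝓡 n) p' ((extChartAt (𝓡 n) p).symm y)) u), ?_⟩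
  have h1 := dcs_dc ((extChartAt (𝓡 n) p).map_target hy)
  rw [(extChartAt (𝓡 n) p).right_inv hy] at h1
  have h2 := dc_dcs ((extChartAt (𝓡 n) p').map_source hy')
  rw [(extChartAt (𝓡 n) p').left_inv hy'] at h2
  rw [fderiv_trans hy hy', h1, h2]

/-- The covariant derivatives of a vector field along a map, computed in the preferred charts at
`p` and at `p'`, correspond to each other. -/
theorem cov_trans (g : Metric n M) {W : Type*} [NormedAddCommGroup W] [NormedSpace ℝ W]
    {p p' : M} {F Y : W → Euc n} {z : W} (hy : F z ∈ (extChartAt (𝓡 n) p).target)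
    (hy' : (extChartAt (𝓡 n) p).symm (F z) ∈ (extChartAt (𝓡 n) p').source)
    (hF : DifferentiableAt ℝ F z) (hY : DifferentiableAt ℝ Y z) (w : W) :
    cov (lc (gB g p')) (fun z => trans p p' (F z)) (fun z => fderiv ℝ (trans p p') (F z) (Y z)) w z
      = fderiv ℝ (trans p p') (F z) (cov (lc (gB g p)) F Y w z) := by
  refine (localMetric_gB g p).cov_change (localMetric_gB g p') hy
    ((extChartAt (𝓡 n) p').map_source hy') (contDiffAt_trans hy hy')
    (surjective_fderiv_trans hy hy') ?_ hF hY w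
  have h1 : ContinuousAt (extChartAt (𝓡 n) p).symm (F z) :=
    (continuousOn_extChartAt_symm p).continuousAt ((isOpen_extChartAt_target p).mem_nhds hy)
  filter_upwards [(isOpen_extChartAt_target p).mem_nhds hy,
    h1.preimage_mem_nhds ((isOpen_extChartAt_source p').mem_nhds hy')] with z hz hz' u v
  exact gB_trans g hz hz' u v

end Charts

end Schlaefli

end

noncomputable section

namespace Schlaefli

/-! ### Maps and vector fields along maps in charts -/

section Rep

variable {n : ℕ} {M : Type*} [TopologicalSpace M] [ChartedSpace (Euc n) M]
  {k : ℕ} {N : Type*} [TopologicalSpace N] [ChartedSpace (Euc k) N]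

/-- The map `f` in the preferred charts at `q` and at `p`. -/
def rep (q : N) (p : M) (f : N → M) (y : Euc k) : Euc n :=
  extChartAt (𝓡 n) p (f ((extChartAt (𝓡 k) q).symm y))

/-- The vector field `Y` along the map `f`, in the preferred charts at `q` and at `p`. -/
def repV (q : N) (p : M) (f : N → M) (Y : N → Euc n) (y : Euc k) : Euc n :=
  dc p (f ((extChartAt (𝓡 k) q).symm y)) (Y ((extChartAt (𝓡 k) q).symm y))

variable {q : N} {p : M} {f : N → M} {x : N}

theorem eventually_rep (hx : x ∈ (extChartAt (𝓡 k) q).source) (hf : ContinuousAt f x)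
    {V : Set M} (hV : V ∈ 𝓝 (f x)) : ∀ᶠ y in 𝓝 (extChartAt (𝓡 k) q x),
      f ((extChartAt (𝓡 k) q).symm y) ∈ V := by
  have h1 : ContinuousAt (extChartAt (𝓡 k) q).symm (extChartAt (𝓡 k) q x) :=
    continuousAt_extChartAt_symm' hx
  have h2 : ContinuousAt f ((extChartAt (𝓡 k) q).symm (extChartAt (𝓡 k) q x)) := by
    rw [(extChartAt (𝓡 k) q).left_inv hx]; exact hf
  refine (ContinuousAt.comp h2 h1).preimage_mem_nhds ?_
  simp only [Function.comp_apply, (extChartAt (𝓡 k) q).left_inv hx]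
  exact hV

variable [IsManifold (𝓡 n) ∞ M]

/-- The derivative of a map, on the vector spaces underlying the tangent spaces. -/
def mder (f : N → M) (x : N) : Euc k →L[ℝ] Euc n := mfderiv (𝓡 k) (𝓡 n) f x

/-- Change of the preferred chart in the target of a map. -/
theorem rep_trans (p' : M) (hx : x ∈ (extChartAt (𝓡 k) q).source) (hf : ContinuousAt f x)
    (hfx : f x ∈ (extChartAt (𝓡 n) p).source) (hfx' : f x ∈ (extChartAt (𝓡 n) p').source)
    (Y : N → Euc n) :
    (rep (n := n) (k := k) q p' f =ᶠ[𝓝 (extChartAt (𝓡 k) q x)]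
      fun y => trans (n := n) p p' (rep (n := n) (k := k) q p f y)) ∧
    (repV (n := n) (k := k) q p' f Y =ᶠ[𝓝 (extChartAt (𝓡 k) q x)]
      fun y => fderiv ℝ (trans (n := n) p p') (rep (n := n) (k := k) q p f y)
        (repV (n := n) (k := k) q p f Y y)) := by
  have h1 := eventually_rep hx hf ((isOpen_extChartAt_source p).mem_nhds hfx)
  have h2 := eventually_rep hx hf ((isOpen_extChartAt_source p').mem_nhds hfx')
  constructor
  · filter_upwards [h1] with y hy
    simp only [rep, trans, (extChartAt (𝓡 n) p).left_inv hy]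
  · filter_upwards [h1, h2] with y hy hy'
    have hl := (extChartAt (𝓡 n) p).left_inv hy
    rw [rep, fderiv_trans ((extChartAt (𝓡 n) p).map_source hy) (by rwa [hl])]
    simp only [repV]
    rw [dcs_dc hy, hl]

variable [IsManifold (𝓡 k) ∞ N]

theorem hasFDerivAt_rep (hx : x ∈ (extChartAt (𝓡 k) q).source)
    (hfx : f x ∈ (extChartAt (𝓡 n) p).source) (hf : MDifferentiableAt (𝓡 k) (𝓡 n) f x) :
    DifferentiableAt ℝ (rep (n := n) (k := k) q p f) (extChartAt (𝓡 k) q x) ∧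
    ∀ w, fderiv ℝ (rep (n := n) (k := k) q p f) (extChartAt (𝓡 k) q x) w =
      dc (n := n) p (f x) (mder (n := n) (k := k) f x
        (dcs (n := k) q (extChartAt (𝓡 k) q x) w)) := by
  have hy := (extChartAt (𝓡 k) q).map_source hx
  have hl := (extChartAt (𝓡 k) q).left_inv hx
  have h1 := mdifferentiableAt_chart_symm hy
  have h2 : MDifferentiableAt (𝓡 k) (𝓡 n) f ((extChartAt (𝓡 k) q).symm (extChartAt (𝓡 k) q x)) := by
    rw [hl]; exact hf
  have h3 : MDifferentiableAt (𝓡 n) 𝓘(ℝ, Euc n) (extChartAt (𝓡 n) p)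
      (f ((extChartAt (𝓡 k) q).symm (extChartAt (𝓡 k) q x))) := by
    rw [hl]; exact hasMFDerivAt_chart hfx
  have h4 := mfderiv_comp _ h2 h1
  have h5 := mfderiv_comp (extChartAt (𝓡 k) q x) (f := f ∘ (extChartAt (𝓡 k) q).symm) h3
    (h2.comp _ h1)
  refine ⟨(MDifferentiableAt.comp (extChartAt (𝓡 k) q x)
    (f := f ∘ (extChartAt (𝓡 k) q).symm) h3 (h2.comp _ h1)).differentiableAt, fun w => ?_⟩
  rw [mfderiv_eq_fderiv, h4] at h5
  have h6 := congrArg (fun L : Euc k →L[ℝ] Euc n => L w) h5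
  refine h6.trans ?_
  change dc (n := n) p (f ((extChartAt (𝓡 k) q).symm (extChartAt (𝓡 k) q x)))
    (mder (n := n) (k := k) f ((extChartAt (𝓡 k) q).symm (extChartAt (𝓡 k) q x))
      (dcs (n := k) q _ w)) = _
  rw [hl]

theorem cov_congr {n : ℕ} {W : Type*} [NormedAddCommGroup W] [NormedSpace ℝ W]
    {Γ : Euc n → Euc n →L[ℝ] Euc n →L[ℝ] Euc n} {F F' Y Y' : W → Euc n} {z : W}
    (hF : F =ᶠ[𝓝 z] F') (hY : Y =ᶠ[𝓝 z] Y') (w : W) : cov Γ F Y w z = cov Γ F' Y' w z := by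
  rw [cov, cov, hF.fderiv_eq, hY.fderiv_eq, hF.self_of_nhds, hY.self_of_nhds]

/-- The covariant derivative along a map can be computed in any charts. -/
theorem dc_covDerivAlong (g : Metric n M) (hx : x ∈ (extChartAt (𝓡 k) q).source)
    (hfx : f x ∈ (extChartAt (𝓡 n) p).source) (hf : MDifferentiableAt (𝓡 k) (𝓡 n) f x)
    {Y : N → Euc n}
    (hY : DifferentiableAt ℝ (repV (n := n) (k := k) q p f Y) (extChartAt (𝓡 k) q x)) (X : Euc k) :
    dc (n := n) p (f x) (covDerivAlong g.tensor f Y x X) =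
      cov (lc (gB g p)) (rep (n := n) (k := k) q p f) (repV (n := n) (k := k) q p f Y)
        (dc (n := k) q x X) (extChartAt (𝓡 k) q x) := by
  set p' := f x with hp'
  have hfx' : f x ∈ (extChartAt (𝓡 n) p').source := mem_extChartAt_source p'
  have hl := (extChartAt (𝓡 k) q).left_inv hx
  have hF := (hasFDerivAt_rep hx hfx hf).1
  have hF' := hasFDerivAt_rep hx hfx' hf
  obtain ⟨e1, e2⟩ := rep_trans p' hx hf.continuousAt hfx hfx' Y
  have hrx : rep (n := n) (k := k) q p f (extChartAt (𝓡 k) q x) = extChartAt (𝓡 n) p (f x) := by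
    rw [rep, hl]
  have hFt : rep (n := n) (k := k) q p f (extChartAt (𝓡 k) q x) ∈ (extChartAt (𝓡 n) p).target := by
    rw [hrx]; exact (extChartAt (𝓡 n) p).map_source hfx
  have hFl : (extChartAt (𝓡 n) p).symm (rep (n := n) (k := k) q p f (extChartAt (𝓡 k) q x)) =
      f x := by
    rw [hrx, (extChartAt (𝓡 n) p).left_inv hfx]
  have hFs : (extChartAt (𝓡 n) p).symm (rep (n := n) (k := k) q p f (extChartAt (𝓡 k) q x)) ∈
      (extChartAt (𝓡 n) p').source := by rw [hFl]; exact hfx'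
  have hY' : DifferentiableAt ℝ (repV (n := n) (k := k) q p' f Y) (extChartAt (𝓡 k) q x) := by
    refine DifferentiableAt.congr_of_eventuallyEq ?_ e2
    have h1 := ((contDiffAt_trans (p' := p') hFt hFs).fderiv_right (m := ∞)
      (by simp)).differentiableAt (by simp)
    exact (h1.hasFDerivAt.comp _ hF.hasFDerivAt).clm_apply hY.hasFDerivAt |>.differentiableAt
  -- In the chart at `f x`, the definition agrees with `cov`.
  have hA : (show Euc n from covDerivAlong g.tensor f Y x X) =
      cov (lc (gB g p')) (rep (n := n) (k := k) q p' f) (repV (n := n) (k := k) q p' f Y)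
        (dc (n := k) q x X) (extChartAt (𝓡 k) q x) := by
    have hd1 : (show Euc n from mfderiv (𝓡 k) (𝓡 n) f x X) =
        fderiv ℝ (rep (n := n) (k := k) q p' f) (extChartAt (𝓡 k) q x) (dc (n := k) q x X) := by
      rw [hF'.2, dcs_dc hx, hp', dc_self]; rfl
    have hd2 : (show Euc n from mfderiv (𝓡 k) 𝓘(ℝ, Euc n)
        (fun y : N => dc (n := n) p' (f y) (Y y)) x X) =
        fderiv ℝ (repV (n := n) (k := k) q p' f Y) (extChartAt (𝓡 k) q x) (dc (n := k) q x X) := by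
      have h1 : (fun y : N => dc (n := n) p' (f y) (Y y)) =ᶠ[𝓝 x]
          repV (n := n) (k := k) q p' f Y ∘ extChartAt (𝓡 k) q := by
        filter_upwards [(isOpen_extChartAt_source q).mem_nhds hx] with y hy
        simp only [Function.comp_apply, repV, (extChartAt (𝓡 k) q).left_inv hy]
      rw [h1.mfderiv_eq]
      have h2 := mfderiv_comp x hY'.mdifferentiableAt (hasMFDerivAt_chart hx)
      rw [mfderiv_eq_fderiv] at h2
      exact congrArg (fun L : Euc k →L[ℝ] Euc n => L X) h2
    have hd3 : repV (n := n) (k := k) q p' f Y (extChartAt (𝓡 k) q x) =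
        dc (n := n) p' (f x) (Y x) := by rw [repV, hl]
    ext l
    rw [cov, ← hd1, ← hd2, hd3, PiLp.add_apply, chrMap_apply, rep, hl]
    rfl
  have hB : cov (lc (gB g p')) (rep (n := n) (k := k) q p' f) (repV (n := n) (k := k) q p' f Y)
        (dc (n := k) q x X) (extChartAt (𝓡 k) q x) =
      fderiv ℝ (trans (n := n) p p') (rep (n := n) (k := k) q p f (extChartAt (𝓡 k) q x))
        (cov (lc (gB g p)) (rep (n := n) (k := k) q p f) (repV (n := n) (k := k) q p f Y)
          (dc (n := k) q x X) (extChartAt (𝓡 k) q x)) := by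
    rw [cov_congr e1 e2]
    exact cov_trans g hFt hFs hF hY _
  have hC : (show Euc n from covDerivAlong g.tensor f Y x X) = _ := hA.trans hB
  refine (congrArg (dc (n := n) p (f x)) hC).trans ?_
  rw [fderiv_trans hFt hFs, hFl, hrx, hp', dc_self, ContinuousLinearMap.id_apply]
  have h3 := dc_dcs ((extChartAt (𝓡 n) p).map_source hfx)
  rw [(extChartAt (𝓡 n) p).left_inv hfx] at h3
  exact h3 _

end Rep

end Schlaefli

end

noncomputable section

namespace Schlaefli

/-! ### Deformations in charts -/

section DeformationCharts

variable {n : ℕ} {M : Type*} [TopologicalSpace M] [ChartedSpace (Euc n) M]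
  [IsManifold (𝓡 n) ∞ M]

/-- The chart components of a smooth vector field along a map are smooth. -/
theorem contDiffAt_dc_of_contMDiffAt {W : Type*} [NormedAddCommGroup W] [NormedSpace ℝ W] {z : W}
    {f : W → M} {Y : W → Euc n}
    (h : ContMDiffAt 𝓘(ℝ, W) (𝓡 n).tangent ∞ (fun z => (⟨f z, Y z⟩ : TangentBundle (𝓡 n) M)) z)
    {p : M} (hp : f z ∈ (extChartAt (𝓡 n) p).source) :
    ContDiffAt ℝ ∞ (fun z => dc p (f z) (Y z)) z := by
  have := isManifold_one (n := n) (M := M)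
  have ho := isOpen_extChartAt_source (I := 𝓡 n) p
  have h0 : ContMDiffOn (𝓡 n) 𝓘(ℝ, Euc n) ∞ (extChartAt (𝓡 n) p) (extChartAt (𝓡 n) p).source := by
    rw [extChartAt_source]; exact contMDiffOn_extChartAt
  have h1 := h0.contMDiffOn_tangentMapWithin (m := ∞) (by simp) ho.uniqueMDiffOn
  have hf : ContinuousAt f z :=
    (FiberBundle.continuous_proj (Euc n) (TangentSpace (𝓡 n) : M → Type _)).continuousAt.comp
      h.continuousAt
  have h2 := (h1.contMDiffAt (x := ⟨f z, Y z⟩) ((ho.preimage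
    (FiberBundle.continuous_proj (Euc n) (TangentSpace (𝓡 n) : M → Type _))).mem_nhds hp)).comp z h
  have h3 := (contMDiff_snd_tangentBundle_modelSpace (Euc n) 𝓘(ℝ, Euc n) (n := ∞)).contMDiffAt.comp
    z h2
  refine h3.contDiffAt.congr_of_eventuallyEq ?_
  filter_upwards [hf.preimage_mem_nhds (ho.mem_nhds hp)] with w hw
  exact congrArg (fun L : Euc n →L[ℝ] Euc n => L (Y w))
    (mfderivWithin_of_isOpen (f := extChartAt (𝓡 n) p) ho hw).symm

end DeformationCharts

namespace Deformation

variable {m : ℕ} {M : Type*} [TopologicalSpace M] [ChartedSpace (Euc (m + 1)) M]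
  [IsManifold (𝓡 (m + 1)) ∞ M] {N : Type*} [TopologicalSpace N] [ChartedSpace (Euc m) N]
  {g : Metric (m + 1) M} (D : Deformation g N)

/-- The deformation in charts, as a function of time and of the coordinate. -/
def locF (q : N) (p : M) (z : ℝ × Euc m) : Euc (m + 1) := rep q p (D.map z.1) z.2

/-- The unit normal in charts. -/
def locY (q : N) (p : M) (z : ℝ × Euc m) : Euc (m + 1) := repV q p (D.map z.1) (D.normal z.1) z.2

/-- The coordinate directions on the hypersurfaces. -/
def locX (j : Fin m) : ℝ × Euc m := (0, bv j)

/-- The domain where the deformation can be written in the preferred charts at `q` and at `p`. -/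
def locO (q : N) (p : M) : Set (ℝ × Euc m) :=
  {z | z.1 ∈ Ioo (-D.ε) D.ε ∧ z.2 ∈ (extChartAt (𝓡 m) q).target ∧
    D.map z.1 ((extChartAt (𝓡 m) q).symm z.2) ∈ (extChartAt (𝓡 (m + 1)) p).source}

theorem domain_mem_nhds {t : ℝ} (ht : t ∈ Ioo (-D.ε) D.ε) (x : N) :
    Ioo (-D.ε) D.ε ×ˢ (univ : Set N) ∈ 𝓝 (t, x) :=
  prod_mem_nhds (isOpen_Ioo.mem_nhds ht) univ_mem

theorem continuousAt_map {t : ℝ} (ht : t ∈ Ioo (-D.ε) D.ε) (x : N) :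
    ContinuousAt (fun p : ℝ × N => D.map p.1 p.2) (t, x) :=
  (D.contMDiffOn_map.continuousOn).continuousAt (D.domain_mem_nhds ht x)

theorem mdifferentiableAt_map {t : ℝ} (ht : t ∈ Ioo (-D.ε) D.ε) (x : N) :
    MDifferentiableAt (𝓡 m) (𝓡 (m + 1)) (D.map t) x := by
  have h1 := D.contMDiffOn_map.contMDiffAt (D.domain_mem_nhds ht x)
  exact (h1.comp x (contMDiffAt_const.prodMk contMDiffAt_id)).mdifferentiableAt (by simp)

theorem mdifferentiableAt_curve {t : ℝ} (ht : t ∈ Ioo (-D.ε) D.ε) (x : N) :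
    MDifferentiableAt 𝓘(ℝ, ℝ) (𝓡 (m + 1)) (fun s => D.map s x) t := by
  have h1 := D.contMDiffOn_map.contMDiffAt (D.domain_mem_nhds ht x)
  exact (h1.comp t (contMDiffAt_id.prodMk contMDiffAt_const)).mdifferentiableAt (by simp)

variable {q : N} {p : M} {z : ℝ × Euc m}

theorem mem_locO {t : ℝ} {x : N} (ht : t ∈ Ioo (-D.ε) D.ε) (hx : x ∈ (extChartAt (𝓡 m) q).source)
    (hp : D.map t x ∈ (extChartAt (𝓡 (m + 1)) p).source) :
    (t, extChartAt (𝓡 m) q x) ∈ D.locO q p :=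
  ⟨ht, (extChartAt (𝓡 m) q).map_source hx, by
    simp only [(extChartAt (𝓡 m) q).left_inv hx]; exact hp⟩

theorem symm_locF (hz : z ∈ D.locO q p) : (extChartAt (𝓡 (m + 1)) p).symm (D.locF q p z) =
    D.map z.1 ((extChartAt (𝓡 m) q).symm z.2) :=
  (extChartAt (𝓡 (m + 1)) p).left_inv hz.2.2

theorem gB_locF (hz : z ∈ D.locO q p) (u v : Euc (m + 1)) : gB g p (D.locF q p z)
    (dc p (D.map z.1 ((extChartAt (𝓡 m) q).symm z.2)) u)
    (dc p (D.map z.1 ((extChartAt (𝓡 m) q).symm z.2)) v) =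
      gAt g (D.map z.1 ((extChartAt (𝓡 m) q).symm z.2)) u v :=
  (gAt_eq_gB g hz.2.2 u v).symm

theorem zero_mem : (0 : ℝ) ∈ Ioo (-D.ε) D.ε := ⟨by linarith [D.ε_pos], D.ε_pos⟩

theorem eventually_mem_source {t : ℝ} (ht : t ∈ Ioo (-D.ε) D.ε) (x : N)
    (hp : D.map t x ∈ (extChartAt (𝓡 (m + 1)) p).source) : ∀ᶠ s in 𝓝 t,
      s ∈ Ioo (-D.ε) D.ε ∧ D.map s x ∈ (extChartAt (𝓡 (m + 1)) p).source :=
  Filter.Eventually.and (isOpen_Ioo.mem_nhds ht)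
    ((D.mdifferentiableAt_curve ht x).continuousAt.preimage_mem_nhds
      ((isOpen_extChartAt_source p).mem_nhds hp))

variable [IsManifold (𝓡 m) ∞ N]

theorem contMDiffAt_chart_prod {t : ℝ} {y : Euc m} (hy : y ∈ (extChartAt (𝓡 m) q).target) :
    ContMDiffAt 𝓘(ℝ, ℝ × Euc m) (𝓘(ℝ, ℝ).prod (𝓡 m)) ∞
      (fun z : ℝ × Euc m => (z.1, (extChartAt (𝓡 m) q).symm z.2)) (t, y) := by
  have h2 : ContMDiffAt 𝓘(ℝ, Euc m) (𝓡 m) ∞ (extChartAt (𝓡 m) q).symm y :=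
    (contMDiffOn_extChartAt_symm q).contMDiffAt ((isOpen_extChartAt_target q).mem_nhds hy)
  exact contDiff_fst.contMDiff.contMDiffAt.prodMk
    (ContMDiffAt.comp (t, y) h2 contDiff_snd.contMDiff.contMDiffAt)

theorem isOpen_locO (q : N) (p : M) : IsOpen (D.locO q p) := by
  rw [isOpen_iff_mem_nhds]
  rintro ⟨t, y⟩ ⟨h1, h2, h3⟩
  have h4 := (D.continuousAt_map h1 ((extChartAt (𝓡 m) q).symm y)).comp
    (f := fun z : ℝ × Euc m => (z.1, (extChartAt (𝓡 m) q).symm z.2)) (x := (t, y))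
    (contMDiffAt_chart_prod h2).continuousAt
  have h5 := h4.preimage_mem_nhds ((isOpen_extChartAt_source p).mem_nhds h3)
  filter_upwards [(isOpen_Ioo.preimage continuous_fst).mem_nhds h1,
    ((isOpen_extChartAt_target q).preimage continuous_snd).mem_nhds h2, h5] with z hz1 hz2 hz3
    using ⟨hz1, hz2, hz3⟩

theorem contDiffAt_locF (hz : z ∈ D.locO q p) : ContDiffAt ℝ ∞ (D.locF q p) z := by
  obtain ⟨t, y⟩ := z
  obtain ⟨h1, h2, h3⟩ := hz
  have h4 := (D.contMDiffOn_map.contMDiffAt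
    (D.domain_mem_nhds h1 ((extChartAt (𝓡 m) q).symm y))).comp (t, y)
    (contMDiffAt_chart_prod h2)
  have h5 : ContMDiffAt (𝓡 (m + 1)) 𝓘(ℝ, Euc (m + 1)) ∞ (extChartAt (𝓡 (m + 1)) p)
      (D.map t ((extChartAt (𝓡 m) q).symm y)) :=
    contMDiffAt_extChartAt' (by rwa [extChartAt_source] at h3)
  exact (ContMDiffAt.comp (t, y) h5 h4).contDiffAt

theorem contDiffAt_locY (hz : z ∈ D.locO q p) : ContDiffAt ℝ ∞ (D.locY q p) z := by
  obtain ⟨t, y⟩ := z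
  obtain ⟨h1, h2, h3⟩ := hz
  have h4 := (D.contMDiffOn_normal.contMDiffAt
    (D.domain_mem_nhds h1 ((extChartAt (𝓡 m) q).symm y))).comp (t, y)
    (contMDiffAt_chart_prod h2)
  exact contDiffAt_dc_of_contMDiffAt h4 h3

theorem fderiv_prod_right {W : Type*} [NormedAddCommGroup W] [NormedSpace ℝ W] {F : ℝ × Euc m → W}
    (hF : DifferentiableAt ℝ F z) (w : Euc m) :
    fderiv ℝ F z (0, w) = fderiv ℝ (fun y => F (z.1, y)) z.2 w := by
  have h1 : HasFDerivAt F (fderiv ℝ F z) (z.1, z.2) := hF.hasFDerivAt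
  have h2 := h1.comp z.2 (hasFDerivAt_prodMk_right z.1 z.2)
  exact (congrArg (fun L : Euc m →L[ℝ] W => L w) h2.fderiv).symm

theorem fderiv_prod_left {W : Type*} [NormedAddCommGroup W] [NormedSpace ℝ W] {F : ℝ × Euc m → W}
    (hF : DifferentiableAt ℝ F z) :
    fderiv ℝ F z (1, 0) = deriv (fun t => F (t, z.2)) z.1 := by
  have h1 : HasFDerivAt F (fderiv ℝ F z) (z.1, z.2) := hF.hasFDerivAt
  have h2 := h1.comp z.1 (f := fun t => (t, z.2)) (hasFDerivAt_prodMk_left (𝕜 := ℝ) z.1 z.2)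
  exact (congrArg (fun L : ℝ →L[ℝ] W => L 1) h2.fderiv).symm

/-- The velocity, on the vector spaces underlying the tangent spaces. -/
def vel (t : ℝ) (x : N) : Euc (m + 1) := D.velocity t x

/-- The unit normal, on the vector spaces underlying the tangent spaces. -/
def nor (t : ℝ) (x : N) : Euc (m + 1) := D.normal t x

theorem fderiv_locF_right (hz : z ∈ D.locO q p) (w : Euc m) :
    fderiv ℝ (D.locF q p) z (0, w) = dc p (D.map z.1 ((extChartAt (𝓡 m) q).symm z.2))
      (mder (D.map z.1) ((extChartAt (𝓡 m) q).symm z.2) (dcs q z.2 w)) := by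
  rw [fderiv_prod_right ((D.contDiffAt_locF hz).differentiableAt (by simp))]
  have h := (hasFDerivAt_rep (n := m + 1) (q := q) ((extChartAt (𝓡 m) q).map_target hz.2.1) hz.2.2
    (D.mdifferentiableAt_map hz.1 _)).2 w
  rw [(extChartAt (𝓡 m) q).right_inv hz.2.1] at h
  exact h

theorem fderiv_locF_left (hz : z ∈ D.locO q p) :
    fderiv ℝ (D.locF q p) z (1, 0) = dc p (D.map z.1 ((extChartAt (𝓡 m) q).symm z.2))
      (D.vel z.1 ((extChartAt (𝓡 m) q).symm z.2)) := by
  rw [fderiv_prod_left ((D.contDiffAt_locF hz).differentiableAt (by simp))]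
  have h := mfderiv_comp z.1 (hasMFDerivAt_chart hz.2.2) (D.mdifferentiableAt_curve hz.1 _)
  rw [mfderiv_eq_fderiv] at h
  exact congrArg (fun L : ℝ →L[ℝ] Euc (m + 1) => L 1) h

theorem tang_locF (hz : z ∈ D.locO q p) (i : Fin m) :
    tang (D.locF q p) locX z i = dc p (D.map z.1 ((extChartAt (𝓡 m) q).symm z.2))
      (mder (D.map z.1) ((extChartAt (𝓡 m) q).symm z.2) (dcs q z.2 (bv i))) :=
  D.fderiv_locF_right hz _

theorem dc_injective {n : ℕ} {M : Type*} [TopologicalSpace M] [ChartedSpace (Euc n) M]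
    [IsManifold (𝓡 n) ∞ M] {p x : M} (hx : x ∈ (extChartAt (𝓡 n) p).source) :
    Function.Injective (dc p x : Euc n → Euc n) := fun u v h => by
  rw [← dcs_dc hx u, h, dcs_dc hx]

theorem dcs_injective {n : ℕ} {M : Type*} [TopologicalSpace M] [ChartedSpace (Euc n) M]
    [IsManifold (𝓡 n) ∞ M] {p : M} {y : Euc n} (hy : y ∈ (extChartAt (𝓡 n) p).target) :
    Function.Injective (dcs p y : Euc n → Euc n) := fun u v h => by
  rw [← dc_dcs hy u, h, dc_dcs hy]

/-- In charts, a deformation is a family of hypersurfaces with unit normal. -/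
theorem hypFamily (q : N) (p : M) : HypFamily (gB g p) (extChartAt (𝓡 (m + 1)) p).target
    (D.locF q p) (D.locY q p) locX (D.locO q p) where
  metric := localMetric_gB g p
  isOpen := D.isOpen_locO q p
  maps z hz := (extChartAt (𝓡 (m + 1)) p).map_source hz.2.2
  smooth_map z hz := D.contDiffAt_locF hz
  smooth_normal z hz := D.contDiffAt_locY hz
  frame z hz := by
    have hl := (localMetric_gB g p)
    have ht := (extChartAt (𝓡 (m + 1)) p).map_source hz.2.2
    refine ⟨hl.symm _ ht, hl.pos _ ht, ?_, ?_, fun i => ?_⟩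
    · have h1 : tang (D.locF q p) locX z = fun i => ((dc p (D.map z.1
        ((extChartAt (𝓡 m) q).symm z.2))).comp ((mder (D.map z.1)
        ((extChartAt (𝓡 m) q).symm z.2)).comp (dcs q z.2))).toLinearMap (bv i) := by
        funext i; rw [D.tang_locF hz]; rfl
      rw [h1]
      have hb : LinearIndependent ℝ (fun i : Fin m => (bv i : Euc m)) := by
        have h3 : (fun i : Fin m => (bv i : Euc m)) =
            (EuclideanSpace.basisFun (Fin m) ℝ).toBasis := by funext i; simp
        rw [h3]
        exact (EuclideanSpace.basisFun (Fin m) ℝ).toBasis.linearIndependent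
      refine hb.map' _ (LinearMap.ker_eq_bot.2 ?_)
      have h2 : Function.Injective (mder (n := m + 1) (D.map z.1)
        ((extChartAt (𝓡 m) q).symm z.2)) := D.immersion z.1 hz.1 _
      exact (dc_injective hz.2.2).comp (h2.comp (dcs_injective hz.2.1))
    · exact (D.gB_locF hz _ _).trans (D.normal_unit z.1 hz.1 _)
    · rw [D.tang_locF hz]
      exact (D.gB_locF hz _ _).trans (D.normal_orthogonal z.1 hz.1 _ _)

end Deformation

end Schlaefli

end

noncomputable section

namespace Schlaefli

/-! ### Pointwise variation formula -/

section MatrixChange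

variable {m : ℕ} {P G C E : Matrix (Fin m) (Fin m) ℝ}

/-- Traces of 2-tensors are invariant under a change of basis. -/
theorem trace_conj (hP : IsUnit P.det) :
    ((P.transpose * G * P)⁻¹ * (P.transpose * C * P)).trace = (G⁻¹ * C).trace := by
  have hPt : IsUnit P.transpose.det := by rwa [Matrix.det_transpose]
  rw [Matrix.mul_inv_rev, Matrix.mul_inv_rev]
  have h1 : P⁻¹ * (G⁻¹ * P.transpose⁻¹) * (P.transpose * C * P) = P⁻¹ * (G⁻¹ * C * P) := by
    simp only [Matrix.mul_assoc]
    rw [Matrix.nonsing_inv_mul_cancel_left _ _ hPt]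
  rw [h1, Matrix.trace_mul_comm, Matrix.mul_assoc, Matrix.mul_nonsing_inv _ hP, Matrix.mul_one]

/-- Scalar products of 2-tensors are invariant under a change of basis. -/
theorem trace_conj₂ (hP : IsUnit P.det) :
    ((P.transpose * G * P)⁻¹ * (P.transpose * C * P) * (P.transpose * G * P)⁻¹ *
      (P.transpose * E * P).transpose).trace = (G⁻¹ * C * G⁻¹ * E.transpose).trace := by
  have hPt : IsUnit P.transpose.det := by rwa [Matrix.det_transpose]
  have h2 : (P.transpose * G * P)⁻¹ * (P.transpose * C * P) * (P.transpose * G * P)⁻¹ *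
      (P.transpose * E * P).transpose = (P.transpose * G * P)⁻¹ *
        (P.transpose * (C * G⁻¹ * E.transpose) * P) := by
    rw [Matrix.mul_inv_rev, Matrix.mul_inv_rev]
    simp only [Matrix.mul_assoc, Matrix.transpose_mul, Matrix.transpose_transpose]
    simp only [Matrix.mul_nonsing_inv_cancel_left _ _ hP,
      Matrix.nonsing_inv_mul_cancel_left _ _ hPt]
  rw [h2, trace_conj hP]
  simp only [Matrix.mul_assoc]

/-- Matrix of a linear map. -/
def jac (A : Euc m →L[ℝ] Euc m) : Matrix (Fin m) (Fin m) ℝ := Matrix.of fun i j => A (bv j) i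

theorem isUnit_det_jac {A : Euc m →L[ℝ] Euc m} (hA : Function.Injective A) :
    IsUnit (jac A).det := by
  rw [isUnit_iff_ne_zero]
  intro h0
  obtain ⟨v, hv, hv0⟩ := Matrix.exists_mulVec_eq_zero_iff.2 h0
  refine hv ?_
  have h1 : A (WithLp.toLp 2 v) = 0 := by
    rw [clm_eq_sum A]
    ext i
    have := congrFun hv0 i
    simp only [Matrix.mulVec, dotProduct, jac, Matrix.of_apply] at this
    simp only [WithLp.ofLp_sum, Finset.sum_apply, PiLp.smul_apply, smul_eq_mul, PiLp.zero_apply]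
    rw [← Pi.zero_apply (M := fun _ => ℝ) i, ← this]
    exact Finset.sum_congr rfl fun j _ => mul_comm _ _
  have h2 := hA (h1.trans (map_zero A).symm)
  simpa using h2

theorem conj_jac (β : Euc m →L[ℝ] Euc m →L[ℝ] ℝ) (A : Euc m →L[ℝ] Euc m) :
    Matrix.of (fun i j => β (A (bv i)) (A (bv j))) =
      (jac A).transpose * compMat β * jac A := by
  ext i j
  rw [Matrix.of_apply, compMat_mulVec]
  simp only [Matrix.mul_apply, Matrix.transpose_apply, jac, Matrix.of_apply, Finset.sum_mul]
  rw [Finset.sum_comm]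
  exact Finset.sum_congr rfl fun a _ => Finset.sum_congr rfl fun b _ => by ring

end MatrixChange

namespace Deformation

variable {m : ℕ} {M : Type*} [TopologicalSpace M] [ChartedSpace (Euc (m + 1)) M]
  [IsManifold (𝓡 (m + 1)) ∞ M] {N : Type*} [TopologicalSpace N] [ChartedSpace (Euc m) N]
  [IsManifold (𝓡 m) ∞ N] {g : Metric (m + 1) M} (D : Deformation g N) {q : N} {p : M} {x : N}
  {t : ℝ}

/-- The induced metric as the first fundamental form of the family `locF` in charts. -/
theorem firstForm_eq (ht : t ∈ Ioo (-D.ε) D.ε) (hx : x ∈ (extChartAt (𝓡 m) q).source)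
    (hp : D.map t x ∈ (extChartAt (𝓡 (m + 1)) p).source) (X Y : Euc m) :
    D.firstForm t x X Y = gB g p (D.locF q p (t, extChartAt (𝓡 m) q x))
      (fderiv ℝ (D.locF q p) (t, extChartAt (𝓡 m) q x) (0, dc q x X))
      (fderiv ℝ (D.locF q p) (t, extChartAt (𝓡 m) q x) (0, dc q x Y)) := by
  have hz := D.mem_locO ht hx hp
  rw [D.fderiv_locF_right hz, D.fderiv_locF_right hz, D.gB_locF hz]
  simp only [(extChartAt (𝓡 m) q).left_inv hx, dcs_dc hx]
  rfl

/-- The second fundamental form in charts. The sign is that of the shape operator `X ↦ -D_X n`. -/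
theorem secondForm_eq (ht : t ∈ Ioo (-D.ε) D.ε) (hx : x ∈ (extChartAt (𝓡 m) q).source)
    (hp : D.map t x ∈ (extChartAt (𝓡 (m + 1)) p).source) (X Y : Euc m) :
    D.secondForm t x X Y = -gB g p (D.locF q p (t, extChartAt (𝓡 m) q x))
      (fderiv ℝ (D.locF q p) (t, extChartAt (𝓡 m) q x) (0, dc q x X))
      (cov (lc (gB g p)) (D.locF q p) (D.locY q p) (0, dc q x Y)
        (t, extChartAt (𝓡 m) q x)) := by
  have hz := D.mem_locO ht hx hp
  have hF := (D.contDiffAt_locF hz).differentiableAt (by simp)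
  have hY := (D.contDiffAt_locY hz).differentiableAt (by simp)
  have hYr : DifferentiableAt ℝ (repV q p (D.map t) (D.normal t)) (extChartAt (𝓡 m) q x) :=
    hY.comp (extChartAt (𝓡 m) q x) (f := fun y => (t, y))
      (hasFDerivAt_prodMk_right (𝕜 := ℝ) t _).differentiableAt
  have h1 := dc_covDerivAlong g hx hp (D.mdifferentiableAt_map ht x) hYr Y
  have h2 : cov (lc (gB g p)) (rep q p (D.map t)) (repV q p (D.map t) (D.normal t)) (dc q x Y)
      (extChartAt (𝓡 m) q x) = cov (lc (gB g p)) (D.locF q p) (D.locY q p) (0, dc q x Y)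
        (t, extChartAt (𝓡 m) q x) := by
    rw [cov, cov, fderiv_prod_right hF, fderiv_prod_right hY]
    rfl
  rw [← h2, ← h1, D.fderiv_locF_right hz]
  simp only [(extChartAt (𝓡 m) q).left_inv hx, dcs_dc hx]
  have h3 := D.gB_locF hz (mder (D.map t) x X) (covDerivAlong g.tensor (D.map t) (D.normal t) x Y)
  simp only [(extChartAt (𝓡 m) q).left_inv hx] at h3
  rw [h3]
  exact map_neg (gAt g (D.map t x) (mder (D.map t) x X)) _

theorem gram_firstForm (ht : t ∈ Ioo (-D.ε) D.ε) (hx : x ∈ (extChartAt (𝓡 m) q).source)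
    (hp : D.map t x ∈ (extChartAt (𝓡 (m + 1)) p).source) :
    gram (D.firstForm t) x = (jac (dc q x)).transpose *
      ff (gB g p) (D.locF q p) locX (t, extChartAt (𝓡 m) q x) * jac (dc q x) := by
  set z : ℝ × Euc m := (t, extChartAt (𝓡 m) q x) with hz
  set L : Euc m →L[ℝ] Euc (m + 1) :=
    (fderiv ℝ (D.locF q p) z).comp (ContinuousLinearMap.inr ℝ ℝ (Euc m)) with hL
  have h1 := conj_jac ((gB g p (D.locF q p z)).bilinearComp L L) (dc q x)
  refine Eq.trans ?_ h1
  ext i j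
  exact D.firstForm_eq ht hx hp (bv i) (bv j)

theorem gram_secondForm (ht : t ∈ Ioo (-D.ε) D.ε) (hx : x ∈ (extChartAt (𝓡 m) q).source)
    (hp : D.map t x ∈ (extChartAt (𝓡 (m + 1)) p).source) :
    gram (D.secondForm t) x = (jac (dc q x)).transpose *
      -covMat (gB g p) (D.locF q p) (D.locY q p) locX (t, extChartAt (𝓡 m) q x) *
        jac (dc q x) := by
  set z : ℝ × Euc m := (t, extChartAt (𝓡 m) q x) with hz
  set L : Euc m →L[ℝ] Euc (m + 1) :=
    (fderiv ℝ (D.locF q p) z).comp (ContinuousLinearMap.inr ℝ ℝ (Euc m)) with hL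
  set L' : Euc m →L[ℝ] Euc (m + 1) :=
    (fderiv ℝ (D.locY q p) z + ((lc (gB g p) (D.locF q p z)).flip (D.locY q p z)).comp
      (fderiv ℝ (D.locF q p) z)).comp (ContinuousLinearMap.inr ℝ ℝ (Euc m)) with hL'
  have h1 := conj_jac (-(gB g p (D.locF q p z)).bilinearComp L L') (dc q x)
  refine Eq.trans ?_ h1
  ext i j
  exact D.secondForm_eq ht hx hp (bv i) (bv j)

theorem isUnit_jac (hx : x ∈ (extChartAt (𝓡 m) q).source) : IsUnit (jac (dc (n := m) q x)).det :=
  isUnit_det_jac (dc_injective hx)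

/-- The mean curvature can be computed in any charts. -/
theorem meanCurvature_eq (ht : t ∈ Ioo (-D.ε) D.ε) (hx : x ∈ (extChartAt (𝓡 m) q).source)
    (hp : D.map t x ∈ (extChartAt (𝓡 (m + 1)) p).source) :
    D.meanCurvature t x = ((ff (gB g p) (D.locF q p) locX (t, extChartAt (𝓡 m) q x))⁻¹ *
      -covMat (gB g p) (D.locF q p) (D.locY q p) locX (t, extChartAt (𝓡 m) q x)).trace := by
  rw [meanCurvature, traceWith, D.gram_firstForm ht hx hp, D.gram_secondForm ht hx hp,
    trace_conj (isUnit_jac hx)]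

theorem differentiableAt_slice {W : Type*} [NormedAddCommGroup W] [NormedSpace ℝ W]
    {F : ℝ × Euc m → W} {y : Euc m} (hF : DifferentiableAt ℝ F (t, y)) :
    DifferentiableAt ℝ (fun s => F (s, y)) t :=
  hF.comp t (f := fun s => (s, y)) (hasFDerivAt_prodMk_left (𝕜 := ℝ) t y).differentiableAt

theorem differentiableAt_firstForm (x : N) (X Y : Euc m) :
    DifferentiableAt ℝ (fun t => D.firstForm t x X Y) 0 := by
  have hx := mem_extChartAt_source (I := 𝓡 m) x
  have hp := mem_extChartAt_source (I := 𝓡 (m + 1)) (D.map 0 x)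
  have hz := D.mem_locO D.zero_mem hx hp
  have h := D.hypFamily x (D.map 0 x)
  have h1 := differentiableAt_slice ((h.contDiffAt_inner hz
    (contDiffAt_fderiv_apply (h.smooth_map _ hz) (0, dc x x X))
    (contDiffAt_fderiv_apply (h.smooth_map _ hz) (0, dc x x Y))).differentiableAt (by simp))
  refine h1.congr_of_eventuallyEq ?_
  filter_upwards [D.eventually_mem_source D.zero_mem x hp] with s hs
  exact D.firstForm_eq hs.1 hx hs.2 X Y

theorem differentiableAt_meanCurvature (x : N) :
    DifferentiableAt ℝ (fun t => D.meanCurvature t x) 0 := by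
  have hx := mem_extChartAt_source (I := 𝓡 m) x
  have hp := mem_extChartAt_source (I := 𝓡 (m + 1)) (D.map 0 x)
  have hz := D.mem_locO D.zero_mem hx hp
  have h := D.hypFamily x (D.map 0 x)
  have h1 := differentiableAt_slice ((h.contDiffAt_trace hz
    (h.smooth_normal _ hz)).differentiableAt (by simp)).neg
  refine h1.congr_of_eventuallyEq ?_
  filter_upwards [D.eventually_mem_source D.zero_mem x hp] with s hs
  rw [D.meanCurvature_eq hs.1 hx hs.2, Matrix.mul_neg, Matrix.trace_neg]
  rfl

/-- The components of `I'`, in the preferred chart at `x`, are obtained from those in the chart at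
`q` by the Jacobian matrix `jac (dc q x)`, which does not depend on time. -/
theorem gram_firstFormVar (hx : x ∈ (extChartAt (𝓡 m) q).source)
    (hp : D.map 0 x ∈ (extChartAt (𝓡 (m + 1)) p).source) :
    gram D.firstFormVar x = (jac (dc q x)).transpose *
      dmat (ff (gB g p) (D.locF q p) locX) (0, extChartAt (𝓡 m) q x) (1, 0) * jac (dc q x) := by
  have hz := D.mem_locO D.zero_mem hx hp
  have hd : ∀ a b, DifferentiableAt ℝ (fun z => ff (gB g p) (D.locF q p) locX z a b)
      (0, extChartAt (𝓡 m) q x) := fun a b =>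
    ((D.hypFamily q p).contDiffAt_ff hz a b).differentiableAt (by simp)
  ext i j
  have h1 : (fun t => D.firstForm t x (stdVec x i) (stdVec x j)) =ᶠ[𝓝 0] fun t =>
      ∑ b, (∑ a, (jac (dc q x)).transpose i a *
        ff (gB g p) (D.locF q p) locX (t, extChartAt (𝓡 m) q x) a b) * jac (dc q x) b j := by
    filter_upwards [D.eventually_mem_source D.zero_mem x hp] with s hs
    exact congrFun (congrFun (D.gram_firstForm hs.1 hx hs.2) i) j
  have h2 : HasDerivAt (fun t => ∑ b, (∑ a, (jac (dc q x)).transpose i a *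
      ff (gB g p) (D.locF q p) locX (t, extChartAt (𝓡 m) q x) a b) * jac (dc q x) b j)
      (∑ b, (∑ a, (jac (dc q x)).transpose i a *
        dmat (ff (gB g p) (D.locF q p) locX) (0, extChartAt (𝓡 m) q x) (1, 0) a b) *
          jac (dc q x) b j) 0 := by
    refine HasDerivAt.fun_sum fun b _ => HasDerivAt.mul_const (HasDerivAt.fun_sum fun a _ =>
      HasDerivAt.const_mul _ ?_) _
    have h3 := (differentiableAt_slice (hd a b)).hasDerivAt
    rwa [← fderiv_prod_left (z := (0, extChartAt (𝓡 m) q x)) (hd a b)] at h3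
  refine (h1.deriv_eq.trans h2.deriv).trans ?_
  rfl

/-- The integrand of the variation formula. -/
def integrand (x : N) : ℝ :=
  D.meanCurvatureVar x + (1 / 2) * innerWith (D.firstForm 0) D.firstFormVar (D.secondForm 0) x

/-- The integrand in charts. -/
theorem integrand_eq (hx : x ∈ (extChartAt (𝓡 m) q).source)
    (hp : D.map 0 x ∈ (extChartAt (𝓡 (m + 1)) p).source) :
    D.integrand x = ∑ k, curv (lc (gB g p)) (D.locF q p (0, extChartAt (𝓡 m) q x)) (bv k)
        (fderiv ℝ (D.locF q p) (0, extChartAt (𝓡 m) q x) (1, 0))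
        (D.locY q p (0, extChartAt (𝓡 m) q x)) k
      - ((ff (gB g p) (D.locF q p) locX (0, extChartAt (𝓡 m) q x))⁻¹ *
        covMat (gB g p) (D.locF q p) (cov (lc (gB g p)) (D.locF q p) (D.locY q p) (1, 0)) locX
          (0, extChartAt (𝓡 m) q x)).trace := by
  have hz := D.mem_locO D.zero_mem hx hp
  have h := D.hypFamily q p
  rw [← h.fderiv_mean hz (1, 0), integrand, innerWith, D.gram_firstForm D.zero_mem hx hp,
    D.gram_secondForm D.zero_mem hx hp, D.gram_firstFormVar hx hp,
    trace_conj₂ (isUnit_jac hx)]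
  congr 1
  have hd : DifferentiableAt ℝ (fun z => ((ff (gB g p) (D.locF q p) locX z)⁻¹ *
      -covMat (gB g p) (D.locF q p) (D.locY q p) locX z).trace) (0, extChartAt (𝓡 m) q x) := by
    have h1 := ((h.contDiffAt_trace hz (h.smooth_normal _ hz)).differentiableAt (by simp)).neg
    refine h1.congr_of_eventuallyEq (Eventually.of_forall fun z => ?_)
    simp only [Matrix.mul_neg, Matrix.trace_neg, Pi.neg_apply]
  rw [fderiv_prod_left hd, meanCurvatureVar]
  refine EventuallyEq.deriv_eq ?_
  filter_upwards [D.eventually_mem_source D.zero_mem x hp] with s hs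
  exact D.meanCurvature_eq hs.1 hx hs.2

end Deformation

end Schlaefli

end

noncomputable section

namespace Schlaefli

namespace Deformation

/-! ### The variation of the normal -/

variable {m : ℕ} {M : Type*} [TopologicalSpace M] [ChartedSpace (Euc (m + 1)) M]
  [IsManifold (𝓡 (m + 1)) ∞ M] {N : Type*} [TopologicalSpace N] [ChartedSpace (Euc m) N]
  {g : Metric (m + 1) M} (D : Deformation g N) {q : N} {p p' : M} {x : N}
  {z : ℝ × Euc m}

/-- The covariant time derivative of the unit normal, in charts. -/
def locZ (q : N) (p : M) : ℝ × Euc m → Euc (m + 1) :=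
  cov (lc (gB g p)) (D.locF q p) (D.locY q p) (1, 0)

theorem locY_apply {t : ℝ} (hx : x ∈ (extChartAt (𝓡 m) q).source) :
    D.locY q p (t, extChartAt (𝓡 m) q x) = dc p (D.map t x) (D.nor t x) := by
  have h : D.locY q p (t, extChartAt (𝓡 m) q x) =
      dc p (D.map t ((extChartAt (𝓡 m) q).symm (extChartAt (𝓡 m) q x)))
        (D.nor t ((extChartAt (𝓡 m) q).symm (extChartAt (𝓡 m) q x))) := rfl
  rw [h, (extChartAt (𝓡 m) q).left_inv hx]

theorem locF_trans (hz : z ∈ D.locO q p) :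
    D.locF q p' z = trans p p' (D.locF q p z) := by
  rw [trans, D.symm_locF hz]; rfl

theorem symm_locF_mem (hz : z ∈ D.locO q p) (hz' : z ∈ D.locO q p') :
    (extChartAt (𝓡 (m + 1)) p).symm (D.locF q p z) ∈ (extChartAt (𝓡 (m + 1)) p').source := by
  rw [D.symm_locF hz]; exact hz'.2.2

theorem locF_mem_target (hz : z ∈ D.locO q p) :
    D.locF q p z ∈ (extChartAt (𝓡 (m + 1)) p).target := (extChartAt (𝓡 (m + 1)) p).map_source hz.2.2

variable [IsManifold (𝓡 m) ∞ N]

theorem contDiffAt_locZ (hz : z ∈ D.locO q p) : ContDiffAt ℝ ∞ (D.locZ q p) z :=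
  (D.hypFamily q p).metric.contDiffAt_cov (D.contDiffAt_locF hz) ((D.hypFamily q p).maps z hz)
    (D.contDiffAt_locY hz) _

/-- Components of tangent vectors in two charts. -/
theorem dc_trans (hz : z ∈ D.locO q p) (hz' : z ∈ D.locO q p') (u : Euc (m + 1)) :
    dc p' (D.map z.1 ((extChartAt (𝓡 m) q).symm z.2)) u = fderiv ℝ (trans p p') (D.locF q p z)
      (dc p (D.map z.1 ((extChartAt (𝓡 m) q).symm z.2)) u) := by
  rw [fderiv_trans (D.locF_mem_target hz) (D.symm_locF_mem hz hz'), D.symm_locF hz]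
  congr 1
  exact (dcs_dc hz.2.2 u).symm

theorem tang_trans (hz : z ∈ D.locO q p) (hz' : z ∈ D.locO q p') (i : Fin m) :
    tang (D.locF q p') locX z i =
      fderiv ℝ (trans p p') (D.locF q p z) (tang (D.locF q p) locX z i) := by
  rw [D.tang_locF hz, D.tang_locF hz', D.dc_trans hz hz']

/-- Covariant derivatives along the deformation transform as vectors under a change of the chart of
`M`. -/
theorem cov_locF_trans (hz : z ∈ D.locO q p) (hz' : z ∈ D.locO q p')
    {A A' : ℝ × Euc m → Euc (m + 1)} (hA : DifferentiableAt ℝ A z)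
    (h : ∀ w ∈ D.locO q p ∩ D.locO q p', A' w = fderiv ℝ (trans p p') (D.locF q p w) (A w))
    (T : ℝ × Euc m) :
    cov (lc (gB g p')) (D.locF q p') A' T z =
      fderiv ℝ (trans p p') (D.locF q p z) (cov (lc (gB g p)) (D.locF q p) A T z) := by
  have ho := ((D.isOpen_locO q p).inter (D.isOpen_locO q p')).mem_nhds ⟨hz, hz'⟩
  have h1 : D.locF q p' =ᶠ[𝓝 z] fun w => trans p p' (D.locF q p w) := by
    filter_upwards [ho] with w hw using D.locF_trans hw.1
  have h2 : A' =ᶠ[𝓝 z] fun w => fderiv ℝ (trans p p') (D.locF q p w) (A w) := by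
    filter_upwards [ho] with w hw using h w hw
  rw [cov_congr h1 h2]
  exact cov_trans g (D.locF_mem_target hz) (D.symm_locF_mem hz hz')
    ((D.contDiffAt_locF hz).differentiableAt (by simp)) hA T

theorem locZ_trans (hz : z ∈ D.locO q p) (hz' : z ∈ D.locO q p') :
    D.locZ q p' z = fderiv ℝ (trans p p') (D.locF q p z) (D.locZ q p z) :=
  D.cov_locF_trans hz hz' ((D.contDiffAt_locY hz).differentiableAt (by simp))
    (fun _ hw => D.dc_trans hw.1 hw.2 _) _

theorem gB_trans_locF (hz : z ∈ D.locO q p) (hz' : z ∈ D.locO q p') (u v : Euc (m + 1)) :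
    gB g p' (D.locF q p' z) (fderiv ℝ (trans p p') (D.locF q p z) u)
      (fderiv ℝ (trans p p') (D.locF q p z) v) = gB g p (D.locF q p z) u v := by
  rw [gB_trans g (D.locF_mem_target hz) (D.symm_locF_mem hz hz'), D.locF_trans hz]

theorem ff_trans (hz : z ∈ D.locO q p) (hz' : z ∈ D.locO q p') :
    ff (gB g p') (D.locF q p') locX z = ff (gB g p) (D.locF q p) locX z := by
  ext i j
  simp only [ff, gramOf, Matrix.of_apply, D.tang_trans hz hz', D.gB_trans_locF hz hz']

theorem covMat_locZ_trans (hz : z ∈ D.locO q p) (hz' : z ∈ D.locO q p') :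
    covMat (gB g p') (D.locF q p') (D.locZ q p') locX z =
      covMat (gB g p) (D.locF q p) (D.locZ q p) locX z := by
  ext i j
  simp only [covMat, Matrix.of_apply, D.tang_trans hz hz']
  rw [D.cov_locF_trans hz hz' ((D.contDiffAt_locZ hz).differentiableAt (by simp))
    (fun w hw => D.locZ_trans hw.1 hw.2), D.gB_trans_locF hz hz']

/-- The covariant time derivative of the unit normal at `t = 0`. -/
def normalVar (x : N) : Euc (m + 1) := D.locZ x (D.map 0 x) (0, extChartAt (𝓡 m) x x)

/-- The vector `normalVar` has components `locZ` in all charts. -/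
theorem locZ_eq (hx : x ∈ (extChartAt (𝓡 m) q).source)
    (hp : D.map 0 x ∈ (extChartAt (𝓡 (m + 1)) p).source) :
    D.locZ q p (0, extChartAt (𝓡 m) q x) = dc p (D.map 0 x) (D.normalVar x) := by
  have hx' := mem_extChartAt_source (I := 𝓡 m) x
  have hp' := mem_extChartAt_source (I := 𝓡 (m + 1)) (D.map 0 x)
  have hz := D.mem_locO D.zero_mem hx hp
  have hz1 := D.mem_locO D.zero_mem hx' hp
  have hz2 := D.mem_locO D.zero_mem hx' hp'
  have h1 : D.locZ q p (0, extChartAt (𝓡 m) q x) = D.locZ x p (0, extChartAt (𝓡 m) x x) := by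
    have e1 : (fun t => D.locF q p (t, extChartAt (𝓡 m) q x)) =
        fun t => D.locF x p (t, extChartAt (𝓡 m) x x) := by
      funext t
      simp only [locF, rep, (extChartAt (𝓡 m) q).left_inv hx, (extChartAt (𝓡 m) x).left_inv hx']
    have e2 : (fun t => D.locY q p (t, extChartAt (𝓡 m) q x)) =
        fun t => D.locY x p (t, extChartAt (𝓡 m) x x) := by
      funext t
      rw [D.locY_apply hx, D.locY_apply hx']
    rw [locZ, locZ, cov, cov,
      fderiv_prod_left ((D.contDiffAt_locF hz).differentiableAt (by simp)),
      fderiv_prod_left ((D.contDiffAt_locF hz1).differentiableAt (by simp)),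
      fderiv_prod_left ((D.contDiffAt_locY hz).differentiableAt (by simp)),
      fderiv_prod_left ((D.contDiffAt_locY hz1).differentiableAt (by simp)), e1, e2,
      congrFun e1 0, congrFun e2 0]
  rw [h1, D.locZ_trans hz2 hz1, ← normalVar]
  have h2 := D.dc_trans hz2 hz1 (D.normalVar x)
  simp only [(extChartAt (𝓡 m) x).left_inv hx', dc_self, ContinuousLinearMap.id_apply] at h2
  exact h2.symm

/-- Components of the variation of the normal in the coordinate directions of the hypersurface. -/
def tanCoef (q : N) (p : M) (z : ℝ × Euc m) (k : Fin m) : ℝ :=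
  ∑ l, (ff (gB g p) (D.locF q p) locX z)⁻¹ k l *
    gB g p (D.locF q p z) (tang (D.locF q p) locX z l) (D.locZ q p z)

/-- The variation of the normal as a tangent vector field to the hypersurface. -/
def tanField (x : N) : Euc m :=
  WithLp.toLp 2 (D.tanCoef x (D.map 0 x) (0, extChartAt (𝓡 m) x x))

theorem contDiffAt_tanCoef (hz : z ∈ D.locO q p) (k : Fin m) :
    ContDiffAt ℝ ∞ (fun z => D.tanCoef q p z k) z := by
  have h := D.hypFamily q p
  exact ContDiffAt.sum fun l _ => (contDiffAt_inv_matrix (h.contDiffAt_ff hz)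
    (h.isUnit_det hz) k l).mul (h.contDiffAt_inner hz (h.contDiffAt_tang hz l)
      (D.contDiffAt_locZ hz))

/-- The normal has constant length, so that its covariant time derivative is tangential; its
components are `tanCoef`. -/
theorem sum_tanCoef (hz : z ∈ D.locO q p) :
    fderiv ℝ (D.locF q p) z (0, WithLp.toLp 2 (D.tanCoef q p z)) = D.locZ q p z := by
  have h := D.hypFamily q p
  conv_rhs => rw [(h.frame z hz).decomp (D.locZ q p z), locZ, h.inner_normal_cov hz]
  rw [zero_smul, add_zero]
  have h1 := clm_eq_sum ((fderiv ℝ (D.locF q p) z).comp (ContinuousLinearMap.inr ℝ ℝ (Euc m)))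
    (WithLp.toLp 2 (D.tanCoef q p z))
  exact h1

theorem mder_tanCoef (hx : x ∈ (extChartAt (𝓡 m) q).source)
    (hp : D.map 0 x ∈ (extChartAt (𝓡 (m + 1)) p).source) :
    mder (D.map 0) x (dcs q (extChartAt (𝓡 m) q x)
      (WithLp.toLp 2 (D.tanCoef q p (0, extChartAt (𝓡 m) q x)))) = D.normalVar x := by
  have hz := D.mem_locO D.zero_mem hx hp
  have h1 := D.sum_tanCoef hz
  rw [D.fderiv_locF_right hz, D.locZ_eq hx hp] at h1
  simp only [(extChartAt (𝓡 m) q).left_inv hx] at h1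
  exact dc_injective hp h1

/-- The coefficients `tanCoef` are the components of the vector field `tanField` in all charts: the
field is determined by its image under the immersion, which is `normalVar`. -/
theorem tanCoef_eq (hx : x ∈ (extChartAt (𝓡 m) q).source)
    (hp : D.map 0 x ∈ (extChartAt (𝓡 (m + 1)) p).source) (k : Fin m) :
    D.tanCoef q p (0, extChartAt (𝓡 m) q x) k = dc q x (D.tanField x) k := by
  have h1 := D.mder_tanCoef hx hp
  have h2 := D.mder_tanCoef (mem_extChartAt_source (I := 𝓡 m) x)
    (mem_extChartAt_source (I := 𝓡 (m + 1)) (D.map 0 x))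
  have hinj : Function.Injective (mder (n := m + 1) (D.map 0) x) := D.immersion 0 D.zero_mem x
  have h3 := hinj (h1.trans h2.symm)
  rw [dcs_self, ContinuousLinearMap.id_apply] at h3
  have h4 := congrArg (dc q x) h3
  have h5 := dc_dcs ((extChartAt (𝓡 m) q).map_source hx)
    (WithLp.toLp 2 (D.tanCoef q p (0, extChartAt (𝓡 m) q x)))
  rw [(extChartAt (𝓡 m) q).left_inv hx] at h5
  rw [h5] at h4
  exact congrArg (fun u : Euc m => u k) h4

/-- The divergence of the variation of the normal: by the variation formula, it is the difference
between `c ⟨v, n⟩` and the integrand. -/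
def divNormalVar (c : ℝ) (x : N) : ℝ :=
  c * gAt g (D.map 0 x) (D.vel 0 x) (D.nor 0 x) - D.integrand x

/-- On an Einstein manifold, `divNormalVar` is the trace of the covariant derivative of the
variation of the normal: this is the variation formula, where the curvature term is `c ⟨v, n⟩`. -/
theorem divNormalVar_eq_trace {c : ℝ}
    (hE : ∀ (p : M) (Y Z : TangentSpace (𝓡 (m + 1)) p),
      ricci g.tensor p Y Z = c * g.tensor p Y Z)
    (hx : x ∈ (extChartAt (𝓡 m) q).source)
    (hp : D.map 0 x ∈ (extChartAt (𝓡 (m + 1)) p).source) :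
    D.divNormalVar c x = ((ff (gB g p) (D.locF q p) locX (0, extChartAt (𝓡 m) q x))⁻¹ *
      covMat (gB g p) (D.locF q p) (D.locZ q p) locX (0, extChartAt (𝓡 m) q x)).trace := by
  have hp' := mem_extChartAt_source (I := 𝓡 (m + 1)) (D.map 0 x)
  have hz := D.mem_locO D.zero_mem hx hp
  have hz' := D.mem_locO D.zero_mem hx hp'
  rw [← D.ff_trans hz hz', ← D.covMat_locZ_trans hz hz', divNormalVar, D.integrand_eq hx hp']
  have h1 : D.locF q (D.map 0 x) (0, extChartAt (𝓡 m) q x) =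
      extChartAt (𝓡 (m + 1)) (D.map 0 x) (D.map 0 x) := by
    simp only [locF, rep, (extChartAt (𝓡 m) q).left_inv hx]
  have h2 : D.locY q (D.map 0 x) (0, extChartAt (𝓡 m) q x) = D.nor 0 x := by
    rw [D.locY_apply hx, dc_self]; rfl
  have h3 : fderiv ℝ (D.locF q (D.map 0 x)) (0, extChartAt (𝓡 m) q x) (1, 0) = D.vel 0 x := by
    rw [D.fderiv_locF_left hz']
    simp only [(extChartAt (𝓡 m) q).left_inv hx, dc_self]; rfl
  have h4 : ricci g.tensor (D.map 0 x) (D.velocity 0 x) (D.normal 0 x) =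
      c * gAt g (D.map 0 x) (D.vel 0 x) (D.nor 0 x) := hE _ _ _
  have h5 := ricci_eq g (D.map 0 x) (D.vel 0 x) (D.nor 0 x)
  rw [h1, h2, h3, ← h5.symm.trans h4, sub_sub_cancel]
  rfl

/-- The density of the area measure in charts. -/
def locArea (q : N) (p : M) (y : Euc m) : ℝ := √(ff (gB g p) (D.locF q p) locX (0, y)).det

theorem contDiffAt_locArea {y : Euc m} (hz : ((0 : ℝ), y) ∈ D.locO q p) :
    ContDiffAt ℝ ∞ (D.locArea q p) y :=
  ((D.hypFamily q p).contDiffAt_area hz).comp y (f := fun y => ((0 : ℝ), y))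
    (contDiffAt_const.prodMk contDiffAt_id)

/-- In charts, `divNormalVar` is the divergence of the field `tanField`. -/
theorem locArea_mul_divNormalVar {c : ℝ}
    (hE : ∀ (p : M) (Y Z : TangentSpace (𝓡 (m + 1)) p),
      ricci g.tensor p Y Z = c * g.tensor p Y Z)
    (hx : x ∈ (extChartAt (𝓡 m) q).source)
    (hp : D.map 0 x ∈ (extChartAt (𝓡 (m + 1)) p).source) :
    D.locArea q p (extChartAt (𝓡 m) q x) * D.divNormalVar c x =
      ∑ k, fderiv ℝ (fun y => D.locArea q p y * D.tanCoef q p (0, y) k)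
        (extChartAt (𝓡 m) q x) (bv k) := by
  have h := D.hypFamily q p
  have hz := D.mem_locO D.zero_mem hx hp
  have hO := (D.isOpen_locO q p).mem_nhds hz
  rw [D.divNormalVar_eq_trace hE hx hp, locArea, h.area_mul_div hz (Z := D.locZ q p)
    (by filter_upwards [hO] with w hw using D.contDiffAt_locZ hw)
    (by filter_upwards [hO] with w hw using h.inner_normal_cov hw _)]
  refine Finset.sum_congr rfl fun k _ => ?_
  exact fderiv_prod_right (F := fun z => √(ff (gB g p) (D.locF q p) locX z).det *
    D.tanCoef q p z k) (((h.contDiffAt_area hz).mul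
      (D.contDiffAt_tanCoef hz k)).differentiableAt (by simp)) (bv k)

theorem gram_firstForm_zero_det (hx : x ∈ (extChartAt (𝓡 m) q).source)
    (hp : D.map 0 x ∈ (extChartAt (𝓡 (m + 1)) p).source) :
    chartGram (D.firstForm 0) q (extChartAt (𝓡 m) q x) =
      ff (gB g p) (D.locF q p) locX (0, extChartAt (𝓡 m) q x) := by
  have hy := (extChartAt (𝓡 m) q).map_source hx
  have hl := (extChartAt (𝓡 m) q).left_inv hx
  ext i j
  have h1 := D.firstForm_eq (q := q) (p := p) D.zero_mem
    ((extChartAt (𝓡 m) q).map_target hy) (by rwa [hl])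
    (dcs q (extChartAt (𝓡 m) q x) (bv i)) (dcs q (extChartAt (𝓡 m) q x) (bv j))
  rw [dc_dcs hy, dc_dcs hy, (extChartAt (𝓡 m) q).right_inv hy] at h1
  exact h1

/-- Where the deformation is constant in time, so is the normal. -/
theorem tanCoef_eq_zero {K : Set N} (hK : IsClosed K)
    (hc : ∀ t ∈ Ioo (-D.ε) D.ε, ∀ x ∉ K, D.map t x = D.map 0 x) (hz : z ∈ D.locO q p)
    (hzK : (extChartAt (𝓡 m) q).symm z.2 ∉ K) (k : Fin m) : D.tanCoef q p z k = 0 := by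
  have h := D.hypFamily q p
  have hv : ∀ w ∈ D.locO q p, (extChartAt (𝓡 m) q).symm w.2 ∉ K →
      fderiv ℝ (D.locF q p) w (1, 0) = 0 := by
    intro w hw hwK
    rw [fderiv_prod_left ((D.contDiffAt_locF hw).differentiableAt (by simp))]
    have h1 : (fun t => D.locF q p (t, w.2)) =ᶠ[𝓝 w.1] fun _ => D.locF q p (0, w.2) := by
      filter_upwards [isOpen_Ioo.mem_nhds hw.1] with s hs
      simp only [locF, rep, hc s hs _ hwK]
    rw [h1.deriv_eq, deriv_const]
  refine Finset.sum_eq_zero fun l _ => ?_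
  rw [locZ, h.inner_tang_cov_normal hz]
  have h2 : cov (lc (gB g p)) (D.locF q p) (fun p_1 => tang (D.locF q p) locX p_1 l) (1, 0) z =
      cov (lc (gB g p)) (D.locF q p) (fun w => fderiv ℝ (D.locF q p) w (1, 0)) (locX l) z :=
    h.metric.cov_fderiv_symm (D.contDiffAt_locF hz) (h.maps z hz) _ _
  -- `D_t ∂_l φ = D_l ∂_t φ` vanishes, since the velocity is zero near the point.
  have h3 : (fun w => fderiv ℝ (D.locF q p) w (1, 0)) =ᶠ[𝓝 z] fun _ => 0 := by
    have h4 : ContinuousAt (fun w : ℝ × Euc m => (extChartAt (𝓡 m) q).symm w.2) z :=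
      ContinuousAt.comp (f := Prod.snd) ((continuousOn_extChartAt_symm q).continuousAt
        ((isOpen_extChartAt_target q).mem_nhds hz.2.1)) continuousAt_snd
    filter_upwards [(D.isOpen_locO q p).mem_nhds hz,
      h4.preimage_mem_nhds (hK.isOpen_compl.mem_nhds hzK)] with w hw hwK using hv w hw hwK
  rw [h2, cov_congr EventuallyEq.rfl h3, cov]
  simp

end Deformation

end Schlaefli

end

noncomputable section

namespace Schlaefli

/-! ### The Riemannian measure in charts -/

section RiemannianMeasure

open scoped ENNReal

variable {n : ℕ} {M : Type*} [TopologicalSpace M] [ChartedSpace (Euc n) M]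

/-- The 2-tensor field given by continuous bilinear forms on the tangent spaces. -/
def formTensor (β : M → Euc n →L[ℝ] Euc n →L[ℝ] ℝ) : TensorField n M := fun x X Y => β x X Y

/-- A field of bilinear forms in the preferred chart at `p`. -/
def formB (β : M → Euc n →L[ℝ] Euc n →L[ℝ] ℝ) (p : M) (y : Euc n) : Euc n →L[ℝ] Euc n →L[ℝ] ℝ :=
  (β ((extChartAt (𝓡 n) p).symm y)).bilinearComp (dcs p y) (dcs p y)

/-- The density of the Riemannian measure in the preferred chart at `p`. -/
def density (β : M → Euc n →L[ℝ] Euc n →L[ℝ] ℝ) (p : M) (y : Euc n) : ℝ :=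
  √(compMat (formB β p y)).det

theorem density_nonneg (β : M → Euc n →L[ℝ] Euc n →L[ℝ] ℝ) (p : M) (y : Euc n) :
    0 ≤ density β p y := Real.sqrt_nonneg _

theorem det_jac (A : Euc n →L[ℝ] Euc n) : (jac A).det = A.det := by
  have h : LinearMap.toMatrix (EuclideanSpace.basisFun (Fin n) ℝ).toBasis
      (EuclideanSpace.basisFun (Fin n) ℝ).toBasis (A : Euc n →ₗ[ℝ] Euc n) = jac A := by
    ext i j
    simp [LinearMap.toMatrix_apply, jac]
  rw [← h, LinearMap.det_toMatrix]

/-- The volume density transforms with the absolute value of the determinant. -/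
theorem sqrt_det_conj (β : Euc n →L[ℝ] Euc n →L[ℝ] ℝ) (A : Euc n →L[ℝ] Euc n) :
    √(compMat (β.bilinearComp A A)).det = |A.det| * √(compMat β).det := by
  have h : compMat (β.bilinearComp A A) = (jac A).transpose * compMat β * jac A := conj_jac β A
  rw [h, Matrix.det_mul, Matrix.det_mul, Matrix.det_transpose, det_jac,
    show A.det * (compMat β).det * A.det = A.det ^ 2 * (compMat β).det by ring,
    Real.sqrt_mul (sq_nonneg _), Real.sqrt_sq_eq_abs]

/-- The measure with density `√(det b_{ij})` in the preferred chart at `p`. -/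
def chartMeasure [MeasurableSpace M] (β : M → Euc n →L[ℝ] Euc n →L[ℝ] ℝ) (p : M) : Measure M :=
  Measure.map (extChartAt (𝓡 n) p).symm
    ((volume.restrict (extChartAt (𝓡 n) p).target).withDensity
      fun y => ENNReal.ofReal (density β p y))

theorem riemannianMeasure_formTensor [MeasurableSpace M] (β : M → Euc n →L[ℝ] Euc n →L[ℝ] ℝ) :
    riemannianMeasure (formTensor β) = ⨆ p : M, chartMeasure β p := rfl

theorem formB_trans [IsManifold (𝓡 n) ∞ M] {β : M → Euc n →L[ℝ] Euc n →L[ℝ] ℝ} {p p' : M}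
    {y : Euc n} (hy : y ∈ (extChartAt (𝓡 n) p).target)
    (hy' : (extChartAt (𝓡 n) p).symm y ∈ (extChartAt (𝓡 n) p').source) :
    formB β p y = (formB β p' (trans p p' y)).bilinearComp (fderiv ℝ (trans p p') y)
      (fderiv ℝ (trans p p') y) := by
  ext u v
  simp only [formB, ContinuousLinearMap.bilinearComp_apply]
  rw [fderiv_trans hy hy', fderiv_trans hy hy', trans, dcs_dc hy', dcs_dc hy',
    (extChartAt (𝓡 n) p').left_inv hy']

variable [MeasurableSpace M] [BorelSpace M] {β : M → Euc n →L[ℝ] Euc n →L[ℝ] ℝ} {p p' : M}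

theorem aemeasurable_chart_symm (p : M) (ρ : Euc n → ℝ≥0∞) :
    AEMeasurable (extChartAt (𝓡 n) p).symm
      ((volume.restrict (extChartAt (𝓡 n) p).target).withDensity ρ) :=
  ((continuousOn_extChartAt_symm p).aemeasurable
    (isOpen_extChartAt_target p).measurableSet).mono_ac (withDensity_absolutelyContinuous _ _)

theorem measurableSet_chart_preimage (p : M) {A : Set M} (hA : MeasurableSet A) :
    MeasurableSet ((extChartAt (𝓡 n) p).target ∩ (extChartAt (𝓡 n) p).symm ⁻¹' A) := by
  have ho := isOpen_extChartAt_target (I := 𝓡 n) p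
  have h1 : Measurable (fun y : (extChartAt (𝓡 n) p).target => (extChartAt (𝓡 n) p).symm y) :=
    ((continuousOn_extChartAt_symm p).domRestrict).measurable
  have h2 := (MeasurableEmbedding.subtype_coe ho.measurableSet).measurableSet_image.2 (h1 hA)
  convert h2 using 1
  ext y
  simp [and_comm]

theorem chartMeasure_apply {A : Set M} (hA : MeasurableSet A) : chartMeasure β p A =
    ∫⁻ y in (extChartAt (𝓡 n) p).target ∩ (extChartAt (𝓡 n) p).symm ⁻¹' A,
      ENNReal.ofReal (density β p y) := by
  have ht := (isOpen_extChartAt_target (I := 𝓡 n) p).measurableSet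
  have hm := measurableSet_chart_preimage (n := n) p hA
  have ha := aemeasurable_chart_symm p fun y => ENNReal.ofReal (density β p y)
  rw [chartMeasure, Measure.map_apply_of_aemeasurable ha hA]
  rw [← withDensity_apply _ hm, ← inter_comm]
  rw [← Measure.restrict_apply' (μ := Measure.withDensity volume _) ht,
    restrict_withDensity ht]

theorem chartMeasure_inter_source {A : Set M} (hA : MeasurableSet A) :
    chartMeasure β p (A ∩ (extChartAt (𝓡 n) p).source) = chartMeasure β p A := by
  rw [chartMeasure_apply hA,
    chartMeasure_apply (hA.inter (isOpen_extChartAt_source p).measurableSet)]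
  congr 2
  ext y
  simp only [mem_inter_iff, mem_preimage]
  exact ⟨fun h => ⟨h.1, h.2.1⟩, fun h => ⟨h.1, h.2, (extChartAt (𝓡 n) p).map_target h.1⟩⟩

variable [IsManifold (𝓡 n) ∞ M]

/-- The local measures agree on overlaps of charts. -/
theorem chartMeasure_eq {A : Set M} (hA : MeasurableSet A)
    (h : A ⊆ (extChartAt (𝓡 n) p).source) (h' : A ⊆ (extChartAt (𝓡 n) p').source) :
    chartMeasure β p A = chartMeasure β p' A := by
  rw [chartMeasure_apply hA, chartMeasure_apply hA]
  set s := (extChartAt (𝓡 n) p).target ∩ (extChartAt (𝓡 n) p).symm ⁻¹' A with hs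
  have him : (extChartAt (𝓡 n) p').target ∩ (extChartAt (𝓡 n) p').symm ⁻¹' A =
      trans p p' '' s := by
    ext y
    constructor
    · rintro ⟨h1, h2⟩
      refine ⟨trans p' p y, ⟨(extChartAt (𝓡 n) p).map_source (h h2), ?_⟩, ?_⟩
      · simp only [trans, mem_preimage, (extChartAt (𝓡 n) p).left_inv (h h2)]; exact h2
      · simp only [trans, (extChartAt (𝓡 n) p).left_inv (h h2), (extChartAt (𝓡 n) p').right_inv h1]
    · rintro ⟨w, ⟨h1, h2⟩, rfl⟩
      refine ⟨(extChartAt (𝓡 n) p').map_source (h' h2), ?_⟩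
      simp only [trans, mem_preimage, (extChartAt (𝓡 n) p').left_inv (h' h2)]; exact h2
  have hinj : InjOn (trans p p') s := by
    rintro y ⟨h1, h2⟩ z ⟨h3, h4⟩ he
    have h5 := (extChartAt (𝓡 n) p').injOn (h' h2) (h' h4) he
    exact (extChartAt (𝓡 n) p).symm.injOn h1 h3 h5
  rw [him, lintegral_image_eq_lintegral_abs_det_fderiv_mul volume
    (measurableSet_chart_preimage p hA) (f' := fderiv ℝ (trans p p'))
    (fun y hy => ((contDiffAt_trans hy.1 (h' hy.2)).differentiableAt
      (by simp)).hasFDerivAt.hasFDerivWithinAt) hinj]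
  refine setLIntegral_congr_fun (measurableSet_chart_preimage p hA) fun y hy => ?_
  rw [density, formB_trans hy.1 (h' hy.2), sqrt_det_conj, ENNReal.ofReal_mul (abs_nonneg _)]
  rfl

variable [SecondCountableTopology M]

/-- On the domain of a chart, the Riemannian measure has density `√(det b_{ij})`. -/
theorem riemannianMeasure_apply {A : Set M} (hA : MeasurableSet A)
    (h : A ⊆ (extChartAt (𝓡 n) p).source) :
    riemannianMeasure (formTensor β) A = chartMeasure β p A := by
  obtain ⟨c, hc, hcU⟩ := TopologicalSpace.countable_cover_nhds
    (f := fun x : M => (extChartAt (𝓡 n) x).source) fun x => extChartAt_source_mem_nhds x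
  have hne : c.Nonempty := by
    rw [nonempty_iff_ne_empty]
    rintro rfl
    have h1 : p ∈ ⋃ x ∈ (∅ : Set M), (extChartAt (𝓡 n) x).source := hcU ▸ mem_univ p
    simp at h1
  obtain ⟨s, rfl⟩ := hc.exists_eq_range hne
  -- A sequence of charts that cover `M`, starting with the chart at `p`.
  set s' : ℕ → M := fun i => Nat.casesOn i p s with hs'
  set S : ℕ → Set M := fun i => (extChartAt (𝓡 n) (s' i)).source with hS
  have hSm : ∀ i, MeasurableSet (S i) := fun i => (isOpen_extChartAt_source _).measurableSet
  have hU : ⋃ i, disjointed S i = univ := by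
    rw [iUnion_disjointed, eq_univ_iff_forall]
    intro x
    have hx : x ∈ ⋃ x ∈ range s, (extChartAt (𝓡 n) x).source := hcU ▸ mem_univ x
    simp only [mem_iUnion, mem_range, exists_prop, exists_exists_eq_and] at hx
    obtain ⟨i, hi⟩ := hx
    exact mem_iUnion.2 ⟨i + 1, hi⟩
  have hD := MeasurableSet.disjointed hSm
  -- `ν` is glued from the local measures on disjoint pieces. It dominates all of them, hence also
  -- the Riemannian measure, and it agrees with the local measure at `p` on the first piece.
  set ν : Measure M := Measure.sum fun i => (chartMeasure β (s' i)).restrict (disjointed S i)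
    with hν
  refine le_antisymm ?_ ((le_iSup (fun p => chartMeasure β p) p) A)
  have h1 : riemannianMeasure (formTensor β) ≤ ν := by
    rw [riemannianMeasure_formTensor]
    refine iSup_le fun r => Measure.le_iff.2 fun B hB => ?_
    rw [hν, Measure.sum_apply _ hB]
    have hB2 : B ∩ (extChartAt (𝓡 n) r).source =
        ⋃ i, (B ∩ (extChartAt (𝓡 n) r).source) ∩ disjointed S i := by
      rw [← inter_iUnion, hU, inter_univ]
    have hBm := hB.inter (isOpen_extChartAt_source (I := 𝓡 n) r).measurableSet
    rw [← chartMeasure_inter_source hB, hB2, measure_iUnion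
      (fun i j hij => ((disjoint_disjointed S) hij).mono inter_subset_right inter_subset_right)
      (fun i => hBm.inter (hD i))]
    refine ENNReal.tsum_le_tsum fun i => ?_
    rw [Measure.restrict_apply hB, chartMeasure_eq (p' := s' i) (hBm.inter (hD i))
      (fun x hx => hx.1.2) (fun x hx => disjointed_subset S i hx.2)]
    exact measure_mono fun x hx => ⟨hx.1.1, hx.2⟩
  refine (h1 A).trans ?_
  rw [hν, Measure.sum_apply _ hA, tsum_eq_single 0]
  · rw [Measure.restrict_apply hA]
    exact measure_mono inter_subset_left
  · intro i hi
    rw [Measure.restrict_apply hA]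
    have h2 : A ∩ disjointed S i = ∅ := by
      have h3 := (disjoint_disjointed S) hi
      have h4 : disjointed S 0 = S 0 := disjointed_zero S
      refine (h3.mono_right ?_).symm.inter_eq
      rw [h4]; exact h
    rw [h2, measure_empty]

/-- Integration in a chart. -/
theorem integral_riemannianMeasure {f : M → ℝ}
    (hρ : ContinuousOn (density β p) (extChartAt (𝓡 n) p).target)
    (hf : AEStronglyMeasurable f (riemannianMeasure (formTensor β)))
    (hs : ∀ x ∉ (extChartAt (𝓡 n) p).source, f x = 0) :
    ∫ x, f x ∂riemannianMeasure (formTensor β) =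
      ∫ y in (extChartAt (𝓡 n) p).target,
        density β p y * f ((extChartAt (𝓡 n) p).symm y) := by
  have hres : (riemannianMeasure (formTensor β)).restrict (extChartAt (𝓡 n) p).source =
      chartMeasure β p := by
    ext A hA
    have hm := (isOpen_extChartAt_source (I := 𝓡 n) p).measurableSet
    rw [Measure.restrict_apply hA, riemannianMeasure_apply (hA.inter hm) inter_subset_right,
      chartMeasure_inter_source hA]
  rw [← setIntegral_eq_integral_of_forall_compl_eq_zero hs, hres, chartMeasure, integral_map
    (aemeasurable_chart_symm p _), integral_withDensity_eq_integral_toReal_smul₀]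
  · refine integral_congr_ae (Eventually.of_forall fun y => ?_)
    simp only [ENNReal.toReal_ofReal (density_nonneg β p y), smul_eq_mul]
  · exact (hρ.aemeasurable (isOpen_extChartAt_target p).measurableSet).ennreal_ofReal
  · exact Eventually.of_forall fun y => ENNReal.ofReal_lt_top
  · have := hf.restrict (s := (extChartAt (𝓡 n) p).source)
    rwa [hres, chartMeasure] at this

/-- A continuous density is bounded on a closed ball in the image of a chart, so that the preimage
of the ball has finite measure. -/
theorem isLocallyFiniteMeasure_riemannianMeasure
    (hρ : ∀ p : M, ContinuousOn (density β p) (extChartAt (𝓡 n) p).target) :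
    IsLocallyFiniteMeasure (riemannianMeasure (formTensor β)) := by
  refine ⟨fun x => ?_⟩
  have hy := mem_extChartAt_target (I := 𝓡 n) x
  have ho := isOpen_extChartAt_target (I := 𝓡 n) x
  obtain ⟨r, hr, hrs⟩ := Metric.nhds_basis_closedBall.mem_iff.1 (ho.mem_nhds hy)
  set V : Set M := (extChartAt (𝓡 n) x).source ∩
    extChartAt (𝓡 n) x ⁻¹' Metric.ball (extChartAt (𝓡 n) x x) r with hV
  have hVo : IsOpen V := (continuousOn_extChartAt x).isOpen_inter_preimage
    (isOpen_extChartAt_source x) Metric.isOpen_ball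
  refine ⟨V, hVo.mem_nhds ⟨mem_extChartAt_source x, Metric.mem_ball_self hr⟩, ?_⟩
  rw [riemannianMeasure_apply hVo.measurableSet inter_subset_left,
    chartMeasure_apply hVo.measurableSet]
  have hsub : (extChartAt (𝓡 n) x).target ∩ (extChartAt (𝓡 n) x).symm ⁻¹' V ⊆
      Metric.closedBall (extChartAt (𝓡 n) x x) r := by
    rintro y ⟨h1, h2⟩
    have h3 := h2.2
    simp only [mem_preimage, (extChartAt (𝓡 n) x).right_inv h1] at h3
    exact Metric.ball_subset_closedBall h3
  refine (lintegral_mono_set hsub).trans_lt ?_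
  exact (((hρ x).mono hrs).integrableOn_compact (isCompact_closedBall _ _)).lintegral_lt_top

end RiemannianMeasure

end Schlaefli

end

noncomputable section

namespace Schlaefli

/-! ### The divergence theorem -/

/-- Integration by parts against the constant function `1`. -/
theorem integral_fderiv_eq_zero {n : ℕ} {h : Euc n → ℝ} (hd : ContDiff ℝ 1 h)
    (hc : HasCompactSupport h) (v : Euc n) :
    Integrable (fun y => fderiv ℝ h y v) ∧ ∫ y, fderiv ℝ h y v = 0 := by
  have h1 : Integrable (fun y => fderiv ℝ h y v) :=
    ((hd.continuous_fderiv (by simp)).clm_apply continuous_const).integrable_of_hasCompactSupport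
      (hc.fderiv_apply ℝ v)
  refine ⟨h1, ?_⟩
  have h2 := integral_mul_fderiv_eq_neg_fderiv_mul_of_integrable (μ := volume)
    (f := fun _ : Euc n => (1 : ℝ)) (g := h) (v := v) (by simp) (by simpa using h1)
    (by simpa using hd.continuous.integrable_of_hasCompactSupport hc)
    (fun x _ => differentiableAt_const _) (fun x _ => (hd.differentiable (by simp)) x)
  simpa using h2

section Divergence

variable {m : ℕ} {N : Type*} [TopologicalSpace N] [ChartedSpace (Euc m) N]
  [IsManifold (𝓡 m) ∞ N]

/-- Derivative of the function `f` in the direction of the tangent vector `v` at `x`. -/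
def dfun (f : N → ℝ) (x : N) (v : Euc m) : ℝ :=
  (mfderiv (𝓡 m) 𝓘(ℝ, ℝ) f x : Euc m →L[ℝ] ℝ) v

theorem fderiv_chart_eq_dfun {f : N → ℝ} {q x : N} (hx : x ∈ (extChartAt (𝓡 m) q).source)
    (hf : MDifferentiableAt (𝓡 m) 𝓘(ℝ, ℝ) f x) (v : Euc m) :
    fderiv ℝ (fun y => f ((extChartAt (𝓡 m) q).symm y)) (extChartAt (𝓡 m) q x) (dc q x v) =
      dfun f x v := by
  have hy := (extChartAt (𝓡 m) q).map_source hx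
  have hl := (extChartAt (𝓡 m) q).left_inv hx
  have h2 : MDifferentiableAt (𝓡 m) 𝓘(ℝ, ℝ) f
      ((extChartAt (𝓡 m) q).symm (extChartAt (𝓡 m) q x)) := by rw [hl]; exact hf
  have h4 := mfderiv_comp _ h2 (mdifferentiableAt_chart_symm hy)
  rw [mfderiv_eq_fderiv] at h4
  have h6 := congrArg (fun L : Euc m →L[ℝ] ℝ => L (dc q x v)) h4
  refine h6.trans ?_
  change dfun f ((extChartAt (𝓡 m) q).symm (extChartAt (𝓡 m) q x))
    (dcs q (extChartAt (𝓡 m) q x) (dc q x v)) = _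
  rw [hl, dcs_dc hx]

/-- The data of a vector field `ζ` with divergence `δ` for the measure with local densities
`density β q`, both vanishing outside of `K`. -/
structure IsDivergence (β : N → Euc m →L[ℝ] Euc m →L[ℝ] ℝ) (ζ : N → Euc m) (δ : N → ℝ)
    (K : Set N) : Prop where
  field_eq_zero : ∀ x ∉ K, ζ x = 0
  eq_zero : ∀ x ∉ K, δ x = 0
  density_pos : ∀ q : N, ∀ y ∈ (extChartAt (𝓡 m) q).target, 0 < density β q y
  density_continuousOn : ∀ q : N, ContinuousOn (density β q) (extChartAt (𝓡 m) q).target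
  eventually : ∀ q : N, ∀ᶠ x in 𝓝 q,
    (∀ k, ContDiffAt ℝ 1 (fun y => density β q y * dc q ((extChartAt (𝓡 m) q).symm y)
      (ζ ((extChartAt (𝓡 m) q).symm y)) k) (extChartAt (𝓡 m) q x)) ∧
    density β q (extChartAt (𝓡 m) q x) * δ x =
      ∑ k, fderiv ℝ (fun y => density β q y * dc q ((extChartAt (𝓡 m) q).symm y)
        (ζ ((extChartAt (𝓡 m) q).symm y)) k) (extChartAt (𝓡 m) q x) (bv k)

variable [SecondCountableTopology N] [MeasurableSpace N] [BorelSpace N]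
  {β : N → Euc m →L[ℝ] Euc m →L[ℝ] ℝ} {ζ : N → Euc m} {δ : N → ℝ} {K : Set N}

/-- The divergence theorem for the product of the vector field with a function supported in a
chart. -/
theorem IsDivergence.integral_mul (h : IsDivergence β ζ δ K) (hK : IsCompact K) (q : N) {V : Set N}
    (hV : IsOpen V) (hVq : V ⊆ (extChartAt (𝓡 m) q).source)
    (hV1 : ∀ x ∈ V, (∀ k, ContDiffAt ℝ 1 (fun y => density β q y *
        dc q ((extChartAt (𝓡 m) q).symm y) (ζ ((extChartAt (𝓡 m) q).symm y)) k)
        (extChartAt (𝓡 m) q x)) ∧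
      density β q (extChartAt (𝓡 m) q x) * δ x =
        ∑ k, fderiv ℝ (fun y => density β q y * dc q ((extChartAt (𝓡 m) q).symm y)
          (ζ ((extChartAt (𝓡 m) q).symm y)) k) (extChartAt (𝓡 m) q x) (bv k))
    {f : N → ℝ} (hf : ContMDiff (𝓡 m) 𝓘(ℝ, ℝ) ∞ f) (hfV : tsupport f ⊆ V) :
    Continuous (fun x => f x * δ x + dfun f x (ζ x)) ∧
    ∫ x, (f x * δ x + dfun f x (ζ x)) ∂riemannianMeasure (formTensor β) = 0 := by
  set κ := extChartAt (𝓡 m) q with hκ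
  set w : N → ℝ := fun x => f x * δ x + dfun f x (ζ x) with hw
  set a : Fin m → Euc m → ℝ := fun k y => density β q y * dc q (κ.symm y) (ζ (κ.symm y)) k with ha
  -- The components of `f ζ`, multiplied by the density and extended by zero outside of the chart.
  -- Their support lies in the compact set `C`.
  set u : Fin m → Euc m → ℝ := fun k => κ.target.indicator fun y => f (κ.symm y) * a k y with hu
  have hto : IsOpen κ.target := isOpen_extChartAt_target q
  set C : Set (Euc m) := κ '' (tsupport f ∩ K) with hC
  have hCc : IsCompact C := by
    refine (hK.inter_left (isClosed_tsupport f)).image_of_continuousOn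
      ((continuousOn_extChartAt q).mono fun x hx => hVq (hfV hx.1))
  have hu0 : ∀ k, ∀ y ∉ C, u k y = 0 := by
    intro k y hy
    by_cases hyt : y ∈ κ.target
    · rw [hu]; simp only [indicator_of_mem hyt, mul_eq_zero]
      by_cases h1 : κ.symm y ∈ tsupport f
      · have h2 : κ.symm y ∉ K := fun h2 => hy ⟨κ.symm y, ⟨h1, h2⟩, κ.right_inv hyt⟩
        right
        simp only [ha, h.field_eq_zero _ h2, map_zero, PiLp.zero_apply, mul_zero]
      · left; exact image_eq_zero_of_notMem_tsupport h1
    · exact indicator_of_notMem hyt _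
  have hfκ : ∀ y ∈ κ.target, ContDiffAt ℝ 1 (fun y => f (κ.symm y)) y := fun y hy => by
    have h2 : ContMDiffAt 𝓘(ℝ, Euc m) (𝓡 m) ∞ κ.symm y :=
      (contMDiffOn_extChartAt_symm q).contMDiffAt (hto.mem_nhds hy)
    exact ((hf.contMDiffAt.comp y h2).contDiffAt).of_le (by simp)
  have hue : ∀ k, ∀ y ∈ κ.target, u k =ᶠ[𝓝 y] fun y => f (κ.symm y) * a k y := by
    intro k y hy
    filter_upwards [hto.mem_nhds hy] with z hz
    exact indicator_of_mem hz _
  have hud : ∀ k, ContDiff ℝ 1 (u k) := by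
    intro k
    rw [contDiff_iff_contDiffAt]
    intro y
    by_cases hy : y ∈ C
    · obtain ⟨x, ⟨hx1, hx2⟩, rfl⟩ := hy
      have hxt := κ.map_source (hVq (hfV hx1))
      exact ((hfκ _ hxt).mul ((hV1 x (hfV hx1)).1 k)).congr_of_eventuallyEq (hue k _ hxt)
    · refine (contDiffAt_const (c := (0 : ℝ))).congr_of_eventuallyEq ?_
      filter_upwards [hCc.isClosed.isOpen_compl.mem_nhds hy] with z hz using hu0 k z hz
  have hus : ∀ k, HasCompactSupport (u k) := fun k => HasCompactSupport.intro hCc (hu0 k)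
  have hfd : ∀ x, MDifferentiableAt (𝓡 m) 𝓘(ℝ, ℝ) f x := fun x =>
    hf.contMDiffAt.mdifferentiableAt (by simp)
  -- The product rule for the divergence, in the chart.
  have hkey : ∀ x ∈ V, density β q (κ x) * w x = ∑ k, fderiv ℝ (u k) (κ x) (bv k) := by
    intro x hx
    have hxt := κ.map_source (hVq hx)
    have hl := κ.left_inv (hVq hx)
    have h1 : ∀ k, fderiv ℝ (u k) (κ x) (bv k) = f x * fderiv ℝ (a k) (κ x) (bv k) +
        a k (κ x) * fderiv ℝ (fun y => f (κ.symm y)) (κ x) (bv k) := by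
      intro k
      rw [(hue k _ hxt).fderiv_eq, fderiv_fun_mul ((hfκ _ hxt).differentiableAt (by simp))
        (((hV1 x hx).1 k).differentiableAt (by simp)), add_apply, smul_apply, smul_apply,
        smul_eq_mul, smul_eq_mul, hl]
      simp only [ha, hl]
    have h2 : ∑ k, a k (κ x) * fderiv ℝ (fun y => f (κ.symm y)) (κ x) (bv k) =
        density β q (κ x) * dfun f x (ζ x) := by
      rw [← fderiv_chart_eq_dfun (hVq hx) (hfd x), clm_eq_sum (F := ℝ), Finset.mul_sum]
      refine Finset.sum_congr rfl fun k _ => ?_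
      simp only [ha, hl, smul_eq_mul]
      ring
    simp only [h1, Finset.sum_add_distrib, h2, ← Finset.mul_sum]
    rw [← (hV1 x hx).2, hw]
    ring
  have hw0 : ∀ x ∉ tsupport f, w =ᶠ[𝓝 x] fun _ => 0 := by
    intro x hx
    filter_upwards [(isClosed_tsupport f).isOpen_compl.mem_nhds hx] with z hz
    have h1 : f =ᶠ[𝓝 z] fun _ => (0 : ℝ) := notMem_tsupport_iff_eventuallyEq.1 hz
    have h2 : dfun f z (ζ z) = 0 := by
      have h3 : mfderiv (𝓡 m) 𝓘(ℝ, ℝ) f z = 0 := by rw [h1.mfderiv_eq]; exact mfderiv_const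
      exact congrArg (fun L : Euc m →L[ℝ] ℝ => L (ζ z)) h3
    simp only [hw, h2, h1.self_of_nhds, zero_mul, add_zero]
  have hcont : Continuous w := by
    rw [continuous_iff_continuousAt]
    intro x
    by_cases hx : x ∈ tsupport f
    · have hxV := hfV hx
      have h1 : w =ᶠ[𝓝 x] fun x => (density β q (κ x))⁻¹ * ∑ k, fderiv ℝ (u k) (κ x) (bv k) := by
        filter_upwards [hV.mem_nhds hxV] with z hz
        rw [← hkey z hz, inv_mul_cancel_left₀ (h.density_pos q _ (κ.map_source (hVq hz))).ne']
      have hκx : ContinuousAt κ x := continuousAt_extChartAt' (hVq hxV)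
      have hxt := κ.map_source (hVq hxV)
      refine ContinuousAt.congr ?_ h1.symm
      refine ContinuousAt.mul (ContinuousAt.inv₀ ?_ (h.density_pos q _ hxt).ne') ?_
      · exact ContinuousAt.comp (f := κ) ((h.density_continuousOn q).continuousAt
          (hto.mem_nhds hxt)) hκx
      · refine tendsto_finsetSum _ fun k _ => ?_
        exact (((hud k).continuous_fderiv (by simp)).clm_apply
          continuous_const).continuousAt.comp (f := κ) hκx
    · exact continuousAt_const.congr (hw0 x hx).symm
  refine ⟨hcont, ?_⟩
  rw [integral_riemannianMeasure (p := q) (h.density_continuousOn q)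
    hcont.aestronglyMeasurable fun x hx => (hw0 x fun hx' => hx (hVq (hfV hx'))).self_of_nhds]
  have h3 : ∀ y ∈ κ.target, density β q y * w (κ.symm y) = ∑ k, fderiv ℝ (u k) y (bv k) := by
    intro y hy
    by_cases hyV : κ.symm y ∈ V
    · have := hkey _ hyV
      rwa [κ.right_inv hy] at this
    · have h4 : κ.symm y ∉ tsupport f := fun h4 => hyV (hfV h4)
      have h5 : y ∉ C := by
        rintro ⟨x, hx, rfl⟩
        exact h4 (by rw [κ.left_inv (hVq (hfV hx.1))]; exact hx.1)
      rw [(hw0 _ h4).self_of_nhds, mul_zero]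
      symm
      refine Finset.sum_eq_zero fun k _ => ?_
      have h6 : u k =ᶠ[𝓝 y] fun _ => 0 := by
        filter_upwards [hCc.isClosed.isOpen_compl.mem_nhds h5] with z hz using hu0 k z hz
      rw [h6.fderiv_eq]; simp
  rw [setIntegral_congr_fun hto.measurableSet h3,
    setIntegral_eq_integral_of_forall_compl_eq_zero, integral_finsetSum]
  · exact Finset.sum_eq_zero fun k _ => (integral_fderiv_eq_zero (hud k) (hus k) _).2
  · exact fun k _ => (integral_fderiv_eq_zero (hud k) (hus k) _).1
  · intro y hy
    have h5 : y ∉ C := by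
      rintro ⟨x, hx, rfl⟩
      exact hy (κ.map_source (hVq (hfV hx.1)))
    refine Finset.sum_eq_zero fun k _ => ?_
    have h6 : u k =ᶠ[𝓝 y] fun _ => 0 := by
      filter_upwards [hCc.isClosed.isOpen_compl.mem_nhds h5] with z hz using hu0 k z hz
    rw [h6.fderiv_eq]; simp

/-- The divergence theorem for compactly supported vector fields. -/
theorem IsDivergence.integral_eq_zero [T2Space N] (h : IsDivergence β ζ δ K) (hK : IsCompact K) :
    Continuous δ ∧ Integrable δ (riemannianMeasure (formTensor β)) ∧
      ∫ x, δ x ∂riemannianMeasure (formTensor β) = 0 := by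
  have : LocallyCompactSpace N := ChartedSpace.locallyCompactSpace (Euc m) N
  have : IsLocallyFiniteMeasure (riemannianMeasure (formTensor β)) :=
    isLocallyFiniteMeasure_riemannianMeasure h.density_continuousOn
  choose! V hV1 hVo hVq using fun q => mem_nhds_iff.1
    (inter_mem (extChartAt_source_mem_nhds (I := 𝓡 m) q) (h.eventually q))
  -- The vector field is decomposed with a partition of unity subordinate to charts. The additional
  -- terms `dfun (f i) x (ζ x)` add up to the derivative of a constant. The sum over `T` is only
  -- used in a neighbourhood `K'` of `K`, where it is equal to `1`.
  obtain ⟨f, hf⟩ := SmoothPartitionOfUnity.exists_isSubordinate (𝓡 m) (isClosed_univ (X := N)) V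
    hVo (fun x _ => mem_iUnion.2 ⟨x, hVq x⟩)
  obtain ⟨K', hK', hKK'⟩ := exists_compact_superset hK
  have hfin := f.locallyFinite.finite_nonempty_inter_compact hK'
  set T := hfin.toFinset with hT
  have hsum : ∀ x ∈ K', ∑ i ∈ T, f i x = 1 := by
    intro x hx
    rw [← f.sum_eq_one (mem_univ x), finsum_eq_sum_of_support_subset]
    intro i hi
    rw [hT, Finite.coe_toFinset]
    exact ⟨x, hi, hx⟩
  have hi := fun i => h.integral_mul hK i (hVo i) (fun x hx => (hV1 i hx).1)
    (fun x hx => (hV1 i hx).2) (f i).contMDiff (hf i)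
  have hint : ∀ i, Integrable (fun x => f i x * δ x + dfun (f i) x (ζ x))
      (riemannianMeasure (formTensor β)) := fun i => by
    refine (hi i).1.integrable_of_hasCompactSupport (HasCompactSupport.intro hK fun x hx => ?_)
    rw [h.eq_zero x hx, h.field_eq_zero x hx, mul_zero, zero_add]
    exact map_zero (mfderiv (𝓡 m) 𝓘(ℝ, ℝ) (f i) x : Euc m →L[ℝ] ℝ)
  have hδ : δ = fun x => ∑ i ∈ T, (f i x * δ x + dfun (f i) x (ζ x)) := by
    funext x
    by_cases hx : x ∈ K
    · have hxK' := interior_subset (hKK' hx)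
      have hd : ∑ i ∈ T, dfun (f i) x (ζ x) = 0 := by
        have hxs := mem_extChartAt_source (I := 𝓡 m) x
        have hfd : ∀ i, MDifferentiableAt (𝓡 m) 𝓘(ℝ, ℝ) (f i) x := fun i =>
          (f i).contMDiff.contMDiffAt.mdifferentiableAt (by simp)
        have hfd' : ∀ i ∈ T, DifferentiableAt ℝ (fun y => f i ((extChartAt (𝓡 m) x).symm y))
            (extChartAt (𝓡 m) x x) := fun i _ => by
          have h2 : ContMDiffAt 𝓘(ℝ, Euc m) (𝓡 m) ∞ (extChartAt (𝓡 m) x).symm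
              (extChartAt (𝓡 m) x x) :=
            (contMDiffOn_extChartAt_symm x).contMDiffAt ((isOpen_extChartAt_target x).mem_nhds
              (mem_extChartAt_target x))
          exact (((f i).contMDiff.contMDiffAt.comp _ h2).contDiffAt).differentiableAt (by simp)
        have h1 : ∀ i ∈ T, dfun (f i) x (ζ x) = fderiv ℝ
            (fun y => f i ((extChartAt (𝓡 m) x).symm y)) (extChartAt (𝓡 m) x x)
              (dc x x (ζ x)) := fun i _ => (fderiv_chart_eq_dfun hxs (hfd i) _).symm
        rw [Finset.sum_congr rfl h1, ← sum_apply, ← fderiv_fun_sum hfd']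
        have h2 : (fun y => ∑ i ∈ T, f i ((extChartAt (𝓡 m) x).symm y))
            =ᶠ[𝓝 (extChartAt (𝓡 m) x x)] fun _ => 1 := by
          filter_upwards [eventually_rep (q := x) hxs continuousAt_id
            (isOpen_interior.mem_nhds (hKK' hx))] with y hy
          exact hsum _ (interior_subset hy)
        rw [h2.fderiv_eq]; simp
      rw [Finset.sum_add_distrib, hd, add_zero, ← Finset.sum_mul, hsum x hxK', one_mul]
    · rw [h.eq_zero x hx, h.field_eq_zero x hx]
      symm
      refine Finset.sum_eq_zero fun i _ => ?_
      rw [mul_zero, zero_add]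
      exact map_zero (mfderiv (𝓡 m) 𝓘(ℝ, ℝ) (f i) x : Euc m →L[ℝ] ℝ)
  have hc : Continuous δ := by
    rw [hδ]; exact continuous_finsetSum _ fun i _ => (hi i).1
  refine ⟨hc, hc.integrable_of_hasCompactSupport (HasCompactSupport.intro hK h.eq_zero), ?_⟩
  rw [hδ, integral_finsetSum _ fun i _ => hint i]
  exact Finset.sum_eq_zero fun i _ => (hi i).2

end Divergence

end Schlaefli

end

noncomputable section

namespace Schlaefli

namespace Deformation

/-! ### The integral of the variation formula -/

variable {m : ℕ} {M : Type*} [TopologicalSpace M] [ChartedSpace (Euc (m + 1)) M]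
  [IsManifold (𝓡 (m + 1)) ∞ M] {N : Type*} [TopologicalSpace N] [ChartedSpace (Euc m) N]
  {g : Metric (m + 1) M} (D : Deformation g N) {q : N} {p : M} {x : N} {t : ℝ}

/-- The induced metric of `φ_0`, as bilinear forms. -/
def areaForm (x : N) : Euc m →L[ℝ] Euc m →L[ℝ] ℝ :=
  (gAt g (D.map 0 x)).bilinearComp (mder (D.map 0) x) (mder (D.map 0) x)

theorem area_eq [MeasurableSpace N] : D.area = riemannianMeasure (formTensor D.areaForm) := rfl

/-- The normal component of the velocity at time `t`. -/
def normalSpeed (t : ℝ) (x : N) : ℝ := gAt g (D.map t x) (D.vel t x) (D.nor t x)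

theorem frame_at (ht : t ∈ Ioo (-D.ε) D.ε) (x : N) :
    AdaptedFrame (gAt g (D.map t x)) (fun i => mder (D.map t) x (bv i)) (D.nor t x) where
  symm := gAt_symm g _
  pos := gAt_pos g _
  indep := by
    have h3 : (fun i : Fin m => (bv i : Euc m)) =
        (EuclideanSpace.basisFun (Fin m) ℝ).toBasis := by funext i; simp
    have hb : LinearIndependent ℝ (fun i : Fin m => (bv i : Euc m)) := by
      rw [h3]
      exact (EuclideanSpace.basisFun (Fin m) ℝ).toBasis.linearIndependent
    exact hb.map' (mder (D.map t) x : Euc m →L[ℝ] Euc (m + 1)).toLinearMap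
      (LinearMap.ker_eq_bot.2 (D.immersion t ht x))
  unit := D.normal_unit t ht x
  orth i := D.normal_orthogonal t ht x _

theorem det_gram_pos (ht : t ∈ Ioo (-D.ε) D.ε) (x : N) : 0 < (gram (D.firstForm t) x).det :=
  (D.frame_at ht x).gram_posDef.det_pos

theorem signedJacobian_eq (ht : t ∈ Ioo (-D.ε) D.ε) (x : N) : D.signedJacobian t x =
    D.normalSpeed t x * √(gram (D.firstForm t) x).det / √(gram (D.firstForm 0) x).det := by
  have h1 := (D.frame_at ht x).det_cons (D.vel t x)
  have h2 : D.signedJacobian t x = (SignType.sign (D.normalSpeed t x) : ℝ) *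
      √(gramOf (gAt g (D.map t x)) (Fin.cons (D.vel t x) fun i =>
        mder (D.map t) x (bv i) : Fin (m + 1) → Euc (m + 1))).det /
        √(gram (D.firstForm 0) x).det := rfl
  have h3 : gramOf (gAt g (D.map t x)) (fun i => mder (D.map t) x (bv i)) =
    gram (D.firstForm t) x := rfl
  rw [h2, h1, h3, Real.sqrt_mul (sq_nonneg _), Real.sqrt_sq_eq_abs, ← mul_assoc]
  change (SignType.sign (D.normalSpeed t x) : ℝ) * |D.normalSpeed t x| * _ / _ = _
  rw [sign_mul_abs]

theorem signedJacobian_zero (x : N) : D.signedJacobian 0 x = D.normalSpeed 0 x := by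
  rw [D.signedJacobian_eq D.zero_mem, mul_div_cancel_right₀]
  exact (Real.sqrt_pos.2 (D.det_gram_pos D.zero_mem x)).ne'

theorem vel_eq_zero {K : Set N} (hc : ∀ t ∈ Ioo (-D.ε) D.ε, ∀ x ∉ K, D.map t x = D.map 0 x)
    (ht : t ∈ Ioo (-D.ε) D.ε) (hx : x ∉ K) : D.vel t x = 0 := by
  have h1 : (fun s => D.map s x) =ᶠ[𝓝 t] fun _ => D.map 0 x := by
    filter_upwards [isOpen_Ioo.mem_nhds ht] with s hs using hc s hs x hx
  have h2 : mfderiv 𝓘(ℝ, ℝ) (𝓡 (m + 1)) (fun s => D.map s x) t = 0 := by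
    rw [h1.mfderiv_eq]; exact mfderiv_const
  exact congrArg (fun L : ℝ →L[ℝ] Euc (m + 1) => L 1) h2

theorem normalSpeed_eq_zero {K : Set N}
    (hc : ∀ t ∈ Ioo (-D.ε) D.ε, ∀ x ∉ K, D.map t x = D.map 0 x)
    (ht : t ∈ Ioo (-D.ε) D.ε) (hx : x ∉ K) : D.normalSpeed t x = 0 := by
  rw [normalSpeed, D.vel_eq_zero hc ht hx, map_zero, zero_apply]

theorem eventually_source_prod (ht : t ∈ Ioo (-D.ε) D.ε) (x : N) :
    ∀ᶠ w : ℝ × N in 𝓝 (t, x), w.1 ∈ Ioo (-D.ε) D.ε ∧ w.2 ∈ (extChartAt (𝓡 m) x).source ∧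
      D.map w.1 w.2 ∈ (extChartAt (𝓡 (m + 1)) (D.map t x)).source := by
  filter_upwards [(isOpen_Ioo.preimage continuous_fst).mem_nhds ht,
    ((isOpen_extChartAt_source x).preimage continuous_snd).mem_nhds
      (mem_extChartAt_source (I := 𝓡 m) x),
    (D.continuousAt_map ht x).preimage_mem_nhds ((isOpen_extChartAt_source _).mem_nhds
      (mem_extChartAt_source (I := 𝓡 (m + 1)) (D.map t x)))] with w h1 h2 h3 using ⟨h1, h2, h3⟩

theorem continuousAt_prod_chart (t : ℝ) (x : N) :
    ContinuousAt (fun w : ℝ × N => (w.1, extChartAt (𝓡 m) x w.2)) (t, x) :=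
  continuousAt_fst.prodMk (ContinuousAt.comp (f := Prod.snd) (continuousAt_extChartAt x)
    continuousAt_snd)

variable [IsManifold (𝓡 m) ∞ N]

theorem density_areaForm (hx : x ∈ (extChartAt (𝓡 m) q).source)
    (hp : D.map 0 x ∈ (extChartAt (𝓡 (m + 1)) p).source) :
    density D.areaForm q (extChartAt (𝓡 m) q x) = D.locArea q p (extChartAt (𝓡 m) q x) := by
  rw [locArea, ← D.gram_firstForm_zero_det hx hp]
  rfl

/-- The normal speed in charts. -/
theorem normalSpeed_chart (ht : t ∈ Ioo (-D.ε) D.ε) (hx : x ∈ (extChartAt (𝓡 m) q).source)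
    (hp : D.map t x ∈ (extChartAt (𝓡 (m + 1)) p).source) :
    D.normalSpeed t x = gB g p (D.locF q p (t, extChartAt (𝓡 m) q x))
      (fderiv ℝ (D.locF q p) (t, extChartAt (𝓡 m) q x) (1, 0))
      (D.locY q p (t, extChartAt (𝓡 m) q x)) := by
  have hz := D.mem_locO ht hx hp
  have h1 := D.gB_locF hz (D.vel t x) (D.nor t x)
  rw [D.fderiv_locF_left hz, D.locY_apply hx]
  simp only [(extChartAt (𝓡 m) q).left_inv hx] at h1 ⊢
  exact h1.symm

theorem continuousAt_normalSpeed (ht : t ∈ Ioo (-D.ε) D.ε) (x : N) :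
    ContinuousAt (fun w : ℝ × N => D.normalSpeed w.1 w.2) (t, x) := by
  have hz := D.mem_locO ht (mem_extChartAt_source (I := 𝓡 m) x)
    (mem_extChartAt_source (I := 𝓡 (m + 1)) (D.map t x))
  have h := D.hypFamily x (D.map t x)
  have h1 := (h.contDiffAt_inner hz (contDiffAt_fderiv_apply (D.contDiffAt_locF hz) (1, 0))
    (D.contDiffAt_locY hz)).continuousAt
  refine (ContinuousAt.comp (f := fun w : ℝ × N => (w.1, extChartAt (𝓡 m) x w.2)) (x := (t, x))
    h1 (continuousAt_prod_chart t x)).congr ?_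
  filter_upwards [D.eventually_source_prod ht x] with w hw
  exact (D.normalSpeed_chart hw.1 hw.2.1 hw.2.2).symm

theorem continuousAt_areaRatio (ht : t ∈ Ioo (-D.ε) D.ε) (x : N) :
    ContinuousAt (fun w : ℝ × N =>
      √(gram (D.firstForm w.1) w.2).det / √(gram (D.firstForm 0) w.2).det) (t, x) := by
  have hxs := mem_extChartAt_source (I := 𝓡 m) x
  have hz := D.mem_locO ht hxs (mem_extChartAt_source (I := 𝓡 (m + 1)) (D.map t x))
  have hz0 := D.mem_locO D.zero_mem hxs (mem_extChartAt_source (I := 𝓡 (m + 1)) (D.map 0 x))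
  have h := D.hypFamily x (D.map t x)
  have h1 := ContinuousAt.comp (f := fun w : ℝ × N => (w.1, extChartAt (𝓡 m) x w.2)) (x := (t, x))
    (h.contDiffAt_area hz).continuousAt (continuousAt_prod_chart t x)
  have h2 := ContinuousAt.comp (f := fun w : ℝ × N => extChartAt (𝓡 m) x w.2) (x := (t, x))
    (D.contDiffAt_locArea hz0).continuousAt
    (ContinuousAt.comp (f := Prod.snd) (continuousAt_extChartAt x) continuousAt_snd)
  refine (ContinuousAt.div h1 h2 (Real.sqrt_pos.2
    ((D.hypFamily x (D.map 0 x)).det_pos hz0)).ne').congr ?_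
  have h3 := (D.eventually_source_prod D.zero_mem x)
  have h4 : ∀ᶠ w : ℝ × N in 𝓝 (t, x),
      D.map 0 w.2 ∈ (extChartAt (𝓡 (m + 1)) (D.map 0 x)).source :=
    (ContinuousAt.comp (f := Prod.snd) (D.mdifferentiableAt_map D.zero_mem x).continuousAt
      continuousAt_snd).preimage_mem_nhds ((isOpen_extChartAt_source _).mem_nhds
        (mem_extChartAt_source (I := 𝓡 (m + 1)) (D.map 0 x)))
  filter_upwards [D.eventually_source_prod ht x, h4] with w hw hw0
  have hj : ∀ G : Matrix (Fin m) (Fin m) ℝ, √((jac (dc x w.2)).transpose * G *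
      jac (dc x w.2)).det = |(jac (dc (n := m) x w.2)).det| * √G.det := fun G => by
    rw [Matrix.det_mul, Matrix.det_mul, Matrix.det_transpose,
      show ∀ a b : ℝ, a * b * a = a ^ 2 * b from fun a b => by ring,
      Real.sqrt_mul (sq_nonneg _), Real.sqrt_sq_eq_abs]
  rw [D.gram_firstForm hw.1 hw.2.1 hw.2.2, D.gram_firstForm D.zero_mem hw.2.1 hw0, hj, hj,
    mul_div_mul_left _ _ (abs_pos.2 (isUnit_jac hw.2.1).ne_zero).ne']
  rfl

theorem continuousOn_signedJacobian :
    ContinuousOn (Function.uncurry D.signedJacobian) (Ioo (-D.ε) D.ε ×ˢ univ) := by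
  rintro ⟨t, x⟩ ⟨ht, -⟩
  refine ContinuousAt.continuousWithinAt ?_
  refine ((D.continuousAt_normalSpeed ht x).mul (D.continuousAt_areaRatio ht x)).congr ?_
  filter_upwards [D.eventually_source_prod ht x] with w hw
  rw [Function.uncurry, D.signedJacobian_eq hw.1, mul_div_assoc]
  rfl

theorem continuous_normalSpeed : Continuous (D.normalSpeed 0) :=
  continuous_iff_continuousAt.2 fun x =>
    (D.continuousAt_normalSpeed D.zero_mem x).comp (f := fun x => ((0 : ℝ), x))
      (continuousAt_const.prodMk continuousAt_id)

theorem density_areaForm_pos (q : N) (y : Euc m) (hy : y ∈ (extChartAt (𝓡 m) q).target) :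
    0 < density D.areaForm q y := by
  have hx := (extChartAt (𝓡 m) q).map_target hy
  have hp := mem_extChartAt_source (I := 𝓡 (m + 1)) (D.map 0 ((extChartAt (𝓡 m) q).symm y))
  have h1 := D.density_areaForm hx hp
  rw [(extChartAt (𝓡 m) q).right_inv hy] at h1
  rw [h1]
  have hz := D.mem_locO D.zero_mem hx hp
  rw [(extChartAt (𝓡 m) q).right_inv hy] at hz
  exact Real.sqrt_pos.2 ((D.hypFamily _ _).det_pos hz)

theorem eventually_density_areaForm {x : N} (hx : x ∈ (extChartAt (𝓡 m) q).source)
    (hp : D.map 0 x ∈ (extChartAt (𝓡 (m + 1)) p).source) :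
    ∀ᶠ y in 𝓝 (extChartAt (𝓡 m) q x), ((0 : ℝ), y) ∈ D.locO q p ∧
      density D.areaForm q y = D.locArea q p y ∧
      ∀ k, dc q ((extChartAt (𝓡 m) q).symm y) (D.tanField ((extChartAt (𝓡 m) q).symm y)) k =
        D.tanCoef q p (0, y) k := by
  filter_upwards [eventually_rep hx (D.mdifferentiableAt_map D.zero_mem x).continuousAt
    ((isOpen_extChartAt_source p).mem_nhds hp), (isOpen_extChartAt_target q).mem_nhds
      ((extChartAt (𝓡 m) q).map_source hx)] with y h1 h2
  have h3 := (extChartAt (𝓡 m) q).map_target h2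
  have h4 := D.density_areaForm h3 h1
  have h5 := fun k => D.tanCoef_eq h3 h1 k
  rw [(extChartAt (𝓡 m) q).right_inv h2] at h4
  simp only [(extChartAt (𝓡 m) q).right_inv h2] at h5
  exact ⟨⟨D.zero_mem, h2, h1⟩, h4, fun k => (h5 k).symm⟩

theorem density_areaForm_continuousOn (q : N) :
    ContinuousOn (density D.areaForm q) (extChartAt (𝓡 m) q).target := by
  intro y hy
  refine ContinuousAt.continuousWithinAt ?_
  have hx := (extChartAt (𝓡 m) q).map_target hy
  have hp := mem_extChartAt_source (I := 𝓡 (m + 1)) (D.map 0 ((extChartAt (𝓡 m) q).symm y))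
  have h1 := D.eventually_density_areaForm hx hp
  rw [(extChartAt (𝓡 m) q).right_inv hy] at h1
  refine ((D.contDiffAt_locArea h1.self_of_nhds.1).continuousAt).congr ?_
  filter_upwards [h1] with z hz using hz.2.1.symm

/-- The variation of the normal has divergence `divNormalVar`. -/
theorem isDivergence {c : ℝ} (hE : ∀ (p : M) (Y Z : TangentSpace (𝓡 (m + 1)) p),
      ricci g.tensor p Y Z = c * g.tensor p Y Z) {K : Set N} (hK : IsClosed K)
    (hc : ∀ t ∈ Ioo (-D.ε) D.ε, ∀ x ∉ K, D.map t x = D.map 0 x) :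
    IsDivergence D.areaForm D.tanField (D.divNormalVar c) K where
  field_eq_zero x hx := by
    have hxs := mem_extChartAt_source (I := 𝓡 m) x
    have hz := D.mem_locO D.zero_mem hxs (mem_extChartAt_source (I := 𝓡 (m + 1)) (D.map 0 x))
    have h1 := D.tanCoef_eq_zero hK hc hz (by
      simp only [(extChartAt (𝓡 m) x).left_inv hxs]; exact hx)
    ext k
    exact h1 k
  -- Near a point outside of `K`, the field is zero, hence so is its divergence.
  eq_zero x hx := by
    have hxs := mem_extChartAt_source (I := 𝓡 m) x
    have hp := mem_extChartAt_source (I := 𝓡 (m + 1)) (D.map 0 x)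
    have h1 := D.locArea_mul_divNormalVar hE hxs hp
    have h2 : ∀ k, fderiv ℝ (fun y => D.locArea x (D.map 0 x) y *
        D.tanCoef x (D.map 0 x) (0, y) k) (extChartAt (𝓡 m) x x) (bv k) = 0 := by
      intro k
      have h3 : (fun y => D.locArea x (D.map 0 x) y * D.tanCoef x (D.map 0 x) (0, y) k)
          =ᶠ[𝓝 (extChartAt (𝓡 m) x x)] fun _ => 0 := by
        filter_upwards [D.eventually_density_areaForm hxs hp, eventually_rep (q := x) hxs
          continuousAt_id (hK.isOpen_compl.mem_nhds hx)] with y h4 h5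
        rw [D.tanCoef_eq_zero hK hc h4.1 h5, mul_zero]
      rw [h3.fderiv_eq]; simp
    rw [Finset.sum_eq_zero fun k _ => h2 k] at h1
    refine (mul_eq_zero.1 h1).resolve_left ?_
    exact (Real.sqrt_pos.2 ((D.hypFamily _ _).det_pos (D.mem_locO D.zero_mem hxs hp))).ne'
  density_pos := D.density_areaForm_pos
  density_continuousOn := D.density_areaForm_continuousOn
  eventually q := by
    have hp := mem_extChartAt_source (I := 𝓡 (m + 1)) (D.map 0 q)
    filter_upwards [extChartAt_source_mem_nhds (I := 𝓡 m) q,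
      (D.mdifferentiableAt_map D.zero_mem q).continuousAt.preimage_mem_nhds
        ((isOpen_extChartAt_source _).mem_nhds hp)] with x hx hpx
    have h1 := D.eventually_density_areaForm hx hpx
    have hz := h1.self_of_nhds.1
    have h2 : ∀ k, (fun y => density D.areaForm q y * dc q ((extChartAt (𝓡 m) q).symm y)
        (D.tanField ((extChartAt (𝓡 m) q).symm y)) k) =ᶠ[𝓝 (extChartAt (𝓡 m) q x)]
        fun y => D.locArea q (D.map 0 q) y * D.tanCoef q (D.map 0 q) (0, y) k := fun k => by
      filter_upwards [h1] with y hy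
      rw [hy.2.1, hy.2.2 k]
    constructor
    · intro k
      refine ContDiffAt.congr_of_eventuallyEq ?_ (h2 k)
      exact ((D.contDiffAt_locArea hz).mul ((D.contDiffAt_tanCoef hz k).comp _
        (f := fun y => ((0 : ℝ), y)) (contDiffAt_const.prodMk contDiffAt_id))).of_le (by simp)
    · rw [h1.self_of_nhds.2.1, D.locArea_mul_divNormalVar hE hx hpx]
      exact Finset.sum_congr rfl fun k _ => by rw [(h2 k).fderiv_eq]

variable [SecondCountableTopology N] [MeasurableSpace N] [BorelSpace N]

theorem isLocallyFiniteMeasure_area : IsLocallyFiniteMeasure D.area := by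
  rw [area_eq]
  exact isLocallyFiniteMeasure_riemannianMeasure (β := D.areaForm) D.density_areaForm_continuousOn

/-- The derivative of the swept volume is the integral of the normal speed. -/
theorem hasDerivAt_sweptVolume :
    HasDerivAt D.sweptVolume (∫ x, D.normalSpeed 0 x ∂D.area) 0 := by
  have := D.isLocallyFiniteMeasure_area
  obtain ⟨K, hK, hc⟩ := D.compact_support
  have h1 : ContinuousOn (fun t => ∫ x, D.signedJacobian t x ∂D.area) (Ioo (-D.ε) D.ε) :=
    continuousOn_integral_of_compact_support hK D.continuousOn_signedJacobian
      fun t x ht hx => by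
        rw [D.signedJacobian_eq ht, D.normalSpeed_eq_zero hc ht hx, zero_mul, zero_div]
  have h2 := intervalIntegral.integral_hasDerivAt_right (a := 0) IntervalIntegrable.refl
    (h1.stronglyMeasurableAtFilter isOpen_Ioo 0 D.zero_mem)
    (h1.continuousAt (isOpen_Ioo.mem_nhds D.zero_mem))
  simp only [D.signedJacobian_zero] at h2
  exact h2

variable [T2Space N]

theorem integrable_normalSpeed : Integrable (D.normalSpeed 0) D.area := by
  have := D.isLocallyFiniteMeasure_area
  obtain ⟨K, hK, hc⟩ := D.compact_support
  exact D.continuous_normalSpeed.integrable_of_hasCompactSupport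
    (HasCompactSupport.intro hK fun x hx => D.normalSpeed_eq_zero hc D.zero_mem hx)

/-- The integrated variation formula. -/
theorem integral_integrand {c : ℝ} (hE : ∀ (p : M) (Y Z : TangentSpace (𝓡 (m + 1)) p),
      ricci g.tensor p Y Z = c * g.tensor p Y Z) :
    Integrable D.integrand D.area ∧
      ∫ x, D.integrand x ∂D.area = c * ∫ x, D.normalSpeed 0 x ∂D.area := by
  obtain ⟨K, hK, hc⟩ := D.compact_support
  obtain ⟨-, h1, h2⟩ := (D.isDivergence hE hK.isClosed hc).integral_eq_zero hK
  have h3 : D.integrand = fun x => c * D.normalSpeed 0 x - D.divNormalVar c x := by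
    funext x; simp only [divNormalVar, normalSpeed]; ring
  have h4 := D.integrable_normalSpeed.const_mul c
  rw [h3]
  refine ⟨h4.sub h1, ?_⟩
  rw [integral_sub h4 h1, integral_const_mul]
  rw [show ∫ x, D.divNormalVar c x ∂D.area = 0 from h2, sub_zero]

end Deformation

end Schlaefli

end

noncomputable section

namespace Schlaefli

/-! ### Families of hypersurfaces as graphs -/

section Graph

variable {m : ℕ}

/-- Near the coordinate `y₀`, the hypersurfaces `F (t, ·)` are the graphs of the functions `h t` in
the coordinates `(z, y) ↦ F (0, y) + z • u`. The coordinate domain is given by `|z| < η` and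
`‖y - y₀‖ < r`, and `h'` is the time derivative of `h` at `0`. In this domain, the graphs contain
all points of the hypersurfaces with coordinate in `X`. -/
structure IsGraph (F : ℝ × Euc m → Euc (m + 1)) (u : Euc (m + 1)) (y₀ : Euc m)
    (h : ℝ → Euc m → ℝ) (h' : Euc m → ℝ) (r η : ℝ) (X : Set (Euc m)) : Prop where
  r_pos : 0 < r
  η_pos : 0 < η
  apply_zero : ∀ y ∈ Metric.ball y₀ r, h 0 y = 0
  abs_lt : ∀ t ∈ Ioo (-r) r, ∀ y ∈ Metric.ball y₀ r, |h t y| < η / 2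
  continuousOn : ∀ t ∈ Ioo (-r) r, ContinuousOn (h t) (Metric.ball y₀ r)
  lipschitz : ∃ L : NNReal, ∀ y ∈ Metric.ball y₀ r, LipschitzOnWith L (fun t => h t y) (Ioo (-r) r)
  hasDerivAt : ∀ y ∈ Metric.ball y₀ r, HasDerivAt (fun t => h t y) (h' y) 0
  continuousOn_deriv : ContinuousOn h' (Metric.ball y₀ r)
  deriv_eq : ∀ y ∈ Metric.ball y₀ r, ∃ w : Euc m,
    fderiv ℝ F (0, y) (1, 0) + fderiv ℝ F (0, y) (0, w) = h' y • u
  injOn : InjOn (fun w : ℝ × Euc m => F (0, w.2) + w.1 • u) (Ioo (-η) η ×ˢ Metric.ball y₀ r)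
  isOpen_image : ∀ W ⊆ Ioo (-η) η ×ˢ Metric.ball y₀ r, IsOpen W →
    IsOpen ((fun w : ℝ × Euc m => F (0, w.2) + w.1 • u) '' W)
  eq_of_eq : ∀ t ∈ Ioo (-r) r, ∀ y ∈ X, ∀ z ∈ Ioo (-η) η, ∀ y' ∈ Metric.ball y₀ r,
    F (t, y) = F (0, y') + z • u → z = h t y' ∧ (t = 0 → y = y')

/-- A family of hypersurfaces that are transverse to the vector `u` is locally a family of graphs:
this is the inverse function theorem for `(t, y, z) ↦ (t, F (t, y) - z • u)`. -/
theorem exists_isGraph {F : ℝ × Euc m → Euc (m + 1)} {u : Euc (m + 1)} {y₀ : Euc m}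
    {O : Set (ℝ × Euc m)} (hO : IsOpen O) (h0 : ((0 : ℝ), y₀) ∈ O)
    (hF : ∀ z ∈ O, ContDiffAt ℝ ∞ F z)
    (hu : ∀ (v : Euc m) (a : ℝ), fderiv ℝ F (0, y₀) (0, v) = a • u → v = 0 ∧ a = 0) :
    ∃ X ∈ 𝓝 y₀, ∀ V ∈ 𝓝 ((0 : ℝ), y₀), ∃ h h' r η, IsGraph F u y₀ h h' r η X ∧
      Ioo (-η) η ×ˢ Metric.ball y₀ r ⊆ V ∧ Ioo (-r) r ×ˢ Metric.ball y₀ r ⊆ O := by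
  set Q : ℝ × (Euc m × ℝ) → ℝ × Euc (m + 1) := fun w => (w.1, F (w.1, w.2.1) - w.2.2 • u) with hQ
  set a₀ : ℝ × (Euc m × ℝ) := (0, (y₀, 0)) with ha₀
  have hFa : ContDiffAt ℝ 1 F (a₀.1, a₀.2.1) := (hF _ h0).of_le (by simp)
  have hQd : ContDiffAt ℝ 1 Q a₀ := by
    refine contDiffAt_fst.prodMk (ContDiffAt.sub (ContDiffAt.comp a₀ hFa
      (contDiffAt_fst.prodMk (contDiffAt_snd.fst))) (contDiffAt_snd.snd.smul contDiffAt_const))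
  set L : ℝ × (Euc m × ℝ) →L[ℝ] ℝ × Euc (m + 1) := fderiv ℝ Q a₀ with hL
  have hQL : HasFDerivAt Q L a₀ := (hQd.differentiableAt (by simp)).hasFDerivAt
  have hLapp : ∀ s v a, L (s, (v, a)) = (s, fderiv ℝ F (0, y₀) (s, v) - a • u) := by
    intro s v a
    have hFf : HasFDerivAt F (fderiv ℝ F (0, y₀)) (a₀.1, a₀.2.1) :=
      (hFa.differentiableAt (by simp)).hasFDerivAt
    have h1 : HasFDerivAt (fun w : ℝ × (Euc m × ℝ) => F (w.1, w.2.1)) _ a₀ :=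
      HasFDerivAt.comp a₀ hFf (hasFDerivAt_fst.prodMk (hasFDerivAt_snd (p := a₀)).fst)
    have h2 := (hasFDerivAt_snd (𝕜 := ℝ) (p := a₀)).snd.smul_const u
    have h3 := hQL.unique (hasFDerivAt_fst.prodMk (h1.sub h2))
    rw [h3]
    rfl
  have hLinj : Function.Injective L := by
    rw [injective_iff_map_eq_zero]
    rintro ⟨s, v, a⟩ hz
    rw [hLapp] at hz
    obtain ⟨hs, hv⟩ := Prod.mk_eq_zero.1 hz
    subst hs
    obtain ⟨rfl, rfl⟩ := hu v a (sub_eq_zero.1 hv)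
    rfl
  set Le : (ℝ × (Euc m × ℝ)) ≃L[ℝ] (ℝ × Euc (m + 1)) :=
    (LinearMap.linearEquivOfInjective L.toLinearMap hLinj (by simp)).toContinuousLinearEquiv
    with hLe
  have hQLe : HasFDerivAt Q (Le : (ℝ × (Euc m × ℝ)) →L[ℝ] (ℝ × Euc (m + 1))) a₀ := by
    convert hQL using 1
    exact ContinuousLinearMap.ext fun w => rfl
  set T := hQd.toOpenPartialHomeomorph Q hQLe (by simp) with hT
  have hTc : ∀ w, T w = Q w := fun w => rfl
  have ha₀T : a₀ ∈ T.source := hQd.mem_toOpenPartialHomeomorph_source hQLe (by simp)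
  set σ : ℝ × Euc m → ℝ × Euc (m + 1) := fun w => (w.1, F (0, w.2)) with hσ
  have hσ0 : ∀ y, σ (0, y) = Q (0, (y, 0)) := fun y => by simp [hσ, hQ]
  have hσd : ContDiffAt ℝ 1 σ (0, y₀) :=
    contDiffAt_fst.prodMk (ContDiffAt.comp (0, y₀) (f := fun w : ℝ × Euc m => ((0 : ℝ), w.2)) hFa
      (contDiffAt_const.prodMk contDiffAt_snd))
  have hSd : ContDiffAt ℝ 1 T.symm (σ (0, y₀)) := by
    have h1 := hQd.to_localInverse hQLe (by simp)
    rw [hσ0]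
    exact h1
  set R : ℝ × Euc m → ℝ × (Euc m × ℝ) := fun w => T.symm (σ w) with hR
  have hRd : ContDiffAt ℝ 1 R (0, y₀) := hSd.comp (0, y₀) hσd
  set H : ℝ × Euc m → ℝ := fun w => (R w).2.2 with hH
  have hHd : ∀ {w}, ContDiffAt ℝ 1 R w → ContDiffAt ℝ 1 H w := fun h => h.snd.snd
  obtain ⟨LH, tH, htH, hLip⟩ := (hHd hRd).exists_lipschitzOnWith
  obtain ⟨ρ, hρ, hρs⟩ := Metric.nhds_basis_ball.mem_iff.1 (T.open_source.mem_nhds ha₀T)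
  have hsrc : ∀ t y z, |t| < ρ → y ∈ Metric.ball y₀ ρ → |z| < ρ → (t, (y, z)) ∈ T.source := by
    intro t y z h1 h2 h3
    refine hρs ?_
    rw [ha₀, ← ball_prod_same, ← ball_prod_same]
    simpa using ⟨h1, h2, h3⟩
  refine ⟨Metric.ball y₀ ρ, Metric.ball_mem_nhds _ hρ, fun V hV => ?_⟩
  obtain ⟨η', hη', hηV⟩ := Metric.nhds_basis_ball.mem_iff.1 hV
  set η := min η' ρ with hηd
  have hη : 0 < η := lt_min hη' hρ
  have hηρ : η ≤ ρ := min_le_right _ _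
  have hH0 : ∀ y ∈ Metric.ball y₀ ρ, R (0, y) = (0, (y, 0)) := by
    intro y hy
    have h1 := hsrc 0 y 0 (by simpa using hρ) hy (by simpa using hρ)
    rw [hR]
    simp only [hσ0]
    exact T.left_inv h1
  -- The radius of the domain where the graph functions have the required properties.
  have e1 : ∀ᶠ w in 𝓝 ((0 : ℝ), y₀), ContDiffAt ℝ 1 R w := hRd.eventually (by simp)
  have e2 : ∀ᶠ w in 𝓝 ((0 : ℝ), y₀), σ w ∈ T.target := by
    refine hσd.continuousAt.preimage_mem_nhds (T.open_target.mem_nhds ?_)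
    rw [hσ0]; exact T.map_source ha₀T
  have e3 : ∀ᶠ w in 𝓝 ((0 : ℝ), y₀), |H w| < η / 2 := by
    have h1 : ContinuousAt (fun w => |H w|) (0, y₀) := (hHd hRd).continuousAt.abs
    refine h1.eventually_lt continuousAt_const ?_
    simp only [hH, hH0 y₀ (Metric.mem_ball_self hρ), abs_zero]
    positivity
  obtain ⟨r', hr', hrs⟩ := Metric.nhds_basis_ball.mem_iff.1
    (inter_mem (inter_mem (inter_mem e1 e2) (inter_mem e3 htH)) (hO.mem_nhds h0))
  set r := min r' η with hr
  have hrp : 0 < r := lt_min hr' hη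
  have hrη : Metric.ball y₀ r ⊆ Metric.ball y₀ ρ :=
    Metric.ball_subset_ball ((min_le_right _ _).trans hηρ)
  have hrP : ∀ t ∈ Ioo (-r) r, ∀ y ∈ Metric.ball y₀ r, ContDiffAt ℝ 1 R (t, y) ∧
      σ (t, y) ∈ T.target ∧ |H (t, y)| < η / 2 ∧ (t, y) ∈ tH ∧ (t, y) ∈ O := by
    intro t ht y hy
    have h4 : (t, y) ∈ Metric.ball ((0 : ℝ), y₀) r' := by
      rw [← ball_prod_same]
      refine ⟨?_, Metric.ball_subset_ball (min_le_left _ _) hy⟩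
      rw [mem_ball_zero_iff, Real.norm_eq_abs]
      exact (abs_lt.2 ht).trans_le (min_le_left _ _)
    obtain ⟨⟨⟨h5, h6⟩, h7, h8⟩, h9⟩ := hrs h4
    exact ⟨h5, h6, h7, h8, h9⟩
  have h0r : (0 : ℝ) ∈ Ioo (-r) r := ⟨by linarith, hrp⟩
  have hRs : ∀ y ∈ Metric.ball y₀ r, DifferentiableAt ℝ (fun t => R (t, y)) 0 := fun y hy =>
    DifferentiableAt.comp (0 : ℝ) (f := fun t => (t, y))
      ((hrP 0 h0r y hy).1.differentiableAt (by simp))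
      (hasFDerivAt_prodMk_left (𝕜 := ℝ) (0 : ℝ) y).differentiableAt
  refine ⟨fun t y => H (t, y), fun y => fderiv ℝ H (0, y) (1, 0), r, η, ?_, ?_, ?_⟩
  · refine ⟨hrp, hη, fun y hy => ?_, fun t ht y hy => (hrP t ht y hy).2.2.1, fun t ht y hy => ?_,
      ⟨LH, fun y hy => ?_⟩, fun y hy => ?_, fun y hy => ?_, fun y hy => ?_, ?_, ?_, ?_⟩
    · simp only [hH, hH0 y (hrη hy)]
    · exact (ContinuousAt.comp (f := fun y => (t, y)) (hHd (hrP t ht y hy).1).continuousAt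
        (continuousAt_const.prodMk continuousAt_id)).continuousWithinAt
    · intro s hs t ht
      have := hLip (hrP s hs y hy).2.2.2.1 (hrP t ht y hy).2.2.2.1
      simpa [Prod.edist_eq] using this
    · rw [Deformation.fderiv_prod_left ((hHd (hrP 0 h0r y hy).1).differentiableAt (by simp))]
      exact (Deformation.differentiableAt_slice (t := 0)
        ((hHd (hrP 0 h0r y hy).1).differentiableAt (by simp))).hasDerivAt
    · have h1 := ((hHd (hrP 0 h0r y hy).1).fderiv_right (m := 0) (by simp)).continuousAt
      exact ((ContinuousAt.comp (f := fun y => ((0 : ℝ), y)) h1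
        (continuousAt_const.prodMk continuousAt_id)).clm_apply
          continuousAt_const).continuousWithinAt
    · -- Differentiate the identity `F (t, y(t)) - h(t) • u = F (0, y)`.
      have hRd' := (hRs y hy).hasDerivAt
      set R' := deriv (fun t => R (t, y)) 0 with hR'
      have h1 : HasDerivAt (fun t => (R (t, y)).2.1) R'.2.1 0 := by
        have := (hasFDerivAt_fst.comp_hasDerivAt (0 : ℝ) (hasFDerivAt_snd.comp_hasDerivAt (0 : ℝ)
          hRd') : HasDerivAt _ _ (0 : ℝ))
        exact this
      have h2 : HasDerivAt (fun t => (R (t, y)).2.2) R'.2.2 0 := by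
        have := (hasFDerivAt_snd.comp_hasDerivAt (0 : ℝ) (hasFDerivAt_snd.comp_hasDerivAt (0 : ℝ)
          hRd') : HasDerivAt _ _ (0 : ℝ))
        exact this
      have hFy : HasFDerivAt F (fderiv ℝ F (0, y)) ((0 : ℝ), (R (0, y)).2.1) := by
        rw [hH0 y (hrη hy)]
        exact ((hF _ (hrP 0 h0r y hy).2.2.2.2).differentiableAt (by simp)).hasFDerivAt
      have h3 : HasDerivAt (fun t => F (t, (R (t, y)).2.1)) (fderiv ℝ F (0, y) (1, R'.2.1)) 0 :=
        HasFDerivAt.comp_hasDerivAt (0 : ℝ) hFy ((hasDerivAt_id (0 : ℝ)).prodMk h1)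
      have h4 := h3.sub (h2.smul_const u)
      have h5 : (fun t => F (t, (R (t, y)).2.1) - (R (t, y)).2.2 • u) =ᶠ[𝓝 0]
          fun _ => F (0, y) := by
        filter_upwards [isOpen_Ioo.mem_nhds h0r] with t ht
        have h6 : Q (R (t, y)) = σ (t, y) := T.right_inv (hrP t ht y hy).2.1
        have h7 : (R (t, y)).1 = t := congrArg Prod.fst h6
        have h8 := congrArg Prod.snd h6
        simp only [hQ, h7] at h8
        exact h8
      have h6 := (h4.congr_of_eventuallyEq h5.symm).unique (hasDerivAt_const (0 : ℝ) (F (0, y)))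
      refine ⟨R'.2.1, ?_⟩
      have h7 : fderiv ℝ H (0, y) (1, 0) = R'.2.2 := by
        rw [Deformation.fderiv_prod_left ((hHd (hrP 0 h0r y hy).1).differentiableAt (by simp))]
        exact h2.deriv
      rw [h7, ← map_add, Prod.mk_add_mk, add_zero, zero_add]
      exact sub_eq_zero.1 h6
    · rintro ⟨z, y⟩ ⟨hz, hy⟩ ⟨z', y'⟩ ⟨hz', hy'⟩ he
      have h1 := hsrc 0 y (-z) (by simpa using hρ) (hrη hy)
        (by rw [abs_neg]; exact (abs_lt.2 hz).trans_le hηρ)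
      have h2 := hsrc 0 y' (-z') (by simpa using hρ) (hrη hy')
        (by rw [abs_neg]; exact (abs_lt.2 hz').trans_le hηρ)
      have h3 := T.injOn h1 h2 (by
        simp only [hTc, hQ, neg_smul, sub_neg_eq_add]; exact Prod.ext rfl he)
      simp only [Prod.mk.injEq, neg_inj, true_and] at h3
      rw [h3.1, h3.2]
    · intro W₀ hW₀ hWo
      have hc : Continuous (fun w : ℝ × (Euc m × ℝ) => (-w.2.2, w.2.1)) := by fun_prop
      set W : Set (ℝ × (Euc m × ℝ)) :=
        (Ioo (-η) η ×ˢ univ) ∩ (fun w : ℝ × (Euc m × ℝ) => (-w.2.2, w.2.1)) ⁻¹' W₀ with hW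
      have hWo' : IsOpen W := (isOpen_Ioo.prod isOpen_univ).inter (hWo.preimage hc)
      have hWs : W ⊆ T.source := fun w hw => by
        have h1 := hW₀ hw.2
        have h2 := abs_lt.2 h1.1
        rw [abs_neg] at h2
        exact hsrc w.1 w.2.1 w.2.2 ((abs_lt.2 hw.1.1).trans_le hηρ) (hrη h1.2) (h2.trans_le hηρ)
      have h1 := T.isOpen_image_of_subset_source hWo' hWs
      have h2 : Continuous (fun q : Euc (m + 1) => ((0 : ℝ), q)) := by fun_prop
      convert h1.preimage h2 using 1
      ext q
      constructor
      · rintro ⟨⟨z, y⟩, hw, rfl⟩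
        refine ⟨(0, (y, -z)), ⟨⟨⟨by simpa using hη, hη⟩, mem_univ _⟩, ?_⟩, ?_⟩
        · simpa using hw
        · simp only [hTc, hQ, neg_smul, sub_neg_eq_add]
      · rintro ⟨⟨t, y, z⟩, ⟨-, hw⟩, he⟩
        simp only [hTc, hQ, Prod.mk.injEq] at he
        obtain ⟨rfl, rfl⟩ := he
        exact ⟨(-z, y), hw, by simp only [neg_smul, sub_eq_add_neg]⟩
    · intro t ht y hy z hz y' hy' he
      have htρ : |t| < ρ := (abs_lt.2 ht).trans_le ((min_le_right _ _).trans hηρ)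
      have h1 := hsrc t y z htρ hy ((abs_lt.2 hz).trans_le hηρ)
      have h2 : Q (t, (y, z)) = σ (t, y') := by simp only [hQ, hσ, he, add_sub_cancel_right]
      have h3 : R (t, y') = (t, (y, z)) := by
        rw [hR]
        simp only [← h2]
        exact T.left_inv h1
      refine ⟨by simp only [hH, h3], ?_⟩
      rintro rfl
      rw [hH0 y' (hrη hy')] at h3
      simp only [Prod.mk.injEq, true_and] at h3
      exact h3.1.symm
  · rintro ⟨z, y⟩ ⟨hz, hy⟩
    refine hηV ?_
    rw [← ball_prod_same]
    refine ⟨?_, Metric.ball_subset_ball ((min_le_right _ _).trans (min_le_left _ _)) hy⟩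
    rw [mem_ball_zero_iff, Real.norm_eq_abs]
    exact (abs_lt.2 hz).trans_le (min_le_left _ _)
  · rintro ⟨t, y⟩ ⟨ht, hy⟩
    exact (hrP t ht y hy).2.2.2.2

end Graph

end Schlaefli

end

noncomputable section

namespace Schlaefli

section Subgraph

variable {m : ℕ} {F : ℝ × Euc m → Euc (m + 1)} {u : Euc (m + 1)} {y₀ : Euc m}
  {h : ℝ → Euc m → ℝ} {h' : Euc m → ℝ} {r η : ℝ} {X : Set (Euc m)}

theorem IsGraph.zero_mem (hG : IsGraph F u y₀ h h' r η X) : (0 : ℝ) ∈ Ioo (-r) r :=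
  ⟨neg_lt_zero.2 hG.r_pos, hG.r_pos⟩

theorem IsGraph.isOpen_subgraph (hG : IsGraph F u y₀ h h' r η X) {t : ℝ} (ht : t ∈ Ioo (-r) r) :
    IsOpen {w : ℝ × Euc m | w ∈ Ioo (-η) η ×ˢ Metric.ball y₀ r ∧ w.1 < h t w.2} := by
  have hbox : IsOpen (Ioo (-η) η ×ˢ Metric.ball y₀ r) := isOpen_Ioo.prod Metric.isOpen_ball
  have h1 : ContinuousOn (fun w : ℝ × Euc m => h t w.2 - w.1) (Ioo (-η) η ×ˢ Metric.ball y₀ r) :=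
    ((hG.continuousOn t ht).comp continuousOn_snd fun w hw => hw.2).sub continuousOn_fst
  convert h1.isOpen_inter_preimage hbox (isOpen_Ioi (a := (0 : ℝ))) using 1
  ext w
  simp

/-- A graph is a null set, since it meets each vertical line in one point. -/
theorem IsGraph.volume_graph (hG : IsGraph F u y₀ h h' r η X) {t : ℝ} (ht : t ∈ Ioo (-r) r) :
    volume {w : ℝ × Euc m | w ∈ Ioo (-η) η ×ˢ Metric.ball y₀ r ∧ w.1 = h t w.2} = 0 := by
  classical
  have h1 : Measurable ((Metric.ball y₀ r).piecewise (h t) 0) :=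
    (hG.continuousOn t ht).measurable_piecewise continuousOn_const measurableSet_ball
  have h3 : MeasurableSet {w : ℝ × Euc m | w.1 = (Metric.ball y₀ r).piecewise (h t) 0 w.2} :=
    measurableSet_eq_fun measurable_fst (h1.comp measurable_snd)
  have h2 : volume {w : ℝ × Euc m | w.1 = (Metric.ball y₀ r).piecewise (h t) 0 w.2} = 0 := by
    rw [Measure.volume_eq_prod, ← Measure.prod_swap,
      Measure.map_apply measurable_swap h3, Measure.measure_prod_null (measurable_swap h3)]
    refine Filter.Eventually.of_forall fun y => ?_
    have h4 : Prod.mk y ⁻¹' (Prod.swap ⁻¹'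
        {w : ℝ × Euc m | w.1 = (Metric.ball y₀ r).piecewise (h t) 0 w.2}) =
        {(Metric.ball y₀ r).piecewise (h t) 0 y} := by ext z; simp
    simp only [h4]
    simp
  refine measure_mono_null (fun w hw => ?_) h2
  change w.1 = (Metric.ball y₀ r).piecewise (h t) 0 w.2
  rw [piecewise_eq_of_mem _ _ _ hw.1.2, hw.2]

/-- Fubini's theorem over a subgraph. -/
theorem IsGraph.integral_subgraph (hG : IsGraph F u y₀ h h' r η X) {t : ℝ} (ht : t ∈ Ioo (-r) r)
    {k : ℝ × Euc m → ℝ} (hk : Continuous k) (hkc : HasCompactSupport k) :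
    ∫ w in {w : ℝ × Euc m | w ∈ Ioo (-η) η ×ˢ Metric.ball y₀ r ∧ w.1 < h t w.2}, k w =
      ∫ y in Metric.ball y₀ r, ∫ z in (-η)..(h t y), k (z, y) := by
  set S := {w : ℝ × Euc m | w ∈ Ioo (-η) η ×ˢ Metric.ball y₀ r ∧ w.1 < h t w.2} with hS
  have hSm : MeasurableSet S := (hG.isOpen_subgraph ht).measurableSet
  rw [← integral_indicator hSm, Measure.volume_eq_prod, integral_prod_symm _
    (by rw [← Measure.volume_eq_prod]
        exact (hk.integrable_of_hasCompactSupport hkc).indicator hSm)]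
  have h0 : ∀ y ∉ Metric.ball y₀ r, ∫ z, S.indicator k (z, y) = 0 := by
    intro y hy
    rw [← integral_zero ℝ ℝ]
    congr 1
    funext z
    exact indicator_of_notMem (fun hw => hy hw.1.2) _
  rw [← setIntegral_eq_integral_of_forall_compl_eq_zero h0]
  refine setIntegral_congr_fun measurableSet_ball fun y hy => ?_
  have h1 := _root_.abs_lt.1 (hG.abs_lt t ht y hy)
  have hη := hG.η_pos
  have h2 : (fun z => S.indicator k (z, y)) = (Ioo (-η) (h t y)).indicator fun z => k (z, y) := by
    funext z
    by_cases hz : z ∈ Ioo (-η) (h t y)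
    · rw [indicator_of_mem hz, indicator_of_mem]
      exact ⟨⟨⟨hz.1, by linarith [hz.2]⟩, hy⟩, hz.2⟩
    · rw [indicator_of_notMem hz, indicator_of_notMem]
      exact fun hw => hz ⟨hw.1.1.1, hw.2⟩
  simp only [h2]
  rw [integral_indicator measurableSet_Ioo, ← integral_Ioc_eq_integral_Ioo,
    intervalIntegral.integral_of_le (by linarith)]

/-- The integral over the regions below the graphs of `h t` is differentiated with Fubini's theorem
and the fundamental theorem of calculus on vertical lines. The Lipschitz bound on `h` in time allows
to differentiate under the integral over `y`. -/
theorem IsGraph.hasDerivAt_integral_subgraph (hG : IsGraph F u y₀ h h' r η X)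
    {k : ℝ × Euc m → ℝ} (hk : Continuous k) (hkc : HasCompactSupport k) :
    HasDerivAt (fun t => ∫ w in {w : ℝ × Euc m | w ∈ Ioo (-η) η ×ˢ Metric.ball y₀ r ∧
      w.1 < h t w.2}, k w) (∫ y in Metric.ball y₀ r, k (0, y) * h' y) 0 := by
  obtain ⟨C, hC⟩ := hkc.exists_bound_of_continuous hk
  have hC0 : 0 ≤ C := (norm_nonneg _).trans (hC (0, y₀))
  obtain ⟨L, hL⟩ := hG.lipschitz
  have hnhds : Ioo (-r) r ∈ 𝓝 (0 : ℝ) := isOpen_Ioo.mem_nhds hG.zero_mem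
  have hkz : ∀ y, Continuous fun z => k (z, y) := fun y => by fun_prop
  have hGc : Continuous fun w : Euc m × ℝ => ∫ z in (-η)..w.2, k (z, w.1) :=
    intervalIntegral.continuous_parametric_primitive_of_continuous (μ := volume) (a₀ := -η)
      (f := fun y z => k (z, y)) (by fun_prop)
  have hfin : IsFiniteMeasure (volume.restrict (Metric.ball y₀ r)) :=
    ⟨by rw [Measure.restrict_apply_univ]; exact measure_ball_lt_top⟩
  have hmeas : ∀ t ∈ Ioo (-r) r, AEStronglyMeasurable (fun y => ∫ z in (-η)..(h t y), k (z, y))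
      (volume.restrict (Metric.ball y₀ r)) := fun t ht =>
    (hGc.comp_continuousOn (continuousOn_id.prodMk
      (hG.continuousOn t ht))).aestronglyMeasurable measurableSet_ball
  have hsub : ∀ y a b, |(∫ z in (-η)..a, k (z, y)) - ∫ z in (-η)..b, k (z, y)| ≤ C * |a - b| := by
    intro y a b
    rw [intervalIntegral.integral_interval_sub_left ((hkz y).intervalIntegrable _ _)
      ((hkz y).intervalIntegrable _ _)]
    exact intervalIntegral.norm_integral_le_of_norm_le_const fun z _ => hC _
  -- On vertical lines, the integrals are Lipschitz in `t`, with constant the product of a bound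
  -- on `k` and of the Lipschitz constant of `h`.
  have key := hasDerivAt_integral_of_dominated_loc_of_lip
    (μ := volume.restrict (Metric.ball y₀ r)) (F := fun t y => ∫ z in (-η)..(h t y), k (z, y))
    (F' := fun y => k (0, y) * h' y) (bound := fun _ => C * L) (x₀ := (0 : ℝ)) hnhds
    (Filter.eventually_of_mem hnhds hmeas) ?_ ?_ ?_ (integrable_const _) ?_
  · refine key.2.congr_of_eventuallyEq ?_
    filter_upwards [hnhds] with t ht
    exact hG.integral_subgraph ht hk hkc
  · refine Integrable.of_bound (hmeas 0 hG.zero_mem) (C * |η|)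
      ((ae_restrict_iff' measurableSet_ball).2 (Filter.Eventually.of_forall fun y hy => ?_))
    rw [hG.apply_zero y hy]
    have := hsub y 0 (-η)
    simpa using this
  · exact ((hk.comp (by fun_prop : Continuous fun y : Euc m => ((0 : ℝ), y))).continuousOn.mul
      hG.continuousOn_deriv).aestronglyMeasurable measurableSet_ball
  · refine (ae_restrict_iff' measurableSet_ball).2 (Filter.Eventually.of_forall fun y hy => ?_)
    refine LipschitzOnWith.of_dist_le_mul fun s hs t ht => ?_
    have h1 := (hL y hy).dist_le_mul s hs t ht
    rw [Real.dist_eq] at h1 ⊢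
    refine (hsub y _ _).trans ((mul_le_mul_of_nonneg_left h1 hC0).trans (le_of_eq ?_))
    rw [Real.coe_nnabs, _root_.abs_of_nonneg (mul_nonneg hC0 L.coe_nonneg), mul_assoc]
  · refine (ae_restrict_iff' measurableSet_ball).2 (Filter.Eventually.of_forall fun y hy => ?_)
    have h1 : HasDerivAt (fun a => ∫ z in (-η)..a, k (z, y)) (k (h 0 y, y)) (h 0 y) :=
      intervalIntegral.integral_hasDerivAt_right ((hkz y).intervalIntegrable _ _)
        (hkz y).aestronglyMeasurable.stronglyMeasurableAtFilter (hkz y).continuousAt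
    have h2 := h1.comp (0 : ℝ) (hG.hasDerivAt y hy)
    rw [hG.apply_zero y hy] at h2
    exact h2

/-- The derivative of the integral of a density over sets that are, up to null sets, subgraphs. -/
theorem IsGraph.hasDerivAt_integral (hG : IsGraph F u y₀ h h' r η X)
    {k : ℝ × Euc m → ℝ} (hk : Continuous k) (hkc : HasCompactSupport k) {A : ℝ → Set (ℝ × Euc m)}
    (hA : ∀ᶠ t in 𝓝 (0 : ℝ), ∀ w ∈ Ioo (-η) η ×ˢ Metric.ball y₀ r,
      (w.1 < h t w.2 → w ∈ A t) ∧ (h t w.2 < w.1 → w ∉ A t)) :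
    HasDerivAt (fun t => ∫ w in Ioo (-η) η ×ˢ Metric.ball y₀ r, (A t).indicator k w)
      (∫ y in Metric.ball y₀ r, k (0, y) * h' y) 0 := by
  refine (hG.hasDerivAt_integral_subgraph hk hkc).congr_of_eventuallyEq ?_
  filter_upwards [hA, isOpen_Ioo.mem_nhds hG.zero_mem] with t hAt ht
  have hbox : MeasurableSet (Ioo (-η) η ×ˢ Metric.ball y₀ r) :=
    measurableSet_Ioo.prod measurableSet_ball
  rw [← integral_indicator hbox, ← integral_indicator (hG.isOpen_subgraph ht).measurableSet]
  refine integral_congr_ae ?_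
  filter_upwards [measure_eq_zero_iff_ae_notMem.1 (hG.volume_graph ht)] with w hw
  by_cases hwb : w ∈ Ioo (-η) η ×ˢ Metric.ball y₀ r
  · rw [indicator_of_mem hwb]
    rcases lt_trichotomy w.1 (h t w.2) with h1 | h1 | h1
    · rw [indicator_of_mem ((hAt w hwb).1 h1), indicator_of_mem (show w ∈ {w : ℝ × Euc m |
        w ∈ Ioo (-η) η ×ˢ Metric.ball y₀ r ∧ w.1 < h t w.2} from ⟨hwb, h1⟩)]
    · exact absurd ⟨hwb, h1⟩ hw
    · rw [indicator_of_notMem ((hAt w hwb).2 h1), indicator_of_notMem fun h2 => h1.not_gt h2.2]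
  · rw [indicator_of_notMem hwb, indicator_of_notMem fun h2 => hwb h2.1]

end Subgraph

end Schlaefli

end

noncomputable section

namespace Schlaefli

/-! ### The domains bounded by the hypersurfaces -/

section Cons

variable {m : ℕ}

/-- Splitting off the first coordinate. -/
def consEquiv (m : ℕ) : Euc (m + 1) ≃L[ℝ] ℝ × Euc m :=
  LinearEquiv.toContinuousLinearEquiv
    { toFun := fun w => (w 0, WithLp.toLp 2 fun i => w i.succ)
      invFun := fun z => WithLp.toLp 2 (Fin.cons z.1 z.2)
      map_add' := fun _ _ => rfl
      map_smul' := fun _ _ => rfl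
      left_inv := fun w => by ext i; refine Fin.cases ?_ (fun i => ?_) i <;> simp
      right_inv := fun z => by
        refine Prod.ext (by simp) ?_
        ext i
        simp }

theorem consEquiv_apply (w : Euc (m + 1)) :
    consEquiv m w = (w 0, WithLp.toLp 2 fun i => w i.succ) := rfl

theorem consEquiv_zero : consEquiv m (bv 0) = (1, 0) := by
  rw [consEquiv_apply]
  refine Prod.ext (by simp) ?_
  ext i
  simp [Fin.succ_ne_zero]

theorem consEquiv_succ (i : Fin m) : consEquiv m (bv i.succ) = (0, bv i) := by
  rw [consEquiv_apply]
  refine Prod.ext (by simp [(Fin.succ_ne_zero i).symm]) ?_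
  ext j
  simp

theorem measurePreserving_consEquiv : MeasurePreserving (consEquiv m) := by
  have h1 := PiLp.volume_preserving_ofLp (Fin (m + 1))
  have h2 := volume_preserving_piFinSuccAbove (fun _ : Fin (m + 1) => ℝ) 0
  have h3 := (MeasurePreserving.id (volume : Measure ℝ)).prod
    (PiLp.volume_preserving_toLp (Fin m))
  exact h3.comp (h2.comp h1)

/-- The image of a hypersurface patch is a null set. -/
theorem volume_image_eq_zero {f : Euc m → Euc (m + 1)} {s : Set (Euc m)}
    (hf : ∀ y ∈ s, DifferentiableAt ℝ f y) : volume (f '' s) = 0 := by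
  set τ : Euc (m + 1) →L[ℝ] Euc m :=
    (ContinuousLinearMap.snd ℝ ℝ (Euc m)).comp (consEquiv m : Euc (m + 1) →L[ℝ] ℝ × Euc m) with hτ
  have him : f '' s = (fun w => f (τ w)) '' (τ ⁻¹' s) := by
    ext v
    constructor
    · rintro ⟨y, hy, rfl⟩
      have hy' : τ ((consEquiv m).symm (0, y)) = y := by simp [hτ]
      exact ⟨(consEquiv m).symm (0, y), by rwa [mem_preimage, hy'], by simp only [hy']⟩
    · rintro ⟨w, hw, rfl⟩
      exact ⟨τ w, hw, rfl⟩
  rw [him]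
  refine addHaar_image_eq_zero_of_det_fderivWithin_eq_zero volume
    (f' := fun w => (fderiv ℝ f (τ w)).comp τ)
    (fun w hw => ((hf _ hw).hasFDerivAt.comp w τ.hasFDerivAt).hasFDerivWithinAt) fun w _ => ?_
  by_contra hd
  have h1 : Function.Injective ((fderiv ℝ f (τ w)).comp τ) :=
    (LinearMap.equivOfDetNeZero _ hd).injective
  have h2 : ((fderiv ℝ f (τ w)).comp τ) (bv 0) = ((fderiv ℝ f (τ w)).comp τ) 0 := by
    have : τ (bv 0) = 0 := congrArg Prod.snd (consEquiv_zero (m := m))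
    simp only [ContinuousLinearMap.comp_apply, this, map_zero]
  have h3 := congrArg (fun v : Euc (m + 1) => v 0) (h1 h2)
  simp at h3

end Cons

section Null

variable {n : ℕ} {M : Type*} [TopologicalSpace M] [ChartedSpace (Euc n) M]
  [IsManifold (𝓡 n) ∞ M] [MeasurableSpace M] [BorelSpace M] [SecondCountableTopology M]

/-- A set in the domain of a chart is a null set if its image in coordinates is one. The set need
not be measurable: the image is first enlarged to a measurable null set. -/
theorem riemannianMeasure_eq_zero {β : M → Euc n →L[ℝ] Euc n →L[ℝ] ℝ} {p : M} {S : Set M}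
    (hS : S ⊆ (extChartAt (𝓡 n) p).source) (h0 : volume (extChartAt (𝓡 n) p '' S) = 0) :
    riemannianMeasure (formTensor β) S = 0 := by
  have ho := isOpen_extChartAt_source (I := 𝓡 n) p
  set Z := toMeasurable volume (extChartAt (𝓡 n) p '' S) with hZ
  have hZ0 : volume Z = 0 := by rw [hZ, measure_toMeasurable, h0]
  have h1 : Measurable (fun x : (extChartAt (𝓡 n) p).source => extChartAt (𝓡 n) p x) :=
    ((continuousOn_extChartAt p).domRestrict).measurable
  have h2 : MeasurableSet ((extChartAt (𝓡 n) p).source ∩ extChartAt (𝓡 n) p ⁻¹' Z) := by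
    have h3 := (MeasurableEmbedding.subtype_coe ho.measurableSet).measurableSet_image.2
      (h1 (measurableSet_toMeasurable volume (extChartAt (𝓡 n) p '' S)))
    convert h3 using 1
    ext x
    simp [hZ, and_comm]
  refine measure_mono_null (t := (extChartAt (𝓡 n) p).source ∩ extChartAt (𝓡 n) p ⁻¹' Z)
    (fun x hx => ⟨hS hx, subset_toMeasurable _ _ (mem_image_of_mem _ hx)⟩) ?_
  rw [riemannianMeasure_apply h2 inter_subset_left, chartMeasure_apply h2]
  refine setLIntegral_measure_zero _ _ (measure_mono_null (fun y hy => ?_) hZ0)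
  have h4 := hy.2.2
  rwa [mem_preimage, (extChartAt (𝓡 n) p).right_inv hy.1] at h4

end Null

namespace Deformation

variable {m : ℕ} {M : Type*} [TopologicalSpace M] [ChartedSpace (Euc (m + 1)) M]
  [IsManifold (𝓡 (m + 1)) ∞ M] {N : Type*} [TopologicalSpace N] [ChartedSpace (Euc m) N]
  {g : Metric (m + 1) M} (D : Deformation g N) {t : ℝ}

section Measure

variable [SecondCountableTopology M] [MeasurableSpace M] [BorelSpace M]
  [SecondCountableTopology N] [IsManifold (𝓡 m) ∞ N]

/-- The hypersurfaces are null sets of `M`: locally, they are images of differentiable maps from a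
space of smaller dimension. -/
theorem riemannianMeasure_range (ht : t ∈ Ioo (-D.ε) D.ε) :
    riemannianMeasure g.tensor (range (D.map t)) = 0 := by
  set W : N → Set N := fun x => (extChartAt (𝓡 m) x).source ∩
    D.map t ⁻¹' (extChartAt (𝓡 (m + 1)) (D.map t x)).source with hW
  obtain ⟨c, hc, hcU⟩ := TopologicalSpace.countable_cover_nhds (f := W) fun x =>
    inter_mem (extChartAt_source_mem_nhds x) ((D.mdifferentiableAt_map ht x).continuousAt
      (extChartAt_source_mem_nhds (D.map t x)))
  have h1 : range (D.map t) = ⋃ x ∈ c, D.map t '' W x := by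
    rw [← image_iUnion₂, hcU, image_univ]
  rw [h1]
  refine (measure_biUnion_null_iff hc).2 fun x _ => ?_
  refine riemannianMeasure_eq_zero (β := gAt g) (p := D.map t x)
    (image_subset_iff.2 fun y hy => hy.2) ?_
  have h2 : extChartAt (𝓡 (m + 1)) (D.map t x) '' (D.map t '' W x) =
      (fun y => D.locF x (D.map t x) (t, y)) '' (extChartAt (𝓡 m) x '' W x) := by
    rw [image_image, image_image]
    refine image_congr fun y hy => ?_
    change _ = extChartAt (𝓡 (m + 1)) (D.map t x)
      (D.map t ((extChartAt (𝓡 m) x).symm (extChartAt (𝓡 m) x y)))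
    rw [(extChartAt (𝓡 m) x).left_inv hy.1]
  rw [h2]
  refine volume_image_eq_zero ?_
  rintro _ ⟨y, hy, rfl⟩
  exact ((D.contDiffAt_locF (D.mem_locO ht hy.1 hy.2)).comp (extChartAt (𝓡 m) x y)
    (f := fun y => (t, y)) (contDiffAt_const.prodMk contDiffAt_id)).differentiableAt (by simp)

theorem Bounds.nullMeasurableSet {Ω : ℝ → Set M} (hΩ : D.Bounds Ω) (ht : t ∈ Ioo (-D.ε) D.ε) :
    NullMeasurableSet (Ω t) (riemannianMeasure g.tensor) :=
  nullMeasurableSet_of_null_frontier (by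
    rw [hΩ.frontier_eq t ht]; exact D.riemannianMeasure_range ht)

end Measure

/-- Points of the hypersurfaces near `φ_0 x₀` are images of points near `x₀`. -/
theorem eventually_mem_of_map_mem [T2Space M] (hemb : Topology.IsEmbedding (D.map 0)) {x₀ : N}
    {X : Set N} (hX : X ∈ 𝓝 x₀) :
    ∀ᶠ w : ℝ × M in 𝓝 (0, D.map 0 x₀), ∀ x, D.map w.1 x = w.2 → x ∈ X := by
  obtain ⟨K, hK, hc⟩ := D.compact_support
  obtain ⟨X', hX'X, hX'o, hxX'⟩ := mem_nhds_iff.1 hX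
  have h1 : ∀ᶠ w : ℝ × M in 𝓝 (0, D.map 0 x₀), ∀ x ∈ K \ X', D.map w.1 x ≠ w.2 := by
    refine (hK.diff hX'o).eventually_forall_of_forall_eventually fun x hx => ?_
    have h2 : D.map 0 x ≠ D.map 0 x₀ := fun h => hx.2 (hemb.injective h ▸ hxX')
    have h3 : ContinuousAt (fun z : (ℝ × M) × N => D.map z.1.1 z.2) ((0, D.map 0 x₀), x) :=
      ContinuousAt.comp (f := fun z : (ℝ × M) × N => (z.1.1, z.2))
        (g := fun p : ℝ × N => D.map p.1 p.2) (x := ((0, D.map 0 x₀), x))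
        (D.continuousAt_map D.zero_mem x) (by fun_prop)
    have h4 : ContinuousAt (fun z : (ℝ × M) × N => z.1.2) ((0, D.map 0 x₀), x) := by fun_prop
    exact (h3.prodMk h4).eventually (isOpen_ne_fun continuous_fst continuous_snd |>.mem_nhds h2)
  have h5 : ∀ᶠ w : ℝ × M in 𝓝 (0, D.map 0 x₀), ∀ x, D.map 0 x = w.2 → x ∈ X' := by
    obtain ⟨U, hU, hUX⟩ := mem_comap.1 (hemb.nhds_eq_comap x₀ ▸ hX'o.mem_nhds hxX')
    filter_upwards [continuous_snd.continuousAt.preimage_mem_nhds hU] with w hw x hx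
    exact hUX (by rw [mem_preimage, hx]; exact hw)
  filter_upwards [h1, h5, (isOpen_Ioo.preimage continuous_fst).mem_nhds
    (show ((0 : ℝ), D.map 0 x₀) ∈ _ from D.zero_mem)] with w hw1 hw2 hw3 x hx
  refine hX'X ?_
  by_contra hxX
  by_cases hxK : x ∈ K
  · exact hw1 x ⟨hxK, hxX⟩ hx
  · exact hxX (hw2 x (by rw [← hc w.1 hw3 x hxK]; exact hx))

end Deformation

end Schlaefli

end

noncomputable section

namespace Schlaefli

/-! ### The domains near a point of the hypersurface -/

/-- A preconnected set that does not meet the boundary of `A` lies on one side. -/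
theorem mem_iff_of_isPreconnected {T : Type*} [TopologicalSpace T] {A S : Set T}
    (hS : IsPreconnected S) (h : ∀ x ∈ S, x ∉ frontier A) {a b : T} (ha : a ∈ S) (hb : b ∈ S) :
    a ∈ A ↔ b ∈ A := by
  have h1 : S ⊆ interior A ∪ interior Aᶜ := by
    intro x hx
    have h2 := h x hx
    rw [frontier_eq_closure_inter_closure, mem_inter_iff, not_and_or] at h2
    rcases h2 with h2 | h2
    · right; rwa [interior_compl]
    · left; rw [← compl_compl A, interior_compl]; exact h2
  have h3 : Disjoint (interior A) (interior Aᶜ) :=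
    disjoint_compl_right.mono interior_subset interior_subset
  rcases hS.subset_or_subset isOpen_interior isOpen_interior h3 h1 with h4 | h4
  · exact iff_of_true (interior_subset (h4 ha)) (interior_subset (h4 hb))
  · exact iff_of_false (interior_subset (h4 ha)) (interior_subset (h4 hb))

/-- A predicate that is locally constant on an interval is constant. -/
theorem iff_of_locally_constant {P : ℝ → Prop} {a b : ℝ}
    (h : ∀ t ∈ Ioo a b, ∀ᶠ s in 𝓝 t, (P s ↔ P t)) {s t : ℝ} (hs : s ∈ Ioo a b) (ht : t ∈ Ioo a b) :
    P s ↔ P t := by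
  classical
  have h1 : ContinuousOn (fun t => decide (P t)) (Ioo a b) := by
    intro t ht
    refine ContinuousAt.continuousWithinAt ?_
    refine (continuousAt_const (y := decide (P t))).congr ?_
    filter_upwards [h t ht] with s hs
    rw [decide_eq_decide, hs]
  exact decide_eq_decide.1 (isPreconnected_Ioo.constant h1 hs ht)

/-- Consider sets `Ω t` of a space with coordinates `(z, y)`, `|z| < η`, `‖y - y₀‖ < r`. If their
boundaries are contained in the graphs of the functions `h t`, and if points that are not on the
graphs neither enter nor leave the sets, then the sets are the regions below the graphs as soon as
this holds near one point at time `0`. -/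
theorem side_of_graph {m : ℕ} {T : Type*} [TopologicalSpace T] {Ω : ℝ → Set T}
    {Ψ : ℝ × Euc m → T} {h : ℝ → Euc m → ℝ} {y₀ : Euc m} {r η δ : ℝ} (hr : 0 < r) (hη : 0 < η)
    (hδp : 0 < δ) (hcont : ContinuousOn Ψ (Ioo (-η) η ×ˢ Metric.ball y₀ r))
    (habs : ∀ t ∈ Ioo (-δ) δ, ∀ y ∈ Metric.ball y₀ r, |h t y| < η / 2) (h0 : h 0 y₀ = 0)
    (hfr : ∀ t ∈ Ioo (-δ) δ, ∀ w ∈ Ioo (-η) η ×ˢ Metric.ball y₀ r, w.1 ≠ h t w.2 →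
      Ψ w ∉ frontier (Ω t))
    (hloc : ∀ t ∈ Ioo (-δ) δ, ∀ w ∈ Ioo (-η) η ×ˢ Metric.ball y₀ r, w.1 ≠ h t w.2 →
      ∀ᶠ s in 𝓝 t, (Ψ w ∈ Ω s ↔ Ψ w ∈ Ω t))
    (hext : ∀ᶠ s in 𝓝[>] (0 : ℝ), Ψ (s, y₀) ∉ Ω 0 ∧ Ψ (-s, y₀) ∈ Ω 0) :
    ∀ t ∈ Ioo (-δ) δ, ∀ w ∈ Ioo (-η) η ×ˢ Metric.ball y₀ r,
      (w.1 < h t w.2 → Ψ w ∈ Ω t) ∧ (h t w.2 < w.1 → Ψ w ∉ Ω t) := by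
  have hconn : ∀ t ∈ Ioo (-δ) δ, ∀ A ⊆ Ioo (-η) η ×ˢ Metric.ball y₀ r, IsPreconnected A →
      (∀ w ∈ A, w.1 ≠ h t w.2) → ∀ a ∈ A, ∀ b ∈ A,
      (Ψ a ∈ Ω t ↔ Ψ b ∈ Ω t) := by
    intro t ht A hA hAp hne a ha b hb
    refine mem_iff_of_isPreconnected (hAp.image _ (hcont.mono hA)) ?_ (mem_image_of_mem _ ha)
      (mem_image_of_mem _ hb)
    rintro _ ⟨w, hw, rfl⟩
    exact hfr t ht w (hA hw) (hne w hw)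
  have hball : IsPreconnected (Metric.ball y₀ r) := (convex_ball y₀ r).isPreconnected
  have hy₀r : y₀ ∈ Metric.ball y₀ r := Metric.mem_ball_self hr
  have h0δ : (0 : ℝ) ∈ Ioo (-δ) δ := ⟨neg_lt_zero.2 hδp, hδp⟩
  -- Any two points on the same side of the graph are joined through the level `±3η/4`.
  have hlow : ∀ t ∈ Ioo (-δ) δ, ∀ w ∈ Ioo (-η) η ×ˢ Metric.ball y₀ r, w.1 < h t w.2 →
      (Ψ w ∈ Ω t ↔ Ψ (-(3 / 4 * η), y₀) ∈ Ω t) := by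
    intro t ht w hw hwl
    have hb := fun y hy => abs_lt.1 (habs t ht y hy)
    have h1 := hconn t ht (Ioo (-η) (h t w.2) ×ˢ {w.2})
      (fun v hv => ⟨⟨hv.1.1, by linarith [hv.1.2, (hb w.2 hw.2).2]⟩,
        (mem_singleton_iff.1 hv.2) ▸ hw.2⟩)
      (isPreconnected_Ioo.prod isPreconnected_singleton)
      (fun v hv => by rw [mem_singleton_iff.1 hv.2]; exact hv.1.2.ne)
      w ⟨⟨hw.1.1, hwl⟩, rfl⟩ (-(3 / 4 * η), w.2)
      ⟨⟨by simp only; linarith, by linarith [(hb w.2 hw.2).1]⟩, rfl⟩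
    have h2 := hconn t ht ({-(3 / 4 * η)} ×ˢ Metric.ball y₀ r)
      (fun v hv => ⟨by rw [mem_singleton_iff.1 hv.1]; constructor <;> linarith, hv.2⟩)
      (isPreconnected_singleton.prod hball)
      (fun v hv => by rw [mem_singleton_iff.1 hv.1]; linarith [(hb v.2 hv.2).1])
      (-(3 / 4 * η), w.2) ⟨rfl, hw.2⟩ (-(3 / 4 * η), y₀) ⟨rfl, hy₀r⟩
    exact h1.trans h2
  have hupp : ∀ t ∈ Ioo (-δ) δ, ∀ w ∈ Ioo (-η) η ×ˢ Metric.ball y₀ r, h t w.2 < w.1 →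
      (Ψ w ∈ Ω t ↔ Ψ (3 / 4 * η, y₀) ∈ Ω t) := by
    intro t ht w hw hwl
    have hb := fun y hy => abs_lt.1 (habs t ht y hy)
    have h1 := hconn t ht (Ioo (h t w.2) η ×ˢ {w.2})
      (fun v hv => ⟨⟨by linarith [hv.1.1, (hb w.2 hw.2).1], hv.1.2⟩,
        (mem_singleton_iff.1 hv.2) ▸ hw.2⟩)
      (isPreconnected_Ioo.prod isPreconnected_singleton)
      (fun v hv => by rw [mem_singleton_iff.1 hv.2]; exact hv.1.1.ne')
      w ⟨⟨hwl, hw.1.2⟩, rfl⟩ (3 / 4 * η, w.2)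
      ⟨⟨by linarith [(hb w.2 hw.2).2], by simp only; linarith⟩, rfl⟩
    have h2 := hconn t ht ({3 / 4 * η} ×ˢ Metric.ball y₀ r)
      (fun v hv => ⟨by rw [mem_singleton_iff.1 hv.1]; constructor <;> linarith, hv.2⟩)
      (isPreconnected_singleton.prod hball)
      (fun v hv => by rw [mem_singleton_iff.1 hv.1]; linarith [(hb v.2 hv.2).2])
      (3 / 4 * η, w.2) ⟨rfl, hw.2⟩ (3 / 4 * η, y₀) ⟨rfl, hy₀r⟩
    exact h1.trans h2
  -- The reference points do not change sides.
  have htime : ∀ w ∈ Ioo (-η) η ×ˢ Metric.ball y₀ r, η / 2 ≤ |w.1| → ∀ t ∈ Ioo (-δ) δ,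
      (Ψ w ∈ Ω t ↔ Ψ w ∈ Ω 0) := by
    intro w hw hwη t ht
    refine iff_of_locally_constant (P := fun t => Ψ w ∈ Ω t) (fun t ht => ?_) ht h0δ
    refine hloc t ht w hw fun he => ?_
    have := habs t ht w.2 hw.2
    rw [← he] at this
    linarith
  -- At time `0`, the sides are given by the exterior normal.
  have hext' : Ψ (3 / 4 * η, y₀) ∉ Ω 0 ∧ Ψ (-(3 / 4 * η), y₀) ∈ Ω 0 := by
    obtain ⟨s, ⟨hs1, hs2⟩, hs0, hsη⟩ := (hext.and (Ioo_mem_nhdsGT hη)).exists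
    constructor
    · rw [← hupp 0 h0δ (s, y₀) ⟨⟨by simp only; linarith, hsη⟩, hy₀r⟩ (by rw [h0]; exact hs0)]
      exact hs1
    · rw [← hlow 0 h0δ (-s, y₀) ⟨⟨by simp only; linarith, by simp only; linarith⟩, hy₀r⟩
        (by rw [h0]; simpa using hs0)]
      exact hs2
  have hm₁ : (-(3 / 4 * η), y₀) ∈ Ioo (-η) η ×ˢ Metric.ball y₀ r :=
    ⟨⟨by simp only; linarith, by simp only; linarith⟩, hy₀r⟩
  have hm₂ : (3 / 4 * η, y₀) ∈ Ioo (-η) η ×ˢ Metric.ball y₀ r :=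
    ⟨⟨by simp only; linarith, by simp only; linarith⟩, hy₀r⟩
  intro t ht w hw
  constructor
  · intro hwl
    rw [hlow t ht w hw hwl, htime (-(3 / 4 * η), y₀) hm₁
      (by simp only; rw [abs_neg, abs_of_pos (by linarith)]; linarith) t ht]
    exact hext'.2
  · intro hwl
    rw [hupp t ht w hw hwl, htime (3 / 4 * η, y₀) hm₂
      (by simp only; rw [abs_of_pos (by linarith)]; linarith) t ht]
    exact hext'.1

namespace Deformation

variable {m : ℕ} {M : Type*} [TopologicalSpace M] [ChartedSpace (Euc (m + 1)) M]
  [IsManifold (𝓡 (m + 1)) ∞ M] {N : Type*} [TopologicalSpace N] [ChartedSpace (Euc m) N]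
  {g : Metric (m + 1) M} (D : Deformation g N) {t : ℝ} {q : N} {p : M} {z : ℝ × Euc m} {x₀ : N}

theorem orth_locF [IsManifold (𝓡 m) ∞ N] (hz : z ∈ D.locO q p) (v : Euc m) :
    gB g p (D.locF q p z) (fderiv ℝ (D.locF q p) z (0, v)) (D.locY q p z) = 0 := by
  rw [D.fderiv_locF_right hz]
  exact (D.gB_locF hz _ _).trans ((gAt_symm g _ _ _).trans (D.normal_orthogonal z.1 hz.1 _ _))

theorem locY_self (x₀ : N) :
    D.locY x₀ (D.map 0 x₀) (0, extChartAt (𝓡 m) x₀ x₀) = D.nor 0 x₀ := by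
  rw [D.locY_apply (mem_extChartAt_source (I := 𝓡 m) x₀), dc_self]
  rfl

theorem self_mem_locO (x₀ : N) : ((0 : ℝ), extChartAt (𝓡 m) x₀ x₀) ∈ D.locO x₀ (D.map 0 x₀) :=
  D.mem_locO D.zero_mem (mem_extChartAt_source x₀) (mem_extChartAt_source (D.map 0 x₀))

/-- The coordinates `(z, y)` near `φ_0 x₀`: `z` is the height above the point of `φ_0` with
coordinate `y`, in the direction of the normal at `φ_0 x₀`, measured in the preferred chart. -/
def tube (x₀ : N) (w : ℝ × Euc m) : Euc (m + 1) :=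
  D.locF x₀ (D.map 0 x₀) (0, w.2) + w.1 • D.nor 0 x₀

/-- The point with coordinates `(z, y)`. -/
def tubePt (x₀ : N) (w : ℝ × Euc m) : M :=
  (extChartAt (𝓡 (m + 1)) (D.map 0 x₀)).symm (D.tube x₀ w)

theorem locF_self (x₀ : N) : D.locF x₀ (D.map 0 x₀) (0, extChartAt (𝓡 m) x₀ x₀) =
    extChartAt (𝓡 (m + 1)) (D.map 0 x₀) (D.map 0 x₀) := by
  change extChartAt (𝓡 (m + 1)) (D.map 0 x₀)
    (D.map 0 ((extChartAt (𝓡 m) x₀).symm (extChartAt (𝓡 m) x₀ x₀))) = _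
  rw [(extChartAt (𝓡 m) x₀).left_inv (mem_extChartAt_source x₀)]

theorem locF_apply {x : N} (hx : x ∈ (extChartAt (𝓡 m) q).source) :
    D.locF q p (t, extChartAt (𝓡 m) q x) = extChartAt (𝓡 (m + 1)) p (D.map t x) := by
  change extChartAt (𝓡 (m + 1)) p
    (D.map t ((extChartAt (𝓡 m) q).symm (extChartAt (𝓡 m) q x))) = _
  rw [(extChartAt (𝓡 m) q).left_inv hx]

/-- Coordinates near `φ_0 x₀` in which the hypersurfaces are graphs, the domains `Ω t` are the
regions below these graphs, and the vertical direction is on the exterior side of `φ_0`. -/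
structure IsBox (Ω : ℝ → Set M) (x₀ : N) (h : ℝ → Euc m → ℝ) (h' : Euc m → ℝ) (r η : ℝ)
    (X : Set (Euc m)) : Prop where
  isGraph : IsGraph (D.locF x₀ (D.map 0 x₀)) (D.nor 0 x₀) (extChartAt (𝓡 m) x₀ x₀) h h' r η X
  mem_target : ∀ w ∈ Ioo (-η) η ×ˢ Metric.ball (extChartAt (𝓡 m) x₀ x₀) r,
    D.tube x₀ w ∈ (extChartAt (𝓡 (m + 1)) (D.map 0 x₀)).target
  mem_locO : ∀ y ∈ Metric.ball (extChartAt (𝓡 m) x₀ x₀) r, ((0 : ℝ), y) ∈ D.locO x₀ (D.map 0 x₀)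
  inner_pos : ∀ y ∈ Metric.ball (extChartAt (𝓡 m) x₀ x₀) r,
    0 < gB g (D.map 0 x₀) (D.locF x₀ (D.map 0 x₀) (0, y)) (D.nor 0 x₀)
      (D.locY x₀ (D.map 0 x₀) (0, y))
  side : ∀ᶠ t in 𝓝 (0 : ℝ), ∀ w ∈ Ioo (-η) η ×ˢ Metric.ball (extChartAt (𝓡 m) x₀ x₀) r,
    (w.1 < h t w.2 → D.tubePt x₀ w ∈ Ω t) ∧ (h t w.2 < w.1 → D.tubePt x₀ w ∉ Ω t)
  eq_of_eq : ∀ w ∈ Ioo (-η) η ×ˢ Metric.ball (extChartAt (𝓡 m) x₀ x₀) r, ∀ x,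
    D.map 0 x = D.tubePt x₀ w → x ∈ (extChartAt (𝓡 m) x₀).source ∧ w = (0, extChartAt (𝓡 m) x₀ x)

/-- Near a point of `φ_0`, the hypersurfaces are graphs by the inverse function theorem, and the
domains lie below the graphs, since they do so at time `0` with respect to the exterior normal. As
`φ_0` is an embedding, and the deformation is constant outside of a compact set, no other part of
the hypersurfaces enters the coordinate domain for small times. -/
theorem Bounds.exists_isBox [IsManifold (𝓡 m) ∞ N] [T2Space M] [MeasurableSpace M]
    {Ω : ℝ → Set M} (hΩ : D.Bounds Ω) (x₀ : N) : ∃ h h' r η X, D.IsBox Ω x₀ h h' r η X := by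
  set p₀ := D.map 0 x₀ with hp₀
  set y₀ := extChartAt (𝓡 m) x₀ x₀ with hy₀
  set F := D.locF x₀ p₀ with hF
  set u := D.nor 0 x₀ with hu
  have hz₀ : ((0 : ℝ), y₀) ∈ D.locO x₀ p₀ := D.self_mem_locO x₀
  have hYu : D.locY x₀ p₀ (0, y₀) = u := D.locY_self x₀
  have hFam := D.hypFamily x₀ p₀
  have hframe := hFam.frame _ hz₀
  have hpt : p₀ ∈ (extChartAt (𝓡 (m + 1)) p₀).source := mem_extChartAt_source p₀
  have hF0 : F (0, y₀) = extChartAt (𝓡 (m + 1)) p₀ p₀ := D.locF_self x₀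
  obtain ⟨X, hX, hgr⟩ := exists_isGraph (F := F) (u := u) (D.isOpen_locO x₀ p₀) hz₀
    (fun z hz => D.contDiffAt_locF hz) (fun v a hv => by
      have h1 := D.orth_locF hz₀ v
      have ha : a = 0 := by
        rw [hv, map_smul, smul_apply, ← hYu, hframe.unit] at h1
        simpa using h1
      refine ⟨?_, ha⟩
      rw [ha, zero_smul, D.fderiv_locF_right hz₀] at hv
      have h2 : Function.Injective (mder (n := m + 1) (D.map 0)
        ((extChartAt (𝓡 m) x₀).symm y₀)) := D.immersion 0 D.zero_mem _
      exact dcs_injective hz₀.2.1 (h2 (dc_injective hz₀.2.2 (by simpa using hv))))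
  -- Points of the hypersurfaces close to `p₀` have a coordinate in `X`.
  have hX' : extChartAt (𝓡 m) x₀ ⁻¹' X ∩ (extChartAt (𝓡 m) x₀).source ∈ 𝓝 x₀ :=
    inter_mem ((continuousAt_extChartAt x₀).preimage_mem_nhds hX) (extChartAt_source_mem_nhds x₀)
  obtain ⟨I, hI, U, hU, hIU⟩ := mem_nhds_prod_iff.1
    (D.eventually_mem_of_map_mem (hΩ.isEmbedding 0 D.zero_mem) hX')
  obtain ⟨δ₀, hδ₀, hδI⟩ := Metric.mem_nhds_iff.1 hI
  have htube : ContinuousAt (D.tube x₀) (0, y₀) := by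
    have h1 : ContinuousAt (fun w : ℝ × Euc m => F (0, w.2)) (0, y₀) :=
      ContinuousAt.comp (f := fun w : ℝ × Euc m => ((0 : ℝ), w.2)) (g := F) (x := (0, y₀))
        (D.contDiffAt_locF hz₀).continuousAt (by fun_prop)
    exact h1.add (continuousAt_fst.smul continuousAt_const)
  have htube0 : D.tube x₀ (0, y₀) = extChartAt (𝓡 (m + 1)) p₀ p₀ := by
    simp only [tube, zero_smul, add_zero]; exact hF0
  have hV1 : ∀ᶠ w in 𝓝 ((0 : ℝ), y₀), D.tube x₀ w ∈ (extChartAt (𝓡 (m + 1)) p₀).target :=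
    htube.preimage_mem_nhds (by rw [htube0]; exact extChartAt_target_mem_nhds p₀)
  have hV2 : ∀ᶠ w in 𝓝 ((0 : ℝ), y₀), D.tubePt x₀ w ∈ U := by
    have h1 : ContinuousAt (D.tubePt x₀) (0, y₀) :=
      ContinuousAt.comp (f := D.tube x₀) (g := (extChartAt (𝓡 (m + 1)) p₀).symm)
        (by rw [htube0]; exact continuousAt_extChartAt_symm p₀) htube
    refine h1.preimage_mem_nhds ?_
    have : D.tubePt x₀ (0, y₀) = p₀ := by
      rw [tubePt, htube0]; exact (extChartAt (𝓡 (m + 1)) p₀).left_inv hpt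
    rw [this]; exact hU
  have hV3 : ∀ᶠ w : ℝ × Euc m in 𝓝 ((0 : ℝ), y₀),
      0 < gB g p₀ (F (0, w.2)) u (D.locY x₀ p₀ (0, w.2)) := by
    have h1 := (hFam.contDiffAt_inner hz₀ (contDiffAt_const (c := u))
      (D.contDiffAt_locY hz₀)).continuousAt
    have h2 : ContinuousAt (fun w : ℝ × Euc m =>
        gB g p₀ (F (0, w.2)) u (D.locY x₀ p₀ (0, w.2))) (0, y₀) :=
      ContinuousAt.comp (f := fun w : ℝ × Euc m => ((0 : ℝ), w.2))
        (g := fun z => gB g p₀ (F z) u (D.locY x₀ p₀ z)) (x := (0, y₀)) h1 (by fun_prop)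
    refine h2.eventually (lt_mem_nhds ?_)
    have := hframe.unit
    rw [hYu] at this
    change 0 < gB g p₀ (F (0, y₀)) u (D.locY x₀ p₀ (0, y₀))
    rw [hYu, this]
    exact one_pos
  obtain ⟨h, h', r, η, hG, hbox, hO⟩ := hgr _ (inter_mem (inter_mem hV1 hV2) hV3)
  have hη := hG.η_pos
  have hr := hG.r_pos
  have hO0 : ∀ y ∈ Metric.ball y₀ r, ((0 : ℝ), y) ∈ D.locO x₀ p₀ := fun y hy =>
    hO ⟨hG.zero_mem, hy⟩
  -- The graph coordinate of the points of the hypersurfaces.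
  have hmem : ∀ t, t ∈ Ioo (-r) r → |t| < δ₀ → ∀ w ∈ Ioo (-η) η ×ˢ Metric.ball y₀ r, ∀ x,
      D.map t x = D.tubePt x₀ w → x ∈ (extChartAt (𝓡 m) x₀).source ∧ w.1 = h t w.2 ∧
        (t = 0 → extChartAt (𝓡 m) x₀ x = w.2) := by
    intro t ht htδ w hw x hx
    obtain ⟨⟨hw1, hw2⟩, -⟩ := hbox hw
    have h1 : (t, D.tubePt x₀ w) ∈ I ×ˢ U :=
      ⟨hδI (by rwa [mem_ball_zero_iff, Real.norm_eq_abs]), hw2⟩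
    obtain ⟨hxX, hxs⟩ := hIU h1 x hx
    refine ⟨hxs, hG.eq_of_eq t ht _ hxX w.1 hw.1 w.2 hw.2 ?_⟩
    rw [hF, D.locF_apply hxs, hx]
    exact (extChartAt (𝓡 (m + 1)) p₀).right_inv hw1
  refine ⟨h, h', r, η, X, hG, fun w hw => (hbox hw).1.1, hO0,
    fun y hy => (hbox (show ((0 : ℝ), y) ∈ Ioo (-η) η ×ˢ Metric.ball y₀ r from
      ⟨⟨by simpa using hη, hη⟩, hy⟩)).2, ?_, ?_⟩
  · set δ := min r δ₀ with hδ
    have hδp : 0 < δ := lt_min hr hδ₀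
    have hδr : ∀ t ∈ Ioo (-δ) δ, t ∈ Ioo (-r) r ∧ |t| < δ₀ := fun t ht => by
      have h1 := abs_lt.2 ht
      exact ⟨abs_lt.1 (h1.trans_le (min_le_left _ _)), h1.trans_le (min_le_right _ _)⟩
    have hδε : ∀ t ∈ Ioo (-δ) δ, t ∈ Ioo (-D.ε) D.ε := fun t ht =>
      (hO (show (t, y₀) ∈ _ from ⟨(hδr t ht).1, Metric.mem_ball_self hr⟩)).1
    have hfr : ∀ t ∈ Ioo (-δ) δ, ∀ w ∈ Ioo (-η) η ×ˢ Metric.ball y₀ r, w.1 ≠ h t w.2 →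
        D.tubePt x₀ w ∉ frontier (Ω t) := by
      rintro t ht w hw hne hfw
      rw [hΩ.frontier_eq t (hδε t ht)] at hfw
      obtain ⟨x, hx⟩ := hfw
      exact hne (hmem t (hδr t ht).1 (hδr t ht).2 w hw x hx).2.1
    have hcont : ContinuousOn (D.tubePt x₀) (Ioo (-η) η ×ˢ Metric.ball y₀ r) := by
      intro w hw
      have h1 : ContinuousAt (D.tube x₀) w := by
        have h1 : ContinuousAt (fun w : ℝ × Euc m => F (0, w.2)) w :=
          ContinuousAt.comp (f := fun w : ℝ × Euc m => ((0 : ℝ), w.2)) (g := F)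
            (D.contDiffAt_locF (hO0 _ hw.2)).continuousAt (by fun_prop)
        exact h1.add (continuousAt_fst.smul continuousAt_const)
      exact (ContinuousAt.comp (f := D.tube x₀) (g := (extChartAt (𝓡 (m + 1)) p₀).symm)
        (continuousAt_extChartAt_symm'' (hbox hw).1.1) h1).continuousWithinAt
    have hside := side_of_graph (Ω := Ω) (h := h) hr hη hδp hcont
      (fun t ht => hG.abs_lt t (hδr t ht).1) (hG.apply_zero y₀ (Metric.mem_ball_self hr)) hfr
      (fun t ht w hw hne => hΩ.locally_constant t (hδε t ht) _ (by
        rw [← hΩ.frontier_eq t (hδε t ht)]; exact hfr t ht w hw hne)) (by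
        filter_upwards [hΩ.exterior_normal 0 D.zero_mem x₀] with s hs
        have e1 : D.tubePt x₀ (s, y₀) = (extChartAt (𝓡 (m + 1)) p₀).symm
            (extChartAt (𝓡 (m + 1)) p₀ p₀ + s • u) := by rw [← hF0]; rfl
        have e2 : D.tubePt x₀ (-s, y₀) = (extChartAt (𝓡 (m + 1)) p₀).symm
            (extChartAt (𝓡 (m + 1)) p₀ p₀ - s • u) := by
          rw [← hF0, sub_eq_add_neg, ← neg_smul]; rfl
        rw [e1, e2]
        exact hs)
    exact Filter.eventually_of_mem (isOpen_Ioo.mem_nhds ⟨neg_lt_zero.2 hδp, hδp⟩) hside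
  · intro w hw x hx
    obtain ⟨h1, h2, h3⟩ := hmem 0 hG.zero_mem (by simpa using hδ₀) w hw x hx
    rw [hG.apply_zero _ hw.2] at h2
    exact ⟨h1, Prod.ext h2 (h3 rfl).symm⟩

end Deformation

end Schlaefli

end

noncomputable section

namespace Schlaefli

/-! ### The volume near a point of the hypersurface -/

theorem continuousOn_density_metric {n : ℕ} {M : Type*} [TopologicalSpace M]
    [ChartedSpace (Euc n) M] [IsManifold (𝓡 n) ∞ M] (g : Metric n M) (p : M) :
    ContinuousOn (density (gAt g) p) (extChartAt (𝓡 n) p).target := by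
  have h1 : Continuous fun β : Euc n →L[ℝ] Euc n →L[ℝ] ℝ => √(compMat β).det := by
    refine Real.continuous_sqrt.comp (Continuous.matrix_det (continuous_matrix fun i j => ?_))
    change Continuous fun β : Euc n →L[ℝ] Euc n →L[ℝ] ℝ => β (bv i) (bv j)
    fun_prop
  exact h1.comp_continuousOn (contDiffOn_gB g p).continuousOn

theorem compMat_bilinearComp_eq_gramOf {n : ℕ} (β : Euc n →L[ℝ] Euc n →L[ℝ] ℝ)
    {A : Euc n →L[ℝ] Euc n} {e : Fin n → Euc n} (h : ∀ i, A (bv i) = e i) :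
    compMat (β.bilinearComp A A) = gramOf β e := by
  ext i j
  change β (A (bv i)) (A (bv j)) = β (e i) (e j)
  rw [h, h]

/-- Extension by zero of a function that is continuous on an open set and vanishes outside of a
compact subset. -/
theorem continuous_indicator_of_isCompact {T : Type*} [TopologicalSpace T] [T2Space T]
    {B C : Set T} {f : T → ℝ} (hB : IsOpen B) (hf : ContinuousOn f B) (hC : IsCompact C)
    (h0 : ∀ x ∈ B, x ∉ C → f x = 0) (hCB : C ⊆ B) :
    Continuous (B.indicator f) ∧ HasCompactSupport (B.indicator f) := by
  have h1 : ∀ x ∉ C, B.indicator f x = 0 := by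
    intro x hx
    by_cases hxB : x ∈ B
    · rw [indicator_of_mem hxB, h0 x hxB hx]
    · rw [indicator_of_notMem hxB]
  refine ⟨continuous_iff_continuousAt.2 fun x => ?_, HasCompactSupport.intro hC h1⟩
  by_cases hx : x ∈ B
  · refine (hf.continuousAt (hB.mem_nhds hx)).congr ?_
    filter_upwards [hB.mem_nhds hx] with y hy
    rw [indicator_of_mem hy]
  · refine (continuousAt_const (y := (0 : ℝ))).congr ?_
    filter_upwards [hC.isClosed.isOpen_compl.mem_nhds fun h => hx (hCB h)] with y hy
    rw [h1 y hy]

namespace Deformation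

variable {m : ℕ} {M : Type*} [TopologicalSpace M] [ChartedSpace (Euc (m + 1)) M]
  [IsManifold (𝓡 (m + 1)) ∞ M] {N : Type*} [TopologicalSpace N] [ChartedSpace (Euc m) N]
  {g : Metric (m + 1) M} (D : Deformation g N) {t : ℝ} {q : N} {p : M} {z : ℝ × Euc m} {x₀ : N}
  {y : Euc m}

/-- The derivative of `tube`, with the domain identified to the `(m + 1)`-dimensional space. -/
def tubeDer (x₀ : N) (y : Euc m) : Euc (m + 1) →L[ℝ] Euc (m + 1) :=
  (((fderiv ℝ (D.locF x₀ (D.map 0 x₀)) (0, y)).comp ((ContinuousLinearMap.inr ℝ ℝ (Euc m)).comp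
    (ContinuousLinearMap.snd ℝ ℝ (Euc m)))) +
    (ContinuousLinearMap.fst ℝ ℝ (Euc m)).smulRight (D.nor 0 x₀)).comp
      (consEquiv m : Euc (m + 1) →L[ℝ] ℝ × Euc m)

theorem tubeDer_bv (x₀ : N) (y : Euc m) (i : Fin (m + 1)) : D.tubeDer x₀ y (bv i) =
    (Fin.cons (D.nor 0 x₀) (tang (D.locF x₀ (D.map 0 x₀)) locX (0, y)) :
      Fin (m + 1) → Euc (m + 1)) i := by
  have h1 : ∀ w, D.tubeDer x₀ y w = fderiv ℝ (D.locF x₀ (D.map 0 x₀)) (0, y)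
    (0, (consEquiv m w).2) + (consEquiv m w).1 • D.nor 0 x₀ := fun _ => rfl
  rw [h1]
  refine Fin.cases ?_ (fun i => ?_) i
  · rw [consEquiv_zero, Fin.cons_zero]
    simp only [one_smul, Prod.mk_zero_zero, map_zero, zero_add]
  · rw [consEquiv_succ, Fin.cons_succ]
    simp only [zero_smul, add_zero]
    rfl

theorem hasFDerivAt_tube [IsManifold (𝓡 m) ∞ N] {w : Euc (m + 1)}
    (hw : ((0 : ℝ), (consEquiv m w).2) ∈ D.locO x₀ (D.map 0 x₀)) :
    HasFDerivAt (fun w => D.tube x₀ (consEquiv m w)) (D.tubeDer x₀ (consEquiv m w).2) w := by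
  have h1 := ((D.contDiffAt_locF hw).differentiableAt (by simp)).hasFDerivAt
  have h2 : HasFDerivAt (fun v : ℝ × Euc m => ((0 : ℝ), v.2)) ((ContinuousLinearMap.inr ℝ ℝ
      (Euc m)).comp (ContinuousLinearMap.snd ℝ ℝ (Euc m))) (consEquiv m w) :=
    ((ContinuousLinearMap.inr ℝ ℝ (Euc m)).comp (ContinuousLinearMap.snd ℝ ℝ (Euc m))).hasFDerivAt
  have h3 := (HasFDerivAt.comp (consEquiv m w) h1 h2).add
    ((hasFDerivAt_fst (𝕜 := ℝ) (p := consEquiv m w)).smul_const (D.nor 0 x₀))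
  exact HasFDerivAt.comp (g := D.tube x₀) w h3 (consEquiv m).hasFDerivAt

/-- The volume element of `M` in the coordinates `(z, y)`. -/
def tubeDensity (x₀ : N) (w : ℝ × Euc m) : ℝ :=
  |(D.tubeDer x₀ w.2).det| * density (gAt g) (D.map 0 x₀) (D.tube x₀ w)

/-- On the hypersurface, the volume element is the product of the area element and of the normal
component of the vertical direction. -/
theorem tubeDensity_zero [IsManifold (𝓡 m) ∞ N] (hy : ((0 : ℝ), y) ∈ D.locO x₀ (D.map 0 x₀)) :
    D.tubeDensity x₀ (0, y) = |gB g (D.map 0 x₀) (D.locF x₀ (D.map 0 x₀) (0, y)) (D.nor 0 x₀)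
      (D.locY x₀ (D.map 0 x₀) (0, y))| * D.locArea x₀ (D.map 0 x₀) y := by
  have h1 : D.tube x₀ (0, y) = D.locF x₀ (D.map 0 x₀) (0, y) := by simp [tube]
  have h2 := sqrt_det_conj (gB g (D.map 0 x₀) (D.locF x₀ (D.map 0 x₀) (0, y))) (D.tubeDer x₀ y)
  have h3 : compMat ((gB g (D.map 0 x₀) (D.locF x₀ (D.map 0 x₀) (0, y))).bilinearComp
      (D.tubeDer x₀ y) (D.tubeDer x₀ y)) = _ :=
    compMat_bilinearComp_eq_gramOf _ (D.tubeDer_bv x₀ y)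
  rw [h3, ((D.hypFamily x₀ (D.map 0 x₀)).frame _ hy).det_cons, Real.sqrt_mul (sq_nonneg _),
    Real.sqrt_sq_eq_abs] at h2
  rw [tubeDensity, h1]
  exact h2.symm

namespace IsBox

variable {D} {Ω : ℝ → Set M} {h : ℝ → Euc m → ℝ} {h' : Euc m → ℝ} {r η : ℝ} {X : Set (Euc m)}

theorem image_tubePt (hB : D.IsBox Ω x₀ h h' r η X) {W : Set (ℝ × Euc m)}
    (hW : W ⊆ Ioo (-η) η ×ˢ Metric.ball (extChartAt (𝓡 m) x₀ x₀) r) : D.tubePt x₀ '' W =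
      (extChartAt (𝓡 (m + 1)) (D.map 0 x₀)).source ∩
        extChartAt (𝓡 (m + 1)) (D.map 0 x₀) ⁻¹' (D.tube x₀ '' W) := by
  ext x
  constructor
  · rintro ⟨w, hw, rfl⟩
    have h1 := hB.mem_target w (hW hw)
    exact ⟨(extChartAt (𝓡 (m + 1)) (D.map 0 x₀)).map_target h1, w, hw,
      ((extChartAt (𝓡 (m + 1)) (D.map 0 x₀)).right_inv h1).symm⟩
  · rintro ⟨hx, w, hw, hwx⟩
    exact ⟨w, hw, by rw [tubePt, hwx, (extChartAt (𝓡 (m + 1)) (D.map 0 x₀)).left_inv hx]⟩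

theorem injOn_tubePt (hB : D.IsBox Ω x₀ h h' r η X) : InjOn (D.tubePt x₀)
    (Ioo (-η) η ×ˢ Metric.ball (extChartAt (𝓡 m) x₀ x₀) r) := fun v hv w hw hvw =>
  hB.isGraph.injOn hv hw ((extChartAt (𝓡 (m + 1)) (D.map 0 x₀)).symm.injOn (hB.mem_target v hv)
    (hB.mem_target w hw) hvw)

theorem isOpen_image_tubePt (hB : D.IsBox Ω x₀ h h' r η X) {W : Set (ℝ × Euc m)}
    (hW : W ⊆ Ioo (-η) η ×ˢ Metric.ball (extChartAt (𝓡 m) x₀ x₀) r) (hWo : IsOpen W) :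
    IsOpen (D.tubePt x₀ '' W) := by
  rw [hB.image_tubePt hW]
  exact (continuousOn_extChartAt (D.map 0 x₀)).isOpen_inter_preimage
    (isOpen_extChartAt_source _) (hB.isGraph.isOpen_image W hW hWo)

variable [IsManifold (𝓡 m) ∞ N]

theorem continuousOn_tube (hB : D.IsBox Ω x₀ h h' r η X) : ContinuousOn (D.tube x₀)
    (Ioo (-η) η ×ˢ Metric.ball (extChartAt (𝓡 m) x₀ x₀) r) := by
  intro w hw
  have h1 : ContinuousAt (fun w : ℝ × Euc m => D.locF x₀ (D.map 0 x₀) (0, w.2)) w :=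
    ContinuousAt.comp (f := fun w : ℝ × Euc m => ((0 : ℝ), w.2)) (g := D.locF x₀ (D.map 0 x₀))
      (D.contDiffAt_locF (hB.mem_locO _ hw.2)).continuousAt (by fun_prop)
  exact (h1.add (continuousAt_fst.smul continuousAt_const)).continuousWithinAt

theorem continuousOn_tubeDensity (hB : D.IsBox Ω x₀ h h' r η X) : ContinuousOn (D.tubeDensity x₀)
    (Ioo (-η) η ×ˢ Metric.ball (extChartAt (𝓡 m) x₀ x₀) r) := by
  refine ContinuousOn.mul ?_ ((continuousOn_density_metric g (D.map 0 x₀)).comp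
    hB.continuousOn_tube hB.mem_target)
  intro w hw
  have h1 : ContinuousAt (fun w : ℝ × Euc m =>
      fderiv ℝ (D.locF x₀ (D.map 0 x₀)) (0, w.2)) w :=
    ContinuousAt.comp (f := fun w : ℝ × Euc m => ((0 : ℝ), w.2))
      (g := fderiv ℝ (D.locF x₀ (D.map 0 x₀)))
      ((D.contDiffAt_locF (hB.mem_locO _ hw.2)).fderiv_right (m := 0) (by simp)).continuousAt
      (by fun_prop)
  have h2 : ContinuousAt (fun w : ℝ × Euc m => D.tubeDer x₀ w.2) w :=
    ((h1.clm_comp continuousAt_const).add continuousAt_const).clm_comp continuousAt_const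
  have h3 : ContinuousAt (fun w : ℝ × Euc m => (D.tubeDer x₀ w.2).det) w :=
    ContinuousAt.comp (g := fun A : Euc (m + 1) →L[ℝ] Euc (m + 1) => A.det)
      ContinuousLinearMap.continuous_det.continuousAt h2
  exact h3.abs.continuousWithinAt

theorem continuousOn_tubePt (hB : D.IsBox Ω x₀ h h' r η X) : ContinuousOn (D.tubePt x₀)
    (Ioo (-η) η ×ˢ Metric.ball (extChartAt (𝓡 m) x₀ x₀) r) :=
  (continuousOn_extChartAt_symm (D.map 0 x₀)).comp hB.continuousOn_tube hB.mem_target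

/-- Compact subsets of the image correspond to compact sets of coordinates. -/
theorem isCompact_preimage (hB : D.IsBox Ω x₀ h h' r η X) {K : Set M} (hK : IsCompact K)
    (hKU : K ⊆ D.tubePt x₀ '' (Ioo (-η) η ×ˢ Metric.ball (extChartAt (𝓡 m) x₀ x₀) r)) :
    IsCompact (Ioo (-η) η ×ˢ Metric.ball (extChartAt (𝓡 m) x₀ x₀) r ∩ D.tubePt x₀ ⁻¹' K) := by
  set B := Ioo (-η) η ×ˢ Metric.ball (extChartAt (𝓡 m) x₀ x₀) r with hBd
  have h1 : Topology.IsOpenEmbedding (B.domRestrict (D.tubePt x₀)) := by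
    refine Topology.IsOpenEmbedding.of_continuous_injective_isOpenMap
      hB.continuousOn_tubePt.domRestrict hB.injOn_tubePt.injective fun W hW => ?_
    rw [domRestrict_eq, image_comp]
    exact hB.isOpen_image_tubePt (Subtype.coe_image_subset _ _)
      ((isOpen_Ioo.prod Metric.isOpen_ball).isOpenMap_subtype_val W hW)
  have h2 : IsCompact (B.domRestrict (D.tubePt x₀) ⁻¹' K) :=
    (h1.isInducing.isCompact_preimage_iff (by rwa [range_domRestrict])).2 hK
  convert h2.image continuous_subtype_val using 1
  ext w
  exact ⟨fun hw => ⟨⟨w, hw.1⟩, hw.2, rfl⟩, fun ⟨v, hv, hvw⟩ => hvw ▸ ⟨v.2, hv⟩⟩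

variable [MeasurableSpace M] [BorelSpace M] [SecondCountableTopology M]

/-- Integrals over `M` in the coordinates `(z, y)`. -/
theorem integral_eq (hB : D.IsBox Ω x₀ h h' r η X) {f : M → ℝ}
    (hf : AEStronglyMeasurable f (riemannianMeasure g.tensor))
    (h0 : ∀ x ∉ D.tubePt x₀ '' (Ioo (-η) η ×ˢ Metric.ball (extChartAt (𝓡 m) x₀ x₀) r), f x = 0) :
    ∫ x, f x ∂riemannianMeasure g.tensor =
      ∫ w in Ioo (-η) η ×ˢ Metric.ball (extChartAt (𝓡 m) x₀ x₀) r,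
        D.tubeDensity x₀ w * f (D.tubePt x₀ w) := by
  set B := Ioo (-η) η ×ˢ Metric.ball (extChartAt (𝓡 m) x₀ x₀) r with hBd
  set p₀ := D.map 0 x₀ with hp₀
  have hBm : MeasurableSet B := measurableSet_Ioo.prod measurableSet_ball
  have h1 : ∫ x, f x ∂riemannianMeasure g.tensor = ∫ v in (extChartAt (𝓡 (m + 1)) p₀).target,
      density (gAt g) p₀ v * f ((extChartAt (𝓡 (m + 1)) p₀).symm v) := by
    refine integral_riemannianMeasure (β := gAt g) (continuousOn_density_metric g p₀) hf
      fun x hx => h0 x fun hx' => hx ?_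
    rw [hB.image_tubePt subset_rfl] at hx'
    exact hx'.1
  have h2 : D.tube x₀ '' B ⊆ (extChartAt (𝓡 (m + 1)) p₀).target :=
    image_subset_iff.2 hB.mem_target
  have h3 : ∫ v in D.tube x₀ '' B, density (gAt g) p₀ v * f ((extChartAt (𝓡 (m + 1)) p₀).symm v) =
      ∫ v in (extChartAt (𝓡 (m + 1)) p₀).target,
        density (gAt g) p₀ v * f ((extChartAt (𝓡 (m + 1)) p₀).symm v) := by
    refine (setIntegral_eq_of_subset_of_forall_sdiff_eq_zero
      (isOpen_extChartAt_target p₀).measurableSet h2 ?_).symm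
    rintro v ⟨hv, hv'⟩
    rw [h0, mul_zero]
    rintro ⟨w, hw, hwv⟩
    refine hv' ⟨w, hw, ?_⟩
    exact (extChartAt (𝓡 (m + 1)) p₀).symm.injOn (hB.mem_target w hw) hv hwv
  have h4 : D.tube x₀ '' B = (fun w => D.tube x₀ (consEquiv m w)) '' (consEquiv m ⁻¹' B) := by
    rw [← image_image (D.tube x₀) (consEquiv m), image_preimage_eq _ (consEquiv m).surjective]
  have hm : Measurable (consEquiv m) := (consEquiv m).continuous.measurable
  have h5 := integral_image_eq_integral_abs_det_fderiv_smul volume (hm hBm)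
    (f := fun w => D.tube x₀ (consEquiv m w)) (f' := fun w => D.tubeDer x₀ (consEquiv m w).2)
    (fun w hw => (D.hasFDerivAt_tube (hB.mem_locO _ hw.2)).hasFDerivWithinAt)
    (fun v hv w hw hvw => (consEquiv m).injective (hB.isGraph.injOn hv hw hvw))
    (fun v => density (gAt g) p₀ v * f ((extChartAt (𝓡 (m + 1)) p₀).symm v))
  rw [h1, ← h3, h4, h5]
  have h6 := measurePreserving_consEquiv.setIntegral_preimage_emb
    (consEquiv m).toHomeomorph.measurableEmbedding
    (fun w => D.tubeDensity x₀ w * f (D.tubePt x₀ w)) B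
  rw [← h6]
  refine setIntegral_congr_fun (hm hBm) fun w _ => ?_
  simp only [tubeDensity, smul_eq_mul, tubePt, mul_assoc]
  rfl

end IsBox

end Deformation

end Schlaefli

end

noncomputable section

namespace Schlaefli

namespace Deformation

/-! ### The derivative of the volume of the domains -/

variable {m : ℕ} {M : Type*} [TopologicalSpace M] [ChartedSpace (Euc (m + 1)) M]
  [IsManifold (𝓡 (m + 1)) ∞ M] {N : Type*} [TopologicalSpace N] [ChartedSpace (Euc m) N]
  {g : Metric (m + 1) M} {D : Deformation g N} {x₀ : N}

/-- Only the points close to the image of the support of the deformation change sides. -/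
theorem Bounds.eventually_mem_iff [MeasurableSpace M] {Ω : ℝ → Set M} (hΩ : D.Bounds Ω)
    {K : Set N} (hK : IsCompact K)
    (hc : ∀ t ∈ Ioo (-D.ε) D.ε, ∀ x ∉ K, D.map t x = D.map 0 x) {V : Set M} (hV : IsOpen V)
    (hKV : D.map 0 '' K ⊆ V) :
    ∀ᶠ t in 𝓝 (0 : ℝ), ∀ p ∉ V, p ∉ range (D.map 0) → (p ∈ Ω t ↔ p ∈ Ω 0) := by
  have h1 : ∀ᶠ t in 𝓝 (0 : ℝ), ∀ x ∈ K, D.map t x ∈ V :=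
    hK.eventually_forall_of_forall_eventually fun x hx =>
      (D.continuousAt_map D.zero_mem x).preimage_mem_nhds
        (hV.mem_nhds (hKV (mem_image_of_mem _ hx)))
  obtain ⟨δ, hδ, hδs⟩ := Metric.mem_nhds_iff.1 (h1.and (isOpen_Ioo.mem_nhds D.zero_mem))
  rw [Real.ball_eq_Ioo, zero_sub, zero_add] at hδs
  have h0 : (0 : ℝ) ∈ Ioo (-δ) δ := ⟨neg_lt_zero.2 hδ, hδ⟩
  filter_upwards [isOpen_Ioo.mem_nhds h0] with t ht p hpV hp
  refine iff_of_locally_constant (P := fun t => p ∈ Ω t) (fun s hs => ?_) ht h0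
  refine hΩ.locally_constant s (hδs hs).2 p ?_
  rintro ⟨x, rfl⟩
  by_cases hx : x ∈ K
  · exact hpV ((hδs hs).1 x hx)
  · exact hp ⟨x, (hc s (hδs hs).2 x hx).symm⟩

variable [IsManifold (𝓡 m) ∞ N]

/-- The normal speed of the graphs, with respect to the volume element of `M`. -/
theorem IsBox.tubeDensity_mul {Ω : ℝ → Set M} {h : ℝ → Euc m → ℝ} {h' : Euc m → ℝ} {r η : ℝ}
    {X : Set (Euc m)} (hB : D.IsBox Ω x₀ h h' r η X) {y : Euc m}
    (hy : y ∈ Metric.ball (extChartAt (𝓡 m) x₀ x₀) r) :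
    D.tubeDensity x₀ (0, y) * h' y =
      density D.areaForm x₀ y * D.normalSpeed 0 ((extChartAt (𝓡 m) x₀).symm y) := by
  have hz := hB.mem_locO y hy
  have hyt : y ∈ (extChartAt (𝓡 m) x₀).target := hz.2.1
  have hxs := (extChartAt (𝓡 m) x₀).map_target hyt
  have h1 := D.density_areaForm hxs hz.2.2
  have h2 := D.normalSpeed_chart D.zero_mem hxs hz.2.2
  rw [(extChartAt (𝓡 m) x₀).right_inv hyt] at h1 h2
  obtain ⟨w, hw⟩ := hB.isGraph.deriv_eq y hy
  have h3 := congrArg (fun v => gB g (D.map 0 x₀) (D.locF x₀ (D.map 0 x₀) (0, y)) v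
    (D.locY x₀ (D.map 0 x₀) (0, y))) hw
  simp only [map_add, map_smul, add_apply, smul_apply, smul_eq_mul] at h3
  rw [D.orth_locF hz, add_zero] at h3
  rw [D.tubeDensity_zero hz, abs_of_pos (hB.inner_pos y hy), h1, h2, h3]
  ring

variable [SecondCountableTopology M] [MeasurableSpace M] [BorelSpace M]
  [SecondCountableTopology N] [MeasurableSpace N] [BorelSpace N]

/-- The derivative of the localized volume of the domains: only the part of the boundary in the
coordinate domain contributes. -/
theorem IsBox.hasDerivAt_integral {Ω : ℝ → Set M} (hΩ : D.Bounds Ω) {h : ℝ → Euc m → ℝ}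
    {h' : Euc m → ℝ} {r η : ℝ} {X : Set (Euc m)} (hB : D.IsBox Ω x₀ h h' r η X) {χ : M → ℝ}
    (hχ : Continuous χ) (hχc : HasCompactSupport χ)
    (hχs : tsupport χ ⊆ D.tubePt x₀ '' (Ioo (-η) η ×ˢ Metric.ball (extChartAt (𝓡 m) x₀ x₀) r)) :
    HasDerivAt (fun t => ∫ p, (Ω t).indicator χ p ∂riemannianMeasure g.tensor)
      (∫ x, χ (D.map 0 x) * D.normalSpeed 0 x ∂D.area) 0 := by
  set B := Ioo (-η) η ×ˢ Metric.ball (extChartAt (𝓡 m) x₀ x₀) r with hBd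
  have hBo : IsOpen B := isOpen_Ioo.prod Metric.isOpen_ball
  have hη := hB.isGraph.η_pos
  have hχ0 : ∀ p ∉ D.tubePt x₀ '' B, χ p = 0 := fun p hp =>
    image_eq_zero_of_notMem_tsupport fun h => hp (hχs h)
  obtain ⟨hk, hkc⟩ := continuous_indicator_of_isCompact
    (f := fun w => D.tubeDensity x₀ w * χ (D.tubePt x₀ w)) hBo
    (hB.continuousOn_tubeDensity.mul (hχ.comp_continuousOn hB.continuousOn_tubePt))
    (hB.isCompact_preimage hχc hχs)
    (fun w hw hwC => by
      rw [image_eq_zero_of_notMem_tsupport fun h => hwC ⟨hw, h⟩, mul_zero]) inter_subset_left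
  have key := hB.isGraph.hasDerivAt_integral hk hkc (A := fun t => D.tubePt x₀ ⁻¹' Ω t) hB.side
  have hmem0 : ∀ y ∈ Metric.ball (extChartAt (𝓡 m) x₀ x₀) r, ((0 : ℝ), y) ∈ B := fun y hy =>
    ⟨⟨neg_lt_zero.2 hη, hη⟩, hy⟩
  have hcont : Continuous (D.map 0) := continuous_iff_continuousAt.2 fun x =>
    (D.mdifferentiableAt_map D.zero_mem x).continuousAt
  have htube : ∀ y ∈ Metric.ball (extChartAt (𝓡 m) x₀ x₀) r, D.tubePt x₀ (0, y) =
      D.map 0 ((extChartAt (𝓡 m) x₀).symm y) := fun y hy => by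
    rw [tubePt, tube, zero_smul, add_zero, D.symm_locF (hB.mem_locO y hy)]
  have hsub : Metric.ball (extChartAt (𝓡 m) x₀ x₀) r ⊆ (extChartAt (𝓡 m) x₀).target :=
    fun y hy => (hB.mem_locO y hy).2.1
  -- The integral over `N` is carried by the coordinate ball.
  have hN : ∫ x, χ (D.map 0 x) * D.normalSpeed 0 x ∂D.area =
      ∫ y in Metric.ball (extChartAt (𝓡 m) x₀ x₀) r,
        B.indicator (fun w => D.tubeDensity x₀ w * χ (D.tubePt x₀ w)) (0, y) * h' y := by
    have h0 : ∀ x, χ (D.map 0 x) ≠ 0 → x ∈ (extChartAt (𝓡 m) x₀).source ∧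
        extChartAt (𝓡 m) x₀ x ∈ Metric.ball (extChartAt (𝓡 m) x₀ x₀) r := by
      intro x hx
      have h1 : D.map 0 x ∈ D.tubePt x₀ '' B := by
        by_contra hx'
        exact hx (hχ0 _ hx')
      obtain ⟨w, hw, hwx⟩ := h1
      obtain ⟨h2, h3⟩ := hB.eq_of_eq w hw x hwx.symm
      exact ⟨h2, by rw [h3] at hw; exact hw.2⟩
    rw [area_eq, integral_riemannianMeasure (β := D.areaForm) (p := x₀)
      (f := fun x => χ (D.map 0 x) * D.normalSpeed 0 x)
      (D.density_areaForm_continuousOn x₀)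
      ((hχ.comp hcont).mul D.continuous_normalSpeed).aestronglyMeasurable fun x hx => by
        by_contra hne
        exact hx (h0 x (left_ne_zero_of_mul hne)).1,
      setIntegral_eq_of_subset_of_forall_sdiff_eq_zero
        (isOpen_extChartAt_target x₀).measurableSet hsub]
    · refine setIntegral_congr_fun measurableSet_ball fun y hy => ?_
      rw [indicator_of_mem (hmem0 y hy), htube y hy]
      have := hB.tubeDensity_mul hy
      linear_combination -χ (D.map 0 ((extChartAt (𝓡 m) x₀).symm y)) * this
    · rintro y ⟨hy, hy'⟩
      by_contra hne
      have := (h0 _ (left_ne_zero_of_mul (right_ne_zero_of_mul hne))).2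
      rw [(extChartAt (𝓡 m) x₀).right_inv hy] at this
      exact hy' this
  rw [hN]
  refine key.congr_of_eventuallyEq ?_
  filter_upwards [isOpen_Ioo.mem_nhds D.zero_mem] with t ht
  have hnull := hΩ.nullMeasurableSet D ht
  rw [hB.integral_eq (hχ.aestronglyMeasurable.indicator₀ hnull) fun p hp => by
    rw [indicator_apply_eq_zero]; exact fun _ => hχ0 p hp]
  refine setIntegral_congr_fun hBo.measurableSet fun w hw => ?_
  by_cases hwt : w ∈ D.tubePt x₀ ⁻¹' Ω t
  · rw [indicator_of_mem hwt, indicator_of_mem hw, indicator_of_mem (mem_preimage.1 hwt)]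
  · rw [indicator_of_notMem hwt, indicator_of_notMem (show D.tubePt x₀ w ∉ Ω t from hwt), mul_zero]

/-- The derivative of the volume of the domains is the integral of the normal speed. -/
theorem Bounds.hasDerivAt_volume [T2Space M] [T2Space N] {Ω : ℝ → Set M} (hΩ : D.Bounds Ω) :
    HasDerivAt (fun t => (riemannianMeasure g.tensor).real (Ω t))
      (∫ x, D.normalSpeed 0 x ∂D.area) 0 := by
  have := D.isLocallyFiniteMeasure_area
  have : IsLocallyFiniteMeasure (riemannianMeasure g.tensor) :=
    isLocallyFiniteMeasure_riemannianMeasure (β := gAt g) (continuousOn_density_metric g)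
  have : LocallyCompactSpace M := ChartedSpace.locallyCompactSpace (Euc (m + 1)) M
  have hcont : Continuous (D.map 0) := continuous_iff_continuousAt.2 fun x =>
    (D.mdifferentiableAt_map D.zero_mem x).continuousAt
  obtain ⟨K, hK, hc⟩ := D.compact_support
  have hKc := hK.image hcont
  choose h h' r η X hB using hΩ.exists_isBox D
  set U : N → Set M := fun x =>
    D.tubePt x '' (Ioo (-(η x)) (η x) ×ˢ Metric.ball (extChartAt (𝓡 m) x x) (r x)) with hU
  have hUo : ∀ x, IsOpen (U x) := fun x =>
    (hB x).isOpen_image_tubePt subset_rfl (isOpen_Ioo.prod Metric.isOpen_ball)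
  have hUx : ∀ x, D.map 0 x ∈ U x := fun x => by
    refine ⟨(0, extChartAt (𝓡 m) x x), ⟨⟨neg_lt_zero.2 (hB x).isGraph.η_pos,
      (hB x).isGraph.η_pos⟩, Metric.mem_ball_self (hB x).isGraph.r_pos⟩, ?_⟩
    rw [tubePt, tube, zero_smul, add_zero, D.locF_self,
      (extChartAt (𝓡 (m + 1)) (D.map 0 x)).left_inv (mem_extChartAt_source _)]
  obtain ⟨s, hs⟩ := hKc.elim_finite_subcover U hUo (by
    rintro _ ⟨x, -, rfl⟩
    exact mem_iUnion.2 ⟨x, hUx x⟩)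
  obtain ⟨T, hT, hKT, hTU⟩ := exists_compact_between hKc
    (isOpen_biUnion fun x (_ : x ∈ s) => hUo x) hs
  obtain ⟨χ, hχs, hχ1, -, hχc⟩ := exists_continuous_sum_one_of_isOpen_isCompact
    (s := fun i => U (s.equivFin.symm i)) (fun i => hUo _) hT (by
      intro p hp
      obtain ⟨x, hx, hpx⟩ := mem_iUnion₂.1 (hTU hp)
      exact mem_iUnion.2 ⟨s.equivFin ⟨x, hx⟩, by simpa using hpx⟩)
  have hχ1' : ∀ p ∈ T, ∑ i, χ i p = 1 := fun p hp => by
    have := hχ1 hp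
    simpa using this
  -- Localized near `φ_0 K` by the functions `χ i`, which add up to `1` on a neighbourhood `T`.
  have hd := HasDerivAt.fun_sum fun i (_ : i ∈ Finset.univ) =>
    (hB (s.equivFin.symm i)).hasDerivAt_integral hΩ (χ i).continuous (hχc i) (hχs i)
  -- The derivatives of the localized volumes add up to the integral of the normal speed.
  have hsum : ∑ i, ∫ x, χ i (D.map 0 x) * D.normalSpeed 0 x ∂D.area =
      ∫ x, D.normalSpeed 0 x ∂D.area := by
    have hK0 : ∀ x ∉ K, D.normalSpeed 0 x = 0 := fun x hx =>
      D.normalSpeed_eq_zero hc D.zero_mem hx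
    rw [← integral_finsetSum]
    · refine integral_congr_ae (Filter.Eventually.of_forall fun x => ?_)
      simp only
      rw [← Finset.sum_mul]
      by_cases hx : x ∈ K
      · rw [hχ1' _ (interior_subset (hKT (mem_image_of_mem _ hx))), one_mul]
      · rw [hK0 x hx, mul_zero]
    · intro i _
      exact (((χ i).continuous.comp hcont).mul
        D.continuous_normalSpeed).integrable_of_hasCompactSupport
        (HasCompactSupport.intro hK fun x hx => by
          rw [Pi.mul_apply, hK0 x hx, mul_zero])
  rw [← hsum]
  -- The remaining part of the volume is constant.
  have hev : ∀ᶠ t in 𝓝 (0 : ℝ), (riemannianMeasure g.tensor).real (Ω t) =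
      (∑ i, ∫ p, (Ω t).indicator (χ i) p ∂riemannianMeasure g.tensor) +
        ∫ p, (Ω 0).indicator (fun p => 1 - ∑ i, χ i p) p ∂riemannianMeasure g.tensor := by
    filter_upwards [hΩ.eventually_mem_iff hK hc isOpen_interior hKT,
      isOpen_Ioo.mem_nhds D.zero_mem] with t hmem ht
    have hnull := hΩ.nullMeasurableSet D ht
    have hae : (Ω t).indicator (fun p => 1 - ∑ i, χ i p) =ᵐ[riemannianMeasure g.tensor]
        (Ω 0).indicator (fun p => 1 - ∑ i, χ i p) := by
      filter_upwards [measure_eq_zero_iff_ae_notMem.1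
        (D.riemannianMeasure_range D.zero_mem)] with p hp
      by_cases hpT : p ∈ T
      · simp only [indicator, hχ1' p hpT, sub_self, ite_self]
      · have := hmem p (fun h => hpT (interior_subset h)) hp
        by_cases hpt : p ∈ Ω t
        · rw [indicator_of_mem hpt, indicator_of_mem (this.1 hpt)]
        · rw [indicator_of_notMem hpt, indicator_of_notMem fun h => hpt (this.2 h)]
    rw [← integral_congr_ae hae]
    have hχi : ∀ i, Integrable ((Ω t).indicator (χ i)) (riemannianMeasure g.tensor) := fun i =>
      ((χ i).continuous.integrable_of_hasCompactSupport (hχc i)).indicator₀ hnull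
    have h1 : Integrable ((Ω t).indicator fun _ => (1 : ℝ)) (riemannianMeasure g.tensor) :=
      IntegrableOn.integrable_indicator₀ (integrableOn_const (hΩ.finite_volume t ht)) hnull
    have h2 : (Ω t).indicator (fun p => 1 - ∑ i, χ i p) = fun p =>
        (Ω t).indicator (fun _ => (1 : ℝ)) p - ∑ i, (Ω t).indicator (χ i) p := by
      funext p
      by_cases hp : p ∈ Ω t
      · simp only [indicator_of_mem hp]
      · simp only [indicator_of_notMem hp, Finset.sum_const_zero, sub_zero]
    rw [h2, integral_sub h1 (integrable_finsetSum _ fun i _ => hχi i),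
      integral_finsetSum _ fun i _ => hχi i, integral_indicator₀ hnull, setIntegral_const,
      smul_eq_mul, mul_one]
    ring
  exact (hd.add_const _).congr_of_eventuallyEq hev

end Deformation

end Schlaefli

end


namespace Schlaefli

/-! ### Einstein manifolds -/

/-- The scalar curvature of an Einstein metric on a manifold of dimension `n` is `c n`. -/
theorem scalarCurvature_eq {n : ℕ} {M : Type*} [TopologicalSpace M] [ChartedSpace (Euc n) M]
    [IsManifold (𝓡 n) ∞ M] (g : Metric n M) {c : ℝ}
    (hE : ∀ (p : M) (Y Z : TangentSpace (𝓡 n) p), ricci g.tensor p Y Z = c * g.tensor p Y Z)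
    (p : M) : scalarCurvature g.tensor p = c * n := by
  have h1 : gram (ricci g.tensor) p = c • gram g.tensor p := by
    ext i j
    exact hE p _ _
  have h2 : IsUnit (gram g.tensor p).det := by
    refine isUnit_det_of_pos fun u hu => ?_
    have := gAt_pos g p (WithLp.toLp 2 u) (by simpa using hu)
    rw [compMat_mulVec] at this
    exact this
  rw [scalarCurvature, traceWith, h1, Matrix.mul_smul, Matrix.nonsing_inv_mul _ h2,
    Matrix.trace_smul, Matrix.trace_one, Fintype.card_fin, smul_eq_mul]

end Schlaefli

theorem mainTheorem1 (m : ℕ) (hm : 2 ≤ m)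
    {M : Type*} [TopologicalSpace M] [T2Space M] [SecondCountableTopology M]
    [ChartedSpace (EuclideanSpace ℝ (Fin (m + 1))) M] [IsManifold (𝓡 (m + 1)) ∞ M]
    [MeasurableSpace M] [BorelSpace M]
    {N : Type*} [TopologicalSpace N] [T2Space N] [SecondCountableTopology N]
    [ChartedSpace (EuclideanSpace ℝ (Fin m)) N] [IsManifold (𝓡 m) ∞ N]
    [MeasurableSpace N] [BorelSpace N]
    (g : Schlaefli.Metric (m + 1) M) (S : ℝ)
    (hE : Schlaefli.IsEinstein g.tensor)
    (hS : ∀ p : M, Schlaefli.scalarCurvature g.tensor p = S)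
    (D : Schlaefli.Deformation g N)
    (v : ∀ x : N, TangentSpace (𝓡 (m + 1)) (D.map 0 x)) (hv : ∀ x : N, D.velocity 0 x = v x) :
    (∀ (x : N) (X Y : TangentSpace (𝓡 m) x),
      DifferentiableAt ℝ (fun t => D.firstForm t x X Y) 0) ∧
    (∀ x : N, DifferentiableAt ℝ (fun t => D.meanCurvature t x) 0) ∧
    Integrable (fun x => D.meanCurvatureVar x +
      (1 / 2) * Schlaefli.innerWith (D.firstForm 0) D.firstFormVar (D.secondForm 0) x) D.area ∧
    ∃ V' : ℝ,
      HasDerivAt D.sweptVolume V' 0 ∧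
      (∀ Ω : ℝ → Set M, D.Bounds Ω →
        HasDerivAt (fun t => (Schlaefli.riemannianMeasure g.tensor).real (Ω t)) V' 0) ∧
      S / (m + 1) * V' = ∫ x, (D.meanCurvatureVar x +
        (1 / 2) * Schlaefli.innerWith (D.firstForm 0) D.firstFormVar (D.secondForm 0) x)
          ∂D.area := by
  obtain ⟨c, hc⟩ := hE
  obtain ⟨h1, h2⟩ := D.integral_integrand hc
  refine ⟨fun x X Y => D.differentiableAt_firstForm x X Y, D.differentiableAt_meanCurvature, h1,
    ∫ x, D.normalSpeed 0 x ∂D.area, D.hasDerivAt_sweptVolume, fun Ω hΩ => hΩ.hasDerivAt_volume, ?_⟩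
  refine Eq.trans ?_ h2.symm
  rcases isEmpty_or_nonempty N with hN | ⟨⟨x⟩⟩
  · simp [integral_of_isEmpty]
  · have h3 := hS (D.map 0 x)
    rw [Schlaefli.scalarCurvature_eq g hc] at h3
    rw [← h3]
    push_cast
    have h4 : (m : ℝ) + 1 ≠ 0 := by positivity
    field_simp
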